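/- **Setting.** Let $V$ be a finite nonempty set, $n=|V|$, and let $f:2^V\to\mathbb Z$ be submodular, i.e. $f(X)+f(Y)\ge f(X\cup Y)+f(X\cap Y)$ for all $X,Y\subseteq V$, with $f(\emptyset)=0$, given by an evaluation oracle. Let $M\ge 1$ be a real number with $|f(X)|\le M$ for all $X\subseteq V$, and assume $nM\ge 2$. Write $B(f)=\{x\in\mathbb R^V: x(V)=f(V),\ x(X)\le f(X)\ \forall X\subseteq V\}$, where $x(X)=\sum_{v\in X}x(v)$. The extreme base generated by a linear ordering $L=(v_1,\dots,v_n)$ is $y(v_i)=f(L(v_i))-f(L(v_{i-1}))$, where $L(v_i)=\{v_1,\dots,v_i\}$ and $L(v_0)=\emptyset$. **Algorithm SFM.** It maintains linear orderings $L_i$ $(i\in I)$ with the extreme bases $y_i$ that they generate, coefficients $\lambda_i$ with $\sum_i\lambda_i=1$, $x=\sum_{i\in I}\lambda_iy_i\in B(f)$, a skew-symmetric flow $\varphi:V\times V\to\mathbb R$ with boundary $\partial\varphi(v)=\sum_u\varphi(u,v)$, and a parameter $\delta$. It starts with one arbitrary ordering, $\varphi=0$ and $\delta=M$, and performs scaling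 phases while $\delta\ge 1/n^2$. A phase replaces $\delta$ by $\delta/2$ and each $\varphi(u,v)$ by the nearest value in $[-\delta,\delta]$. Throughout it uses $S=\{v: x(v)\le\partial\varphi(v)-\delta\}$, $T=\{v: x(v)\ge\partial\varphi(v)+\delta\}$, and the set $W$ of vertices reachable from $S$ along arcs $(u,v)$, $u\ne v$, with $\varphi(u,v)\le 0$. A pair $(i,v)$ is active if $v$ is the last vertex of $V\setminus W$ in $L_i$ that has a vertex of $W$ after it. As long as $S,T\neq\emptyset$, the phase repeats the following. 1. While $W\cap T=\emptyset$ and there is an active pair $(i,v)$, with $u$ the successor of $v$ in $L_i$, it applies $\mathrm{Push}(i,u,v)$: put $c=f(L_i(u)\setminus\{v\})-f(L_i(u))+y_i(v)$ and $\alpha=\min\{\delta,\lambda_ic\}$; decrease $\varphi(u,v)$ and increase $\varphi(v,u)$ by $\alpha$; if $\alpha<\lambda_ic$, add to $I$ a copy $k$ of $i$ with $\lambda_k=\lambda_i-\alpha/c$ and set $\lambda_i=\alpha/c$; then add $c(\chi_u-\chi_v)$ to $y_i$, interchange $u,v$ in $L_i$, and add $\alpha(\chi_u-\chi_v)$ to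 $x$. 2. If $W\cap T\ne\emptyset$, it augments $\varphi$ by $\delta$ along a path from $S$ to $T$ inside the residual graph just described. 3. By Gaussian elimination it reduces $x=\sum_{i\in I}\lambda_iy_i$ to affinely independent $y_i$ with $\lambda_i>0$. The phase ends when $S=\emptyset$, or $T=\emptyset$, or there is neither a path from $S$ to $T$ nor an active pair. After the last phase the output is $\emptyset$ if $S=\emptyset$, otherwise $V$ if $T=\emptyset$, and otherwise $W$. **Theorem.** Algorithm SFM runs in $O(n^5\log(nM))$ time. More precisely, implement SFM as one explicit program, the same for all inputs, on a random access machine on which every memory access, arithmetic operation or comparison of real numbers, constant, test and oracle call takes one elementary step. There is an absolute constant $C>0$ such that for all $V,f,M$ as above and every initial linear ordering of $V$ the program halts, its output minimizes $f$, and * it takes at most $C\,n^5\log(nM)$ elementary steps; * it performs at most $C\log(nM)$ scaling phases; * it performs at most $Cn^2$ augmentations in each phase; * between consecutive events of the form "start of the run, start of a phase, augmentation, end of the run" it takes at most $Cn^3$ elementary steps; these include all pushes and the reductions of the convex combination. -/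

import Mathlib

/-! ## Submodular set functions -/

/-- `f(X) + f(Y) ≥ f(X ∪ Y) + f(X ∩ Y)` for all `X, Y ⊆ V`. -/
def IsSubmodular {V : Type*} [DecidableEq V] (f : Finset V → ℤ) : Prop :=
  ∀ X Y : Finset V, f (X ∪ Y) + f (X ∩ Y) ≤ f X + f Y

/-! ## The machine model

A structured unit-cost random access machine with real arithmetic and an evaluation oracle.
The memory consists of finitely many named two-dimensional arrays whose entries are natural
numbers (vertices, indices, flags) or real numbers.  A scalar is the entry `(0, 0)` of an array
and a vector is its column `0`.  Reading or writing one entry, one arithmetic operation, one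
comparison, one logical connective, one constant and one oracle call take one elementary step each.
The naturals can only be incremented and decremented, and there is no rounding of reals. -/

namespace SFM

/-- Names of the arrays of natural numbers. -/
inductive NArr
  | n | k | L | que | qh | qt | inT | inW | par | hit | tgt | nS | nT
  | i | j | p | q | r | c | v | w | a | b | u | s | t | go | chg
  | bas | keep | kk | qry | out
  deriving DecidableEq

/-- Names of the arrays of real numbers. -/
inductive RArr
  | M | delta | phi | x | y | lam | z | g | h | cap | alpha | tab | d | theta
  deriving DecidableEq

/-- Expressions with natural values. -/
inductive NExp
  | lit (m : ℕ)
  | rd (A : NArr) (i j : NExp)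
  | succ (e : NExp)
  | pred (e : NExp)

/-- Expressions with real values. -/
inductive RExp
  | lit (m : ℕ)
  | rd (A : RArr) (i j : NExp)
  | ofNat (e : NExp)
  | add (e e' : RExp)
  | sub (e e' : RExp)
  | mul (e e' : RExp)
  | div (e e' : RExp)

/-- Tests. -/
inductive BExp
  | nlt (e e' : NExp)
  | neq (e e' : NExp)
  | rlt (e e' : RExp)
  | rle (e e' : RExp)
  | not (t : BExp)
  | and (t t' : BExp)
  | or (t t' : BExp)

/-- Labels that mark, free of charge, the start of a scaling phase and an augmentation. -/
inductive Label
  | phase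
  | augmentation
  deriving DecidableEq

/-- Events of a computation: an elementary step, or the passing of a label. -/
inductive Event
  | step
  | mark (l : Label)
  deriving DecidableEq

/-- Programs. `query A i j` writes to the entry `(i, j)` of `A` the value of the oracle at the set
whose indicator vector is held (as zeros and nonzeros) by the array `qry`. -/
inductive Cmd
  | skip
  | setN (A : NArr) (i j : NExp) (e : NExp)
  | setR (A : RArr) (i j : NExp) (e : RExp)
  | query (A : RArr) (i j : NExp)
  | mark (l : Label)
  | seq (c c' : Cmd)
  | ite (t : BExp) (c c' : Cmd)
  | while (t : BExp) (c : Cmd)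

/-- The memory. -/
structure Mem where
  nat : NArr → ℕ → ℕ → ℕ
  real : RArr → ℕ → ℕ → ℝ

/-- Write `m` to the entry `(i, j)` of `A`. -/
def Mem.setN (s : Mem) (A : NArr) (i j m : ℕ) : Mem :=
  { s with nat := fun A' i' j' => if A' = A ∧ i' = i ∧ j' = j then m else s.nat A' i' j' }

/-- Write `a` to the entry `(i, j)` of `A`. -/
def Mem.setR (s : Mem) (A : RArr) (i j : ℕ) (a : ℝ) : Mem :=
  { s with real := fun A' i' j' => if A' = A ∧ i' = i ∧ j' = j then a else s.real A' i' j' }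

/-- The set that is held by the query array. -/
def Mem.querySet (s : Mem) : Set ℕ := {m | s.nat .qry m 0 ≠ 0}

def NExp.eval (s : Mem) : NExp → ℕ
  | lit m => m
  | rd A i j => s.nat A (i.eval s) (j.eval s)
  | succ e => e.eval s + 1
  | pred e => e.eval s - 1

noncomputable def RExp.eval (s : Mem) : RExp → ℝ
  | lit m => m
  | rd A i j => s.real A (i.eval s) (j.eval s)
  | ofNat e => e.eval s
  | add e e' => e.eval s + e'.eval s
  | sub e e' => e.eval s - e'.eval s
  | mul e e' => e.eval s * e'.eval s
  | div e e' => e.eval s / e'.eval s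

def BExp.holds (s : Mem) : BExp → Prop
  | nlt e e' => e.eval s < e'.eval s
  | neq e e' => e.eval s = e'.eval s
  | rlt e e' => e.eval s < e'.eval s
  | rle e e' => e.eval s ≤ e'.eval s
  | not t => ¬ t.holds s
  | and t t' => t.holds s ∧ t'.holds s
  | or t t' => t.holds s ∨ t'.holds s

/-- The number of elementary steps that it takes to evaluate an expression. -/
def NExp.cost : NExp → ℕ
  | lit _ => 1
  | rd _ i j => i.cost + j.cost + 1
  | succ e => e.cost + 1
  | pred e => e.cost + 1

def RExp.cost : RExp → ℕ
  | lit _ => 1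
  | rd _ i j => i.cost + j.cost + 1
  | ofNat e => e.cost + 1
  | add e e' => e.cost + e'.cost + 1
  | sub e e' => e.cost + e'.cost + 1
  | mul e e' => e.cost + e'.cost + 1
  | div e e' => e.cost + e'.cost + 1

def BExp.cost : BExp → ℕ
  | nlt e e' => e.cost + e'.cost + 1
  | neq e e' => e.cost + e'.cost + 1
  | rlt e e' => e.cost + e'.cost + 1
  | rle e e' => e.cost + e'.cost + 1
  | not t => t.cost + 1
  | and t t' => t.cost + t'.cost + 1
  | or t t' => t.cost + t'.cost + 1

/-- `m` elementary steps. -/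
def steps (m : ℕ) : List Event := List.replicate m Event.step

/-- `Exec O P s s' tr`: with the evaluation oracle `O`, the program `P` started with the memory
`s` halts with the memory `s'`, and `tr` is the list of the events of this computation. -/
inductive Exec (O : Set ℕ → ℝ) : Cmd → Mem → Mem → List Event → Prop
  | skip (s : Mem) : Exec O .skip s s []
  | setN (s : Mem) (A : NArr) (i j e : NExp) :
      Exec O (.setN A i j e) s (s.setN A (i.eval s) (j.eval s) (e.eval s))
        (steps (i.cost + j.cost + e.cost + 1))
  | setR (s : Mem) (A : RArr) (i j : NExp) (e : RExp) :
      Exec O (.setR A i j e) s (s.setR A (i.eval s) (j.eval s) (e.eval s))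
        (steps (i.cost + j.cost + e.cost + 1))
  | query (s : Mem) (A : RArr) (i j : NExp) :
      Exec O (.query A i j) s (s.setR A (i.eval s) (j.eval s) (O s.querySet))
        (steps (i.cost + j.cost + 2))
  | mark (s : Mem) (l : Label) : Exec O (.mark l) s s [.mark l]
  | seq (s s' s'' : Mem) (c c' : Cmd) (tr tr' : List Event)
      (h : Exec O c s s' tr) (h' : Exec O c' s' s'' tr') :
      Exec O (.seq c c') s s'' (tr ++ tr')
  | ite_true (s s' : Mem) (t : BExp) (c c' : Cmd) (tr : List Event)
      (ht : t.holds s) (h : Exec O c s s' tr) :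
      Exec O (.ite t c c') s s' (steps t.cost ++ tr)
  | ite_false (s s' : Mem) (t : BExp) (c c' : Cmd) (tr : List Event)
      (ht : ¬ t.holds s) (h : Exec O c' s s' tr) :
      Exec O (.ite t c c') s s' (steps t.cost ++ tr)
  | while_true (s s' s'' : Mem) (t : BExp) (c : Cmd) (tr tr' : List Event)
      (ht : t.holds s) (h : Exec O c s s' tr) (h' : Exec O (.while t c) s' s'' tr') :
      Exec O (.while t c) s s'' (steps t.cost ++ tr ++ tr')
  | while_false (s : Mem) (t : BExp) (c : Cmd) (ht : ¬ t.holds s) :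
      Exec O (.while t c) s s (steps t.cost)

/-- A program has at most one computation from a given memory. -/
theorem Exec.deterministic {O : Set ℕ → ℝ} {P : Cmd} {s s₁ s₂ : Mem} {tr₁ tr₂ : List Event}
    (h₁ : Exec O P s s₁ tr₁) (h₂ : Exec O P s s₂ tr₂) : s₁ = s₂ ∧ tr₁ = tr₂ := by
  induction h₁ generalizing s₂ tr₂ with
  | skip => cases h₂; exact ⟨rfl, rfl⟩
  | setN => cases h₂; exact ⟨rfl, rfl⟩
  | setR => cases h₂; exact ⟨rfl, rfl⟩
  | query => cases h₂; exact ⟨rfl, rfl⟩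
  | mark => cases h₂; exact ⟨rfl, rfl⟩
  | seq _ _ _ _ _ _ _ _ _ ih ih' =>
    cases h₂ with
    | seq _ _ _ _ _ _ _ h h' =>
      obtain ⟨rfl, rfl⟩ := ih h
      obtain ⟨rfl, rfl⟩ := ih' h'
      exact ⟨rfl, rfl⟩
  | ite_true _ _ _ _ _ _ ht _ ih =>
    cases h₂ with
    | ite_true _ _ _ _ _ _ _ h => obtain ⟨rfl, rfl⟩ := ih h; exact ⟨rfl, rfl⟩
    | ite_false _ _ _ _ _ _ ht' _ => exact absurd ht ht'
  | ite_false _ _ _ _ _ _ ht _ ih =>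
    cases h₂ with
    | ite_true _ _ _ _ _ _ ht' _ => exact absurd ht' ht
    | ite_false _ _ _ _ _ _ _ h => obtain ⟨rfl, rfl⟩ := ih h; exact ⟨rfl, rfl⟩
  | while_true _ _ _ _ _ _ _ ht _ _ ih ih' =>
    cases h₂ with
    | while_true _ _ _ _ _ _ _ _ h h' =>
      obtain ⟨rfl, rfl⟩ := ih h
      obtain ⟨rfl, rfl⟩ := ih' h'
      exact ⟨rfl, rfl⟩
    | while_false _ _ _ ht' => exact absurd ht ht'
  | while_false _ _ _ ht =>
    cases h₂ with
    | while_true _ _ _ _ _ _ _ ht' _ _ => exact absurd ht' ht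
    | while_false => exact ⟨rfl, rfl⟩

/-! ### Abbreviations for writing programs -/

/-- The scalar `A`, the entry `A[i]` of a vector, and the entry `A[i][j]` of a matrix. -/
def n0 (A : NArr) : NExp := .rd A (.lit 0) (.lit 0)
def n1 (A : NArr) (i : NExp) : NExp := .rd A i (.lit 0)
def n2 (A : NArr) (i j : NExp) : NExp := .rd A i j
def r0 (A : RArr) : RExp := .rd A (.lit 0) (.lit 0)
def r1 (A : RArr) (i : NExp) : RExp := .rd A i (.lit 0)
def r2 (A : RArr) (i j : NExp) : RExp := .rd A i j

/-- Assignments to a scalar, to an entry of a vector and to an entry of a matrix. -/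
def setN0 (A : NArr) (e : NExp) : Cmd := .setN A (.lit 0) (.lit 0) e
def setN1 (A : NArr) (i e : NExp) : Cmd := .setN A i (.lit 0) e
def setN2 (A : NArr) (i j e : NExp) : Cmd := .setN A i j e
def setR0 (A : RArr) (e : RExp) : Cmd := .setR A (.lit 0) (.lit 0) e
def setR1 (A : RArr) (i : NExp) (e : RExp) : Cmd := .setR A i (.lit 0) e
def setR2 (A : RArr) (i j : NExp) (e : RExp) : Cmd := .setR A i j e

/-- Ask the oracle for the value at the current query set and store it in the scalar `A`. -/
def query0 (A : RArr) : Cmd := .query A (.lit 0) (.lit 0)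

/-- Increment a scalar. -/
def inc (A : NArr) : Cmd := setN0 A (.succ (n0 A))

/-- Sequential composition of a list of programs. -/
def block : List Cmd → Cmd
  | [] => .skip
  | c :: l => .seq c (block l)

def ifThen (t : BExp) (l : List Cmd) : Cmd := .ite t (block l) .skip
def ifElse (t : BExp) (l l' : List Cmd) : Cmd := .ite t (block l) (block l')
def whileDo (t : BExp) (l : List Cmd) : Cmd := .while t (block l)

/-- `for A = 0, 1, …, e - 1 do l`. -/
def forTo (A : NArr) (e : NExp) (l : List Cmd) : Cmd :=
  block [setN0 A (.lit 0), whileDo (.nlt (n0 A) e) [block l, inc A]]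

/-! ## Algorithm SFM

Vertices are the numbers `0, …, n - 1`, and the index set is `I = {0, …, k - 1}`.  For `i ∈ I`,
`L[i][0], …, L[i][n - 1]` is the linear ordering `L_i`, row `y[i]` is the extreme base `y_i` that it
generates, and `lam[i]` is the coefficient `λ_i`.  Moreover `x = ∑ λ_i y_i`, `phi[u][v]` is the flow
`φ(u, v)` and `delta` is the scaling parameter `δ`. -/

/-- Enter the vertex `b` into `W`, reached by the residual arc `(a, b)`; `hit` records that `W`
meets `T`, in the vertex `tgt`. -/
def enterW : Cmd := block [
  setN1 .inW (n0 .b) (.lit 1),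
  setN1 .par (n0 .b) (n0 .a),
  setN1 .que (n0 .qt) (n0 .b),
  inc .qt,
  ifThen (.neq (n1 .inT (n0 .b)) (.lit 1)) [
    setN0 .hit (.lit 1),
    setN0 .tgt (n0 .b)]]

/-- Close `W` under the arcs `(a, b)` with `a ≠ b` and `φ(a, b) ≤ 0` of the residual graph, by a
breadth-first search from the vertices that wait in the queue `que[qh], …, que[qt - 1]`. -/
def closeW : Cmd :=
  whileDo (.nlt (n0 .qh) (n0 .qt)) [
    setN0 .a (n1 .que (n0 .qh)),
    inc .qh,
    forTo .b (n0 .n) [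
      ifThen (.and (.neq (n1 .inW (n0 .b)) (.lit 0))
          (.and (.not (.neq (n0 .a) (n0 .b)))
            (.rle (r2 .phi (n0 .a) (n0 .b)) (.lit 0)))) [
        enterW]]]

/-- Compute `S = {v | x(v) ≤ ∂φ(v) - δ}`, `T = {v | x(v) ≥ ∂φ(v) + δ}` and the set `W` of the
vertices that are reachable from `S` in the residual graph; `nS` and `nT` record whether `S` and
`T` are nonempty. -/
def computeSTW : Cmd := block [
  setN0 .nS (.lit 0),
  setN0 .nT (.lit 0),
  setN0 .hit (.lit 0),
  setN0 .qh (.lit 0),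
  setN0 .qt (.lit 0),
  forTo .v (n0 .n) [
    setR0 .z (r1 .x (n0 .v)),
    forTo .w (n0 .n) [
      setR0 .z (.sub (r0 .z) (r2 .phi (n0 .w) (n0 .v)))],
    setN1 .inT (n0 .v) (.lit 0),
    setN1 .inW (n0 .v) (.lit 0),
    ifThen (.rle (r0 .z) (.sub (.lit 0) (r0 .delta))) [
      setN0 .nS (.lit 1),
      setN1 .inW (n0 .v) (.lit 1),
      setN1 .par (n0 .v) (n0 .v),
      setN1 .que (n0 .qt) (n0 .v),
      inc .qt],
    ifThen (.rle (r0 .delta) (r0 .z)) [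
      setN0 .nT (.lit 1),
      setN1 .inT (n0 .v) (.lit 1)]],
  closeW]

/-- `Push(i, u, v)`, where `v = L[i][q]` and `u = L[i][q + 1]`.  When it starts, the query set is
`L_i(v)`; the exchange capacity is `cap = f(L_i(u) \ {v}) - f(L_i(u)) + y_i(v)`.  When it ends, `v` is
at position `q + 1` and the query set is the new `L_i(v)`. -/
def push : Cmd := block [
  setN1 .qry (n0 .u) (.lit 1),
  query0 .g,
  setN1 .qry (n0 .v) (.lit 0),
  query0 .h,
  setN1 .qry (n0 .v) (.lit 1),
  setR0 .cap (.add (.sub (r0 .h) (r0 .g)) (r2 .y (n0 .i) (n0 .v))),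
  ifElse (.rle (.mul (r1 .lam (n0 .i)) (r0 .cap)) (r0 .delta))
    [setR0 .alpha (.mul (r1 .lam (n0 .i)) (r0 .cap))]
    [setR0 .alpha (r0 .delta)],
  setR2 .phi (n0 .u) (n0 .v) (.sub (r2 .phi (n0 .u) (n0 .v)) (r0 .alpha)),
  setR2 .phi (n0 .v) (n0 .u) (.add (r2 .phi (n0 .v) (n0 .u)) (r0 .alpha)),
  ifThen (.rlt (r0 .alpha) (.mul (r1 .lam (n0 .i)) (r0 .cap))) [
    setR1 .lam (n0 .k) (.sub (r1 .lam (n0 .i)) (.div (r0 .alpha) (r0 .cap))),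
    setR1 .lam (n0 .i) (.div (r0 .alpha) (r0 .cap)),
    forTo .w (n0 .n) [
      setR2 .y (n0 .k) (n0 .w) (r2 .y (n0 .i) (n0 .w)),
      setN2 .L (n0 .k) (n0 .w) (n2 .L (n0 .i) (n0 .w))],
    inc .k],
  setR2 .y (n0 .i) (n0 .u) (.add (r2 .y (n0 .i) (n0 .u)) (r0 .cap)),
  setR2 .y (n0 .i) (n0 .v) (.sub (r2 .y (n0 .i) (n0 .v)) (r0 .cap)),
  setN2 .L (n0 .i) (n0 .q) (n0 .u),
  setN2 .L (n0 .i) (.succ (n0 .q)) (n0 .v),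
  setR1 .x (n0 .u) (.add (r1 .x (n0 .u)) (r0 .alpha)),
  setR1 .x (n0 .v) (.sub (r1 .x (n0 .v)) (r0 .alpha))]

/-- After `Push(i, u, v)` the set `W` grows exactly if `(u, v)` has become a residual arc; `chg`
records that it has grown. -/
def updateW : Cmd :=
  ifThen (.rle (r2 .phi (n0 .u) (n0 .v)) (.lit 0)) [
    setN0 .a (n0 .u),
    setN0 .b (n0 .v),
    enterW,
    closeW,
    setN0 .chg (.lit 1)]

/-- Treat the active vertices of `L_i` one after the other until none is left or `W` has grown.
The ordering is scanned from its end (position `p`).  To the right of `p` the vertices of `W` come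
first, so that a vertex `v ∉ W` at position `p` is active exactly if its successor is in `W`; it is
then pushed to the right (position `q`) as long as it is active.  The query set is `L_i(L[i][q])`. -/
def scanOrdering : Cmd := block [
  forTo .w (n0 .n) [setN1 .qry (n0 .w) (.lit 1)],
  setN0 .p (n0 .n),
  whileDo (.and (.nlt (.lit 0) (n0 .p)) (.neq (n0 .chg) (.lit 0))) [
    setN0 .p (.pred (n0 .p)),
    setN0 .q (n0 .p),
    whileDo (.and (.neq (n0 .chg) (.lit 0))
        (.and (.nlt (.succ (n0 .q)) (n0 .n))
          (.and (.neq (n1 .inW (n2 .L (n0 .i) (n0 .q))) (.lit 0))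
            (.neq (n1 .inW (n2 .L (n0 .i) (.succ (n0 .q)))) (.lit 1))))) [
      setN0 .v (n2 .L (n0 .i) (n0 .q)),
      setN0 .u (n2 .L (n0 .i) (.succ (n0 .q))),
      push,
      updateW,
      inc .q],
    inc .q,
    whileDo (.nlt (n0 .p) (n0 .q)) [
      setN0 .q (.pred (n0 .q)),
      setN1 .qry (n2 .L (n0 .i) (n0 .q)) (.lit 0)]]]

/-- While `W ∩ T = ∅` and there is an active pair `(i, v)`, push. -/
def search : Cmd := block [
  setN0 .chg (.lit 1),
  whileDo (.and (.neq (n0 .chg) (.lit 1)) (.neq (n0 .hit) (.lit 0))) [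
    setN0 .chg (.lit 0),
    setN0 .i (.lit 0),
    whileDo (.and (.nlt (n0 .i) (n0 .k)) (.neq (n0 .chg) (.lit 0))) [
      scanOrdering,
      inc .i]]]

/-- Augment the flow by `δ` along the path from `S` to `tgt ∈ T` in the search forest. -/
def augment : Cmd := block [
  .mark .augmentation,
  setN0 .t (n0 .tgt),
  whileDo (.not (.neq (n1 .par (n0 .t)) (n0 .t))) [
    setN0 .s (n1 .par (n0 .t)),
    setR2 .phi (n0 .s) (n0 .t) (.add (r2 .phi (n0 .s) (n0 .t)) (r0 .delta)),
    setR2 .phi (n0 .t) (n0 .s) (.sub (r2 .phi (n0 .t) (n0 .s)) (r0 .delta)),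
    setN0 .t (n0 .s)]]

/-- A Gauss–Jordan pivot of the tableau at the entry `(r, j)`. -/
def pivot : Cmd := block [
  setR0 .d (r2 .tab (n0 .r) (n0 .j)),
  forTo .c (n0 .k) [
    setR2 .tab (n0 .r) (n0 .c) (.div (r2 .tab (n0 .r) (n0 .c)) (r0 .d))],
  forTo .w (.succ (n0 .n)) [
    ifThen (.not (.neq (n0 .w) (n0 .r))) [
      setR0 .d (r2 .tab (n0 .w) (n0 .j)),
      forTo .c (n0 .k) [
        setR2 .tab (n0 .w) (n0 .c)
          (.sub (r2 .tab (n0 .w) (n0 .c)) (.mul (r0 .d) (r2 .tab (n0 .r) (n0 .c))))]]]]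

/-- The basic column of row `w`, if `bas[w] ≠ 0`. -/
def basicCol : NExp := .pred (n1 .bas (n0 .w))

/-- Reduce `x = ∑ λ_i y_i` to affinely independent `y_i` with `λ_i > 0`.  The tableau has the
columns `(y_i, 1)`.  They are treated one after the other; `bas[w] = j + 1` if the column `j` is
basic in row `w`, and `bas[w] = 0` if row `w` has no basic column yet.  If the column `j` is
dependent on the basic ones, then `μ` with `μ_i = tab[w][j]` for the basic columns and `μ_j = -1` is
an affine dependency; one subtracts `θ μ` from `λ`, where `θ = min {λ_i / μ_i | μ_i > 0}`, and
column `j` replaces a column at which the minimum is attained.  At the end the indices with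
`λ_i > 0` among the basic ones are renumbered. -/
def reduce : Cmd := block [
  forTo .c (n0 .k) [
    forTo .w (n0 .n) [
      setR2 .tab (n0 .w) (n0 .c) (r2 .y (n0 .c) (n0 .w))],
    setR2 .tab (n0 .n) (n0 .c) (.lit 1),
    setN1 .keep (n0 .c) (.lit 0)],
  forTo .w (.succ (n0 .n)) [setN1 .bas (n0 .w) (.lit 0)],
  forTo .j (n0 .k) [
    setN0 .r (.succ (n0 .n)),
    forTo .w (.succ (n0 .n)) [
      ifThen (.and (.neq (n1 .bas (n0 .w)) (.lit 0))
          (.or (.rlt (r2 .tab (n0 .w) (n0 .j)) (.lit 0))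
            (.rlt (.lit 0) (r2 .tab (n0 .w) (n0 .j))))) [
        setN0 .r (n0 .w)]],
    ifThen (.neq (n0 .r) (.succ (n0 .n))) [
      forTo .w (.succ (n0 .n)) [
        ifThen (.and (.not (.neq (n1 .bas (n0 .w)) (.lit 0)))
            (.rlt (.lit 0) (r2 .tab (n0 .w) (n0 .j)))) [
          setR0 .d (.div (r1 .lam basicCol) (r2 .tab (n0 .w) (n0 .j))),
          ifThen (.or (.neq (n0 .r) (.succ (n0 .n))) (.rlt (r0 .d) (r0 .theta))) [
            setR0 .theta (r0 .d),
            setN0 .r (n0 .w)]]],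
      forTo .w (.succ (n0 .n)) [
        ifThen (.not (.neq (n1 .bas (n0 .w)) (.lit 0))) [
          setR1 .lam basicCol
            (.sub (r1 .lam basicCol) (.mul (r0 .theta) (r2 .tab (n0 .w) (n0 .j))))]],
      setR1 .lam (n0 .j) (.add (r1 .lam (n0 .j)) (r0 .theta)),
      setN1 .keep (.pred (n1 .bas (n0 .r))) (.lit 0)],
    pivot,
    setN1 .bas (n0 .r) (.succ (n0 .j)),
    setN1 .keep (n0 .j) (.lit 1)],
  setN0 .kk (.lit 0),
  forTo .c (n0 .k) [
    ifThen (.and (.neq (n1 .keep (n0 .c)) (.lit 1)) (.rlt (.lit 0) (r1 .lam (n0 .c)))) [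
      setR1 .lam (n0 .kk) (r1 .lam (n0 .c)),
      forTo .w (n0 .n) [
        setR2 .y (n0 .kk) (n0 .w) (r2 .y (n0 .c) (n0 .w)),
        setN2 .L (n0 .kk) (n0 .w) (n2 .L (n0 .c) (n0 .w))],
      inc .kk]],
  setN0 .k (n0 .kk)]

/-- Start with one linear ordering, the extreme base that the greedy algorithm generates from it,
the zero flow, and `δ = M`. -/
def setUp : Cmd := block [
  forTo .w (n0 .n) [setN1 .qry (n0 .w) (.lit 0)],
  setR0 .g (.lit 0),
  forTo .v (n0 .n) [
    setN2 .L (.lit 0) (n0 .v) (n0 .v),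
    setN1 .qry (n0 .v) (.lit 1),
    query0 .h,
    setR2 .y (.lit 0) (n0 .v) (.sub (r0 .h) (r0 .g)),
    setR1 .x (n0 .v) (r2 .y (.lit 0) (n0 .v)),
    setR0 .g (r0 .h),
    forTo .w (n0 .n) [setR2 .phi (n0 .v) (n0 .w) (.lit 0)]],
  setR1 .lam (.lit 0) (.lit 1),
  setN0 .k (.lit 1),
  setR0 .delta (r0 .M)]

/-- Make the flow `δ`-feasible. -/
def clip : Cmd :=
  forTo .v (n0 .n) [
    forTo .w (n0 .n) [
      ifThen (.rlt (r0 .delta) (r2 .phi (n0 .v) (n0 .w))) [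
        setR2 .phi (n0 .v) (n0 .w) (r0 .delta)],
      ifThen (.rlt (r2 .phi (n0 .v) (n0 .w)) (.sub (.lit 0) (r0 .delta))) [
        setR2 .phi (n0 .v) (n0 .w) (.sub (.lit 0) (r0 .delta))]]]

/-- One scaling phase.  It ends when `S = ∅`, or `T = ∅`, or there is neither a `δ`-augmenting path
nor an active pair. -/
def scalingPhase : Cmd := block [
  .mark .phase,
  setR0 .delta (.div (r0 .delta) (.lit 2)),
  clip,
  setN0 .go (.lit 1),
  whileDo (.neq (n0 .go) (.lit 1)) [
    computeSTW,
    ifElse (.or (.neq (n0 .nS) (.lit 0)) (.neq (n0 .nT) (.lit 0)))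
      [setN0 .go (.lit 0)]
      [search,
       ifElse (.neq (n0 .hit) (.lit 1))
         [augment]
         [setN0 .go (.lit 0)],
       reduce]]]

/-- The algorithm SFM.  The phases are repeated while `δ ≥ 1 / n²`, and the indicator vector of the
set that is returned is written to `out`. -/
def algorithm : Cmd := block [
  setUp,
  whileDo (.rle (.div (.lit 1) (.mul (.ofNat (n0 .n)) (.ofNat (n0 .n)))) (r0 .delta)) [
    scalingPhase],
  forTo .v (n0 .n) [
    ifElse (.neq (n0 .nS) (.lit 0))
      [setN1 .out (n0 .v) (.lit 0)]
      [ifElse (.neq (n0 .nT) (.lit 0))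
        [setN1 .out (n0 .v) (.lit 1)]
        [setN1 .out (n0 .v) (n1 .inW (n0 .v))]]]]

/-- The initial memory: all entries are zero, except for the inputs `n` and `M`. -/
noncomputable def input (n : ℕ) (M : ℝ) : Mem where
  nat := fun A i j => if A = .n ∧ i = 0 ∧ j = 0 then n else 0
  real := fun A i j => if A = .M ∧ i = 0 ∧ j = 0 then M else 0

section

variable {V : Type*} [Fintype V]

open Classical in
/-- The subset of `V` that consists of the vertices with numbers in `Q`. -/
noncomputable def vertices (e : Fin (Fintype.card V) ≃ V) (Q : Set ℕ) : Finset V :=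
  Finset.univ.filter (fun v => (e.symm v : ℕ) ∈ Q)

/-- The evaluation oracle of `f`. -/
noncomputable def oracle (e : Fin (Fintype.card V) ≃ V) (f : Finset V → ℤ) (Q : Set ℕ) : ℝ :=
  f (vertices e Q)

/-- The subset of `V` that is returned. -/
noncomputable def output (e : Fin (Fintype.card V) ≃ V) (s : Mem) : Finset V :=
  vertices e {m | s.nat .out m 0 ≠ 0}

end

end SFM

/-! Everything is measured by ζ = x − ∂φ and the sum ζ⁻(V) of its negative parts (`zeta`, `negSum`).
Because x(Y) ≤ f(Y) and the boundary of a δ-feasible flow is small, ζ⁻(V) ≤ f(Y) + n²δ for every Y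
(`Base.negSum_le`). Conversely, the set X that would be returned at the end of a phase is an initial
segment of every ordering, so x(X) = f(X). No residual arc leaves X, and ζ ≤ δ on X, ζ ≥ −δ off X,
whence f(X) − nδ ≤ ζ⁻(V) (`Base.le_negSum`). Once δ < 1/n², this and weak duality leave f(X) < f(Y)
+ 1, and integrality gives f(X) ≤ f(Y) (`Base.minimizer`).

The same two inequalities count augmentations. A push changes x and ∂φ by the same vector, so ζ does
not move (`wp_push`); an augmentation raises ζ⁻(V) by δ (`negSum_augment`); halving δ and clipping φ
lowers it by at most n² times the new δ (`negSum_clamp`). Hence a phase has at most 10n²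
augmentations (`exec_scalingPhase`, `exec_turnLoop`). As δ is halved from M until it is below 1/n²,
there are O(log(nM)) phases.

Between augmentations the work is bounded by the potential `psiSum`: every vertex outside W is
charged with its distance to the end of each ordering. A push moves such a vertex one place to the
right and lowers the potential by one; growth of W never raises it. A copy of an ordering is made
only when the push sends the full δ, and then φ(u, v) ≤ 0, so W grows; this happens at most n times,
each time adding at most n² to the potential. So O(n³) steps suffice (`wp_pushRight`, `wp_search`),
and at most 2n + 1 orderings exist when the elimination starts. The elimination brings them back to
n + 1 by a ratio test along affine dependencies (`Tab.exchange`, `wp_reduce`) in O(n³) steps.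

Label-free pieces of the program are verified with `wp`, which combines termination, postcondition
and step count; the pieces that contain labels are put together by explicit derivations of `Exec`,
and the bounds between labels are read off the trace (`LoopTrace`, `PhasesTrace`). -/

namespace SFM

/-! ## Program logic -/

/-- Change one entry of a two-dimensional array. -/
def upd {α : Type*} (F : ℕ → ℕ → α) (i j : ℕ) (a : α) : ℕ → ℕ → α :=
  fun i' j' => if i' = i ∧ j' = j then a else F i' j'

@[simp] theorem upd_apply {α : Type*} (F : ℕ → ℕ → α) (i j i' j' : ℕ) (a : α) :
    upd F i j a i' j' = if i' = i ∧ j' = j then a else F i' j' := rfl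

section
variable (s : Mem) (A B : NArr) (A' B' : RArr) (i j m : ℕ) (a : ℝ)

@[simp] theorem Mem.nat_setN_self : (s.setN A i j m).nat A = upd (s.nat A) i j m := by
  funext i' j'; simp [Mem.setN]

@[simp] theorem Mem.nat_setN_of_ne (h : B ≠ A) : (s.setN A i j m).nat B = s.nat B := by
  funext i' j'; simp [Mem.setN, h]

@[simp] theorem Mem.real_setN : (s.setN A i j m).real = s.real := rfl

@[simp] theorem Mem.real_setR_self : (s.setR A' i j a).real A' = upd (s.real A') i j a := by
  funext i' j'; simp [Mem.setR]

@[simp] theorem Mem.real_setR_of_ne (h : B' ≠ A') : (s.setR A' i j a).real B' = s.real B' := by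
  funext i' j'; simp [Mem.setR, h]

@[simp] theorem Mem.nat_setR : (s.setR A' i j a).nat = s.nat := rfl

end

attribute [simp] NExp.eval RExp.eval BExp.holds NExp.cost RExp.cost BExp.cost
attribute [simp] n0 n1 n2 r0 r1 r2 setN0 setN1 setN2 setR0 setR1 setR2 query0 inc
attribute [simp] block ifThen ifElse whileDo

/-- Total correctness with exact step count for a program that passes no label. -/
def wp (O : Set ℕ → ℝ) (P : Cmd) (Q : Mem → ℕ → Prop) (s : Mem) : Prop :=
  ∃ s' m, Exec O P s s' (steps m) ∧ Q s' m

/-- Whether a program may write to an array of naturals. -/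
def Cmd.wrN : Cmd → NArr → Bool
  | .skip, _ => false
  | .setN A _ _ _, B => B = A
  | .setR _ _ _ _, _ => false
  | .query _ _ _, _ => false
  | .mark _, _ => false
  | .seq c c', B => c.wrN B || c'.wrN B
  | .ite _ c c', B => c.wrN B || c'.wrN B
  | .while _ c, B => c.wrN B

/-- Whether a program may write to an array of reals. -/
def Cmd.wrR : Cmd → RArr → Bool
  | .skip, _ => false
  | .setN _ _ _ _, _ => false
  | .setR A _ _ _, B => B = A
  | .query A _ _, B => B = A
  | .mark _, _ => false
  | .seq c c', B => c.wrR B || c'.wrR B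
  | .ite _ c c', B => c.wrR B || c'.wrR B
  | .while _ c, B => c.wrR B

/-- The arrays that `P` does not write to agree in `s` and `s'`. -/
structure Frame (P : Cmd) (s s' : Mem) : Prop where
  nat : ∀ A, P.wrN A = false → s'.nat A = s.nat A
  real : ∀ A, P.wrR A = false → s'.real A = s.real A

theorem Frame.refl (P : Cmd) (s : Mem) : Frame P s s := ⟨fun _ _ => rfl, fun _ _ => rfl⟩

theorem Frame.trans {P : Cmd} {s s' s'' : Mem} (h : Frame P s s') (h' : Frame P s' s'') :
    Frame P s s'' :=
  ⟨fun A hA => (h'.nat A hA).trans (h.nat A hA), fun A hA => (h'.real A hA).trans (h.real A hA)⟩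

/-- The set of written arrays is computed from the text of the program, so that "this array is
unchanged" is later settled by `rfl` or `decide`. -/
theorem Exec.frame {O : Set ℕ → ℝ} {P : Cmd} {s s' : Mem} {tr : List Event}
    (h : Exec O P s s' tr) : Frame P s s' := by
  induction h with
  | skip => exact .refl _ _
  | setN s A i j e =>
    exact ⟨fun B hB => by simp [Cmd.wrN] at hB; simp [hB], fun _ _ => rfl⟩
  | setR s A i j e =>
    exact ⟨fun _ _ => rfl, fun B hB => by simp [Cmd.wrR] at hB; simp [hB]⟩
  | query s A i j =>
    exact ⟨fun _ _ => rfl, fun B hB => by simp [Cmd.wrR] at hB; simp [hB]⟩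
  | mark => exact .refl _ _
  | seq _ _ _ _ _ _ _ _ _ ih ih' =>
    constructor
    · intro A hA
      simp only [Cmd.wrN, Bool.or_eq_false_iff] at hA
      exact (ih'.nat A hA.2).trans (ih.nat A hA.1)
    · intro A hA
      simp only [Cmd.wrR, Bool.or_eq_false_iff] at hA
      exact (ih'.real A hA.2).trans (ih.real A hA.1)
  | ite_true _ _ _ _ _ _ _ _ ih =>
    constructor
    · intro A hA
      simp only [Cmd.wrN, Bool.or_eq_false_iff] at hA
      exact ih.nat A hA.1
    · intro A hA
      simp only [Cmd.wrR, Bool.or_eq_false_iff] at hA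
      exact ih.real A hA.1
  | ite_false _ _ _ _ _ _ _ _ ih =>
    constructor
    · intro A hA
      simp only [Cmd.wrN, Bool.or_eq_false_iff] at hA
      exact ih.nat A hA.2
    · intro A hA
      simp only [Cmd.wrR, Bool.or_eq_false_iff] at hA
      exact ih.real A hA.2
  | while_true _ _ _ _ _ _ _ _ _ _ ih ih' =>
    exact ⟨fun A hA => (ih'.nat A hA).trans (ih.nat A hA),
      fun A hA => (ih'.real A hA).trans (ih.real A hA)⟩
  | while_false => exact .refl _ _

section rules

variable {O : Set ℕ → ℝ}

theorem steps_add (a b : ℕ) : steps a ++ steps b = steps (a + b) := by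
  simp [steps]

/-- The frame is handed to the continuation for free; specifications therefore speak only of the
arrays that a piece changes. -/
theorem wp_mono {P : Cmd} {Q Q' : Mem → ℕ → Prop} {s : Mem} (h : wp O P Q s)
    (hQ : ∀ s' m, Frame P s s' → Q s' m → Q' s' m) : wp O P Q' s := by
  obtain ⟨s', m, he, hq⟩ := h
  exact ⟨s', m, he, hQ s' m he.frame hq⟩

theorem wp_skip {Q : Mem → ℕ → Prop} {s : Mem} (h : Q s 0) : wp O .skip Q s :=
  ⟨s, 0, Exec.skip s, h⟩

theorem wp_setN {A : NArr} {i j e : NExp} {Q : Mem → ℕ → Prop} {s : Mem}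
    (h : Q (s.setN A (i.eval s) (j.eval s) (e.eval s)) (i.cost + j.cost + e.cost + 1)) :
    wp O (.setN A i j e) Q s := ⟨_, _, Exec.setN s A i j e, h⟩

theorem wp_setR {A : RArr} {i j : NExp} {e : RExp} {Q : Mem → ℕ → Prop} {s : Mem}
    (h : Q (s.setR A (i.eval s) (j.eval s) (e.eval s)) (i.cost + j.cost + e.cost + 1)) :
    wp O (.setR A i j e) Q s := ⟨_, _, Exec.setR s A i j e, h⟩

theorem wp_query {A : RArr} {i j : NExp} {Q : Mem → ℕ → Prop} {s : Mem}
    (h : Q (s.setR A (i.eval s) (j.eval s) (O s.querySet)) (i.cost + j.cost + 2)) :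
    wp O (.query A i j) Q s := ⟨_, _, Exec.query s A i j, h⟩

theorem wp_seq {c c' : Cmd} {Q : Mem → ℕ → Prop} {s : Mem}
    (h : wp O c (fun s' m => wp O c' (fun s'' m' => Q s'' (m + m')) s') s) :
    wp O (.seq c c') Q s := by
  obtain ⟨s', m, he, s'', m', he', hq⟩ := h
  exact ⟨s'', m + m', steps_add m m' ▸ Exec.seq _ _ _ _ _ _ _ he he', hq⟩

theorem wp_ite {t : BExp} {c c' : Cmd} {Q : Mem → ℕ → Prop} {s : Mem}
    (h : t.holds s → wp O c (fun s' m => Q s' (t.cost + m)) s)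
    (h' : ¬ t.holds s → wp O c' (fun s' m => Q s' (t.cost + m)) s) :
    wp O (.ite t c c') Q s := by
  by_cases ht : t.holds s
  · obtain ⟨s', m, he, hq⟩ := h ht
    exact ⟨s', t.cost + m, steps_add _ m ▸ Exec.ite_true _ _ _ _ _ _ ht he, hq⟩
  · obtain ⟨s', m, he, hq⟩ := h' ht
    exact ⟨s', t.cost + m, steps_add _ m ▸ Exec.ite_false _ _ _ _ _ _ ht he, hq⟩

/-- Loop rule with an invariant `I` (which sees the steps taken so far) and a variant `v`. -/
theorem wp_while {t : BExp} {c : Cmd} {s : Mem} (I : Mem → ℕ → Prop) (v : Mem → ℕ)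
    (h0 : I s 0)
    (hstep : ∀ s' m, Frame c s s' → I s' m → t.holds s' →
      wp O c (fun s'' m' => I s'' (m + t.cost + m') ∧ v s'' < v s') s') :
    wp O (.while t c) (fun s' m => ∃ m', I s' m' ∧ ¬ t.holds s' ∧ m = m' + t.cost) s := by
  suffices H : ∀ N s' m, v s' = N → Frame c s s' → I s' m →
      ∃ s'' m'' m', Exec O (.while t c) s' s'' (steps m'') ∧ I s'' m' ∧ ¬ t.holds s'' ∧
        m + m'' = m' + t.cost by
    obtain ⟨s'', m'', m', he, hI, ht, hm⟩ := H _ s 0 rfl (.refl _ _) h0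
    exact ⟨s'', m'', he, m', hI, ht, by omega⟩
  intro N
  induction N using Nat.strong_induction_on with
  | _ N ih =>
    intro s' m hN hF hI
    by_cases ht : t.holds s'
    · obtain ⟨s1, m1, he, hI1, hv⟩ := hstep s' m hF hI ht
      obtain ⟨s'', m'', m', he', hI', ht', hm⟩ :=
        ih _ (hN ▸ hv) s1 _ rfl (hF.trans he.frame) hI1
      refine ⟨s'', t.cost + m1 + m'', m', ?_, hI', ht', by omega⟩
      rw [← steps_add, ← steps_add]
      exact Exec.while_true _ _ _ _ _ _ _ ht he he'
    · exact ⟨s', t.cost, m, Exec.while_false _ _ _ ht, hI, ht, rfl⟩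

/-- Counting loop rule; `c` bounds the cost of one turn. -/
theorem wp_forTo {A : NArr} {e : NExp} {l : List Cmd} {s : Mem} (N c : ℕ) (I : ℕ → Mem → Prop)
    (hA : (block l).wrN A = false)
    (he : ∀ s', Frame (forTo A e l) s s' → e.eval s' = N)
    (h0 : I 0 (s.setN A 0 0 0))
    (hstep : ∀ i < N, ∀ s', Frame (forTo A e l) s s' → s'.nat A 0 0 = i → I i s' →
      wp O (block l) (fun s'' m => I (i + 1) (s''.setN A 0 0 (i + 1)) ∧ m ≤ c) s') :
    wp O (forTo A e l) (fun s' m => I N s' ∧ s'.nat A 0 0 = N ∧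
      m ≤ N * (c + e.cost + 12) + e.cost + 12) s := by
  have hF0 : Frame (forTo A e l) s (s.setN A 0 0 0) := by
    constructor
    · intro B hB
      simp only [forTo, block, Cmd.wrN, setN0, Bool.or_eq_false_iff, decide_eq_false_iff_not] at hB
      simp [hB.1]
    · intro B _; rfl
  have hw : wp O (.while (.nlt (n0 A) e) (.seq (block l) (.seq (inc A) .skip)))
      (fun s' m => ∃ m', (s'.nat A 0 0 ≤ N ∧ I (s'.nat A 0 0) s' ∧
        Frame (forTo A e l) s s' ∧ m' ≤ s'.nat A 0 0 * (c + e.cost + 12)) ∧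
          ¬ (BExp.nlt (n0 A) e).holds s' ∧ m = m' + (BExp.nlt (n0 A) e).cost)
      (s.setN A 0 0 0) := by
    refine wp_while (fun s' m' => s'.nat A 0 0 ≤ N ∧ I (s'.nat A 0 0) s' ∧
        Frame (forTo A e l) s s' ∧ m' ≤ s'.nat A 0 0 * (c + e.cost + 12))
      (fun s' => N - s'.nat A 0 0) ?_ ?_
    · simpa using ⟨h0, hF0⟩
    · rintro s' m - ⟨hle, hI, hF, hm⟩ ht
      have heN := he s' hF
      simp only [BExp.holds, n0, NExp.eval, heN] at ht
      apply wp_seq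
      obtain ⟨s1, m1, hx, hI1, hm1⟩ := hstep _ ht s' hF rfl hI
      have hA1 : s1.nat A = s'.nat A := hx.frame.nat A hA
      refine ⟨s1, m1, hx, ?_⟩
      apply wp_seq
      apply wp_setN
      apply wp_skip
      have hF1 : Frame (forTo A e l) s' (s1.setN A 0 0 (s'.nat A 0 0 + 1)) := by
        constructor
        · intro B hB
          simp only [forTo, block, Cmd.wrN, setN0, Bool.or_eq_false_iff, whileDo,
            decide_eq_false_iff_not, Bool.or_false] at hB
          rw [Mem.nat_setN_of_ne _ _ _ _ _ _ hB.1]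
          exact hx.frame.nat B hB.2.1
        · intro B hB
          simp only [forTo, block, Cmd.wrR, setN0, Bool.or_eq_false_iff, whileDo,
            Bool.or_false] at hB
          rw [Mem.real_setN]
          exact hx.frame.real B hB.2.1
      simp only [NExp.eval, n0, hA1, NExp.cost, BExp.cost]
      refine ⟨⟨?_, ?_, hF.trans hF1, ?_⟩, ?_⟩
      · simpa using ht
      · simpa using hI1
      · simp only [Mem.nat_setN_self, upd_apply, and_self, if_true]
        nlinarith
      · simp; omega
  apply wp_seq
  apply wp_setN
  apply wp_seq
  refine wp_mono hw ?_
  rintro s' m - ⟨m', ⟨hle, hI, hF, hm⟩, ht, rfl⟩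
  apply wp_skip
  have heN := he s' hF
  simp only [BExp.holds, n0, NExp.eval, heN, not_lt] at ht
  have hN : s'.nat A 0 0 = N := le_antisymm hle ht
  rw [hN] at hI hm
  refine ⟨hI, hN, ?_⟩
  simp only [NExp.cost, BExp.cost, n0]
  omega

/-- Allows long programs such as `push` and `reduce` to be cut into named pieces and verified one
piece at a time. -/
theorem wp_block_append {l l' : List Cmd} {Q : Mem → ℕ → Prop} {s : Mem}
    (h : wp O (block l) (fun s' m => wp O (block l') (fun s'' m' => Q s'' (m + m')) s') s) :
    wp O (block (l ++ l')) Q s := by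
  induction l generalizing s Q with
  | nil =>
    obtain ⟨s', m, he, s'', m', he', hq⟩ := h
    generalize htr : steps m = tr at he
    cases he
    have : m = 0 := by simpa [steps] using htr
    subst this
    exact ⟨s'', m', he', by simpa using hq⟩
  | cons c l ih =>
    obtain ⟨s', m, he, s'', m', he', hq⟩ := h
    generalize htr : steps m = tr at he
    cases he with
    | seq _ s1 _ _ _ tr1 tr2 h1 h2 =>
      -- A part of a trace that consists of steps only again consists of steps only, so both halves
      -- have the form required by `wp`.
      have h1' : tr1 = steps tr1.length := by
        rw [steps, List.eq_replicate_iff]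
        refine ⟨rfl, fun b hb => ?_⟩
        have : b ∈ steps m := htr ▸ List.mem_append_left _ hb
        exact List.eq_of_mem_replicate this
      have h2' : tr2 = steps tr2.length := by
        rw [steps, List.eq_replicate_iff]
        refine ⟨rfl, fun b hb => ?_⟩
        have : b ∈ steps m := htr ▸ List.mem_append_right _ hb
        exact List.eq_of_mem_replicate this
      have hlen : m = tr1.length + tr2.length := by
        simpa [steps] using congrArg List.length htr
      rw [h1'] at h1
      rw [h2'] at h2
      refine wp_seq ⟨s1, _, h1, ih ⟨s', _, h2, s'', m', he', ?_⟩⟩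
      simpa [← Nat.add_assoc, ← hlen] using hq

end rules

end SFM

namespace SFM

/-! ## Extreme bases, convex combinations and flows -/

open Finset Classical

/-- The properties of the evaluation oracle of an integral submodular function on `{0, …, n - 1}`. -/
structure IsOracle (O : Set ℕ → ℝ) (n : ℕ) (M : ℝ) : Prop where
  submod : ∀ X Y, O (X ∪ Y) + O (X ∩ Y) ≤ O X + O Y
  empty : O ∅ = 0
  bound : ∀ X, |O X| ≤ M
  inter : ∀ X, O (X ∩ Set.Iio n) = O X
  int : ∀ X, ∃ z : ℤ, O X = z

/-- The set of the first `p` vertices of an ordering. -/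
def pre (L : ℕ → ℕ) (p : ℕ) : Set ℕ := {m | ∃ q < p, L q = m}

@[simp] theorem pre_zero (L : ℕ → ℕ) : pre L 0 = ∅ := by
  ext m; simp [pre]

theorem pre_succ (L : ℕ → ℕ) (p : ℕ) : pre L (p + 1) = insert (L p) (pre L p) := by
  ext m
  simp only [pre, Set.mem_ofPred_eq, Set.mem_insert_iff]
  constructor
  · rintro ⟨q, hq, rfl⟩
    rcases Nat.lt_succ_iff_lt_or_eq.1 hq with h | rfl
    · exact Or.inr ⟨q, h, rfl⟩
    · exact Or.inl rfl
  · rintro (rfl | ⟨q, hq, rfl⟩)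
    · exact ⟨p, by omega, rfl⟩
    · exact ⟨q, by omega, rfl⟩

theorem pre_congr {L L' : ℕ → ℕ} {p : ℕ} (h : ∀ q < p, L' q = L q) : pre L' p = pre L p := by
  ext m
  constructor
  · rintro ⟨q, hq, rfl⟩; exact ⟨q, hq, (h q hq).symm⟩
  · rintro ⟨q, hq, rfl⟩; exact ⟨q, hq, h q hq⟩

/-- `L` lists the vertices `0, …, n - 1`. -/
structure IsOrd (n : ℕ) (L : ℕ → ℕ) : Prop where
  lt : ∀ p < n, L p < n
  inj : ∀ p < n, ∀ q < n, L p = L q → p = q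

theorem IsOrd.image {n : ℕ} {L : ℕ → ℕ} (h : IsOrd n L) : (range n).image L = range n := by
  apply Finset.eq_of_subset_of_card_le
  · intro v hv
    obtain ⟨p, hp, rfl⟩ := mem_image.1 hv
    exact mem_range.2 (h.lt p (mem_range.1 hp))
  · rw [Finset.card_image_of_injOn]
    intro p hp q hq hpq
    exact h.inj p (by simpa using hp) q (by simpa using hq) hpq

theorem IsOrd.surj {n : ℕ} {L : ℕ → ℕ} (h : IsOrd n L) {v : ℕ} (hv : v < n) :
    ∃ p < n, L p = v := by
  have : v ∈ (range n).image L := by rw [h.image]; exact mem_range.2 hv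
  obtain ⟨p, hp, rfl⟩ := mem_image.1 this
  exact ⟨p, mem_range.1 hp, rfl⟩

theorem IsOrd.sum {n : ℕ} {L : ℕ → ℕ} (h : IsOrd n L) (g : ℕ → ℝ) :
    ∑ p ∈ range n, g (L p) = ∑ v ∈ range n, g v := by
  conv_rhs => rw [← h.image]
  rw [Finset.sum_image]
  intro p hp q hq hpq
  exact h.inj p (by simpa using hp) q (by simpa using hq) hpq

theorem IsOrd.pre_eq {n : ℕ} {L : ℕ → ℕ} (h : IsOrd n L) : pre L n = Set.Iio n := by
  ext v
  constructor
  · rintro ⟨q, hq, rfl⟩; exact h.lt q hq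
  · intro hv; exact h.surj hv

theorem IsOrd.notMem_pre {n : ℕ} {L : ℕ → ℕ} (h : IsOrd n L) {p q : ℕ} (hp : p < n) (hq : q ≤ p) :
    L p ∉ pre L q := by
  rintro ⟨r, hr, e⟩
  have := h.inj r (by omega) p hp e
  omega

/-- `y` is the extreme base generated by the ordering `L`. -/
structure IsExt (O : Set ℕ → ℝ) (n : ℕ) (L : ℕ → ℕ) (y : ℕ → ℝ) : Prop extends IsOrd n L where
  ext : ∀ p < n, y (L p) = O (pre L (p + 1)) - O (pre L p)

section

variable {O : Set ℕ → ℝ} {n : ℕ} {M : ℝ} {L L' : ℕ → ℕ} {y y' : ℕ → ℝ}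

theorem IsExt.congr (h : IsExt O n L y) (hL : ∀ p < n, L' p = L p) (hy : ∀ v < n, y' v = y v) :
    IsExt O n L' y' where
  lt p hp := by rw [hL p hp]; exact h.lt p hp
  inj p hp q hq e := by
    rw [hL p hp, hL q hq] at e
    exact h.inj p hp q hq e
  ext p hp := by
    rw [hL p hp, hy _ (h.lt p hp), h.ext p hp,
      pre_congr (fun q hq => hL q (by omega)), pre_congr (fun q hq => hL q (by omega))]

/-- The greedy argument: along the ordering, each new vertex of X has a marginal value over the
whole initial segment that is at most its marginal value over the part of X seen so far. -/
theorem IsExt.sum_le (hO : IsOracle O n M) (h : IsExt O n L y) (X : Set ℕ) :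
    ∑ v ∈ range n, (if v ∈ X then y v else 0) ≤ O X := by
  rw [← h.toIsOrd.sum]
  have key : ∀ p ≤ n, ∑ q ∈ range p, (if L q ∈ X then y (L q) else 0) ≤ O (X ∩ pre L p) := by
    intro p
    induction p with
    | zero => simp [hO.empty]
    | succ p ih =>
      intro hp
      rw [sum_range_succ]
      have ih := ih (by omega)
      split_ifs with hX
      · rw [h.ext p (by omega)]
        -- The union of these sets is the next initial segment and their intersection is the old
        -- part of X, so this is the comparison of the two marginal values.
        have hs := hO.submod (X ∩ pre L (p + 1)) (pre L p)
        have e1 : X ∩ pre L (p + 1) ∪ pre L p = pre L (p + 1) := by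
          rw [pre_succ]; ext m; simp; by_cases hm : m = L p <;> simp [hm, hX]
        have e2 : X ∩ pre L (p + 1) ∩ pre L p = X ∩ pre L p := by
          rw [pre_succ]; ext m; simp; tauto
        rw [e1, e2] at hs
        linarith
      · have e : X ∩ pre L (p + 1) = X ∩ pre L p := by
          rw [pre_succ]; ext m; simp; rintro hm rfl; exact absurd hm hX
        rw [e]; linarith
  have := key n le_rfl
  rwa [h.toIsOrd.pre_eq, hO.inter] at this

/-- An extreme base is tight at the initial segments of the ordering. -/
theorem IsExt.sum_eq (hO : IsOracle O n M) (h : IsExt O n L y) (X : Set ℕ)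
    (hX : ∀ a b, a < b → b < n → L b ∈ X → L a ∈ X) :
    ∑ v ∈ range n, (if v ∈ X then y v else 0) = O X := by
  rw [← h.toIsOrd.sum]
  have key : ∀ p ≤ n, ∑ q ∈ range p, (if L q ∈ X then y (L q) else 0) = O (X ∩ pre L p) := by
    intro p
    induction p with
    | zero => simp [hO.empty]
    | succ p ih =>
      intro hp
      rw [sum_range_succ, ih (by omega)]
      split_ifs with hp'
      · have e : ∀ r ≤ p + 1, X ∩ pre L r = pre L r := by
          rintro r hr
          apply Set.inter_eq_right.2
          rintro m ⟨q, hq, rfl⟩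
          rcases Nat.lt_or_ge q p with hqp | hqp
          · exact hX q p hqp (by omega) hp'
          · have : q = p := by omega
            rwa [this]
        rw [h.ext p (by omega), e _ (by omega), e _ le_rfl]
        ring
      · have e : X ∩ pre L (p + 1) = X ∩ pre L p := by
          rw [pre_succ]; ext m; simp; rintro hm rfl; exact absurd hm hp'
        rw [e]; ring
  rw [key n le_rfl, h.toIsOrd.pre_eq, hO.inter]

/-- Interchanging neighbours alters a single initial segment, the one of length q + 1. Hence only
two marginal values change, by opposite amounts. -/
theorem IsExt.swap (h : IsExt O n L y) {q : ℕ} (hq : q + 1 < n) {c : ℝ}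
    (hc : c = O (pre L (q + 2) \ {L q}) - O (pre L (q + 2)) + y (L q))
    (h1 : L' q = L (q + 1)) (h2 : L' (q + 1) = L q)
    (h3 : ∀ p, p ≠ q → p ≠ q + 1 → L' p = L p)
    (h1y : y' (L (q + 1)) = y (L (q + 1)) + c) (h2y : y' (L q) = y (L q) - c)
    (h3y : ∀ v, v ≠ L q → v ≠ L (q + 1) → y' v = y v) : IsExt O n L' y' := by
  have hne : L q ≠ L (q + 1) := fun e => by
    have := h.inj _ (by omega) _ hq e
    omega
  have hpre : ∀ p, p ≠ q + 1 → pre L' p = pre L p := by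
    intro p hp
    rcases Nat.lt_or_ge p (q + 1) with hpq | hpq
    · exact pre_congr (fun r hr => h3 r (by omega) (by omega))
    · ext m
      constructor
      · rintro ⟨r, hr, rfl⟩
        by_cases h4 : r = q
        · exact ⟨q + 1, by omega, by rw [h4, h1]⟩
        · by_cases h5 : r = q + 1
          · exact ⟨q, by omega, by rw [h5, h2]⟩
          · exact ⟨r, hr, (h3 r h4 h5).symm⟩
      · rintro ⟨r, hr, rfl⟩
        by_cases h4 : r = q
        · exact ⟨q + 1, by omega, by rw [h4, h2]⟩
        · by_cases h5 : r = q + 1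
          · exact ⟨q, by omega, by rw [h5, h1]⟩
          · exact ⟨r, hr, h3 r h4 h5⟩
  have hmid : pre L' (q + 1) = pre L (q + 2) \ {L q} := by
    rw [pre_succ, hpre q (by omega), h1, pre_succ, pre_succ]
    have := h.toIsOrd.notMem_pre (p := q) (q := q) (by omega) le_rfl
    ext m
    simp only [Set.mem_insert_iff, Set.mem_sdiff, Set.mem_singleton_iff]
    constructor
    · rintro (rfl | hm)
      · exact ⟨Or.inl rfl, hne.symm⟩
      · exact ⟨Or.inr (Or.inr hm), fun e => this (e ▸ hm)⟩
    · rintro ⟨rfl | rfl | hm, hm'⟩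
      · exact Or.inl rfl
      · exact absurd rfl hm'
      · exact Or.inr hm
  have eq1 := h.ext q (by omega)
  have eq2 := h.ext (q + 1) hq
  refine ⟨⟨?_, ?_⟩, ?_⟩
  · intro p hp
    by_cases h4 : p = q
    · rw [h4, h1]; exact h.lt _ hq
    · by_cases h5 : p = q + 1
      · rw [h5, h2]; exact h.lt _ (by omega)
      · rw [h3 p h4 h5]; exact h.lt _ hp
  · have key : ∀ p, p < n → ∃ r < n, L' p = L r ∧
        r = if p = q then q + 1 else if p = q + 1 then q else p := by
      intro p hp
      by_cases h4 : p = q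
      · exact ⟨q + 1, hq, by rw [h4, h1], by simp [h4]⟩
      · by_cases h5 : p = q + 1
        · exact ⟨q, by omega, by rw [h5, h2], by simp [h5]⟩
        · exact ⟨p, hp, h3 p h4 h5, by simp [h4, h5]⟩
    intro p hp r hr e
    obtain ⟨p', hp', e1, e1'⟩ := key p hp
    obtain ⟨r', hr', e2, e2'⟩ := key r hr
    have := h.inj p' hp' r' hr' (by rw [← e1, ← e2, e])
    rw [e1', e2'] at this
    split_ifs at this <;> omega
  · intro p hp
    by_cases h4 : p = q
    · subst h4
      rw [h1, h1y, hmid, hpre p (by omega)]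
      linarith
    · by_cases h5 : p = q + 1
      · subst h5
        rw [h2, h2y, hmid, hpre _ (by omega)]
        linarith
      · rw [h3 p h4 h5, hpre p h5, hpre (p + 1) (by omega), h3y, h.ext p hp]
        · exact fun e => h4 (h.inj _ hp _ (by omega) e)
        · exact fun e => h5 (h.inj _ hp _ hq e)

/-- Exchange capacities are nonnegative. -/
theorem IsExt.cap_nonneg (hO : IsOracle O n M) (h : IsExt O n L y) {q : ℕ} (hq : q + 1 < n) :
    0 ≤ O (pre L (q + 2) \ {L q}) - O (pre L (q + 2)) + y (L q) := by
  -- The two sets meet in `pre L q` and their union is `pre L (q + 2)`; with the formula for y(L q)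
  -- the submodular inequality says exactly c ≥ 0.
  have hs := hO.submod (pre L (q + 2) \ {L q}) (pre L (q + 1))
  have hn := h.toIsOrd.notMem_pre (p := q) (q := q) (by omega) le_rfl
  have e1 : pre L (q + 2) \ {L q} ∪ pre L (q + 1) = pre L (q + 2) := by
    rw [pre_succ, pre_succ]; ext m; simp; tauto
  have e2 : (pre L (q + 2) \ {L q}) ∩ pre L (q + 1) = pre L q := by
    rw [pre_succ, pre_succ]; ext m
    simp only [Set.mem_inter_iff, Set.mem_sdiff, Set.mem_insert_iff, Set.mem_singleton_iff]
    constructor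
    · rintro ⟨⟨_, h1⟩, h2⟩
      exact h2.resolve_left h1
    · intro hm
      exact ⟨⟨Or.inr (Or.inr hm), fun e => hn (e ▸ hm)⟩, Or.inr hm⟩
  rw [e1, e2] at hs
  have := h.ext q (by omega)
  linarith

end

/-- `x` is the convex combination of the extreme bases `y_i`, `i < k`, generated by the orderings
`L_i`, with the coefficients `λ_i`. -/
structure Base (O : Set ℕ → ℝ) (n k : ℕ) (L : ℕ → ℕ → ℕ) (y lam x : ℕ → ℕ → ℝ) : Prop where
  ext : ∀ i < k, IsExt O n (L i) (y i)
  nonneg : ∀ i < k, 0 ≤ lam i 0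
  sum_one : ∑ i ∈ range k, lam i 0 = 1
  x_eq : ∀ v < n, x v 0 = ∑ i ∈ range k, lam i 0 * y i v

section

variable {O : Set ℕ → ℝ} {n k : ℕ} {M : ℝ} {L L' : ℕ → ℕ → ℕ} {y y' lam lam' x x' : ℕ → ℕ → ℝ}

theorem Base.sum_x (h : Base O n k L y lam x) (X : Set ℕ) :
    ∑ v ∈ range n, (if v ∈ X then x v 0 else 0) =
      ∑ i ∈ range k, lam i 0 * ∑ v ∈ range n, (if v ∈ X then y i v else 0) := by
  simp_rw [mul_sum]
  rw [sum_comm]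
  refine sum_congr rfl fun v hv => ?_
  split_ifs
  · exact h.x_eq v (mem_range.1 hv)
  · simp

theorem Base.sum_le (hO : IsOracle O n M) (h : Base O n k L y lam x) (X : Set ℕ) :
    ∑ v ∈ range n, (if v ∈ X then x v 0 else 0) ≤ O X := by
  rw [h.sum_x]
  calc _ ≤ ∑ i ∈ range k, lam i 0 * O X := by
        refine sum_le_sum fun i hi => ?_
        have hi := mem_range.1 hi
        exact mul_le_mul_of_nonneg_left ((h.ext i hi).sum_le hO X) (h.nonneg i hi)
    _ = O X := by rw [← sum_mul, h.sum_one, one_mul]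

theorem Base.sum_eq (hO : IsOracle O n M) (h : Base O n k L y lam x) (X : Set ℕ)
    (hX : ∀ i < k, ∀ a b, a < b → b < n → L i b ∈ X → L i a ∈ X) :
    ∑ v ∈ range n, (if v ∈ X then x v 0 else 0) = O X := by
  rw [h.sum_x]
  calc _ = ∑ i ∈ range k, lam i 0 * O X := by
        refine sum_congr rfl fun i hi => ?_
        have hi := mem_range.1 hi
        rw [(h.ext i hi).sum_eq hO X (hX i hi)]
    _ = O X := by rw [← sum_mul, h.sum_one, one_mul]

/-- Splitting the coefficient of an extreme base. -/
theorem Base.split (h : Base O n k L y lam x) {i : ℕ} (hi : i < k)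
    (hL : ∀ j < k, L' j = L j) (hy : ∀ j < k, y' j = y j)
    (hLk : ∀ p < n, L' k p = L i p) (hyk : ∀ v < n, y' k v = y i v)
    (hlam : ∀ j < k, j ≠ i → lam' j 0 = lam j 0) (hadd : lam' i 0 + lam' k 0 = lam i 0)
    (hi0 : 0 ≤ lam' i 0) (hk0 : 0 ≤ lam' k 0) : Base O n (k + 1) L' y' lam' x := by
  -- Used twice: with constant weights 1 for the sum of the coefficients, and with a coordinate of
  -- the bases for x.
  have key : ∀ (g g' : ℕ → ℝ), (∀ j < k, g' j = g j) → g' k = g i →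
      ∑ j ∈ range (k + 1), lam' j 0 * g' j = ∑ j ∈ range k, lam j 0 * g j := by
    intro g g' hg hgk
    have hi' := mem_range.2 hi
    rw [sum_range_succ, ← add_sum_erase _ _ hi', ← add_sum_erase _ (fun j => lam j 0 * g j) hi',
      hgk, hg i hi, ← hadd]
    have : ∑ j ∈ (range k).erase i, lam' j 0 * g' j = ∑ j ∈ (range k).erase i, lam j 0 * g j := by
      refine sum_congr rfl fun j hj => ?_
      have hj' := mem_erase.1 hj
      rw [hlam j (mem_range.1 hj'.2) hj'.1, hg j (mem_range.1 hj'.2)]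
    rw [this]; ring
  refine ⟨?_, ?_, ?_, ?_⟩
  · intro j hj
    rcases Nat.lt_succ_iff_lt_or_eq.1 hj with hj | rfl
    · rw [hL j hj, hy j hj]; exact h.ext j hj
    · exact (h.ext i hi).congr hLk hyk
  · intro j hj
    rcases Nat.lt_succ_iff_lt_or_eq.1 hj with hj | rfl
    · by_cases e : j = i
      · rwa [e]
      · rw [hlam j hj e]; exact h.nonneg j hj
    · exact hk0
  · have := key (fun _ => 1) (fun _ => 1) (fun _ _ => rfl) rfl
    simp only [mul_one] at this
    rw [this, h.sum_one]
  · intro v hv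
    rw [h.x_eq v hv]
    exact (key (fun j => y j v) (fun j => y' j v) (fun j hj => by rw [hy j hj]) (hyk v hv)).symm

/-- Interchanging two consecutive vertices in one of the orderings. -/
theorem Base.swap (h : Base O n k L y lam x) {i : ℕ} (hi : i < k) {q : ℕ} (hq : q + 1 < n) {c α : ℝ}
    (hc : c = O (pre (L i) (q + 2) \ {L i q}) - O (pre (L i) (q + 2)) + y i (L i q))
    (hα : α = lam i 0 * c)
    (h0 : ∀ j, j ≠ i → L' j = L j)
    (h1 : L' i q = L i (q + 1)) (h2 : L' i (q + 1) = L i q)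
    (h3 : ∀ p, p ≠ q → p ≠ q + 1 → L' i p = L i p)
    (h0y : ∀ j, j ≠ i → y' j = y j)
    (h1y : y' i (L i (q + 1)) = y i (L i (q + 1)) + c) (h2y : y' i (L i q) = y i (L i q) - c)
    (h3y : ∀ v, v ≠ L i q → v ≠ L i (q + 1) → y' i v = y i v)
    (h1x : x' (L i (q + 1)) 0 = x (L i (q + 1)) 0 + α) (h2x : x' (L i q) 0 = x (L i q) 0 - α)
    (h3x : ∀ v, v ≠ L i q → v ≠ L i (q + 1) → x' v 0 = x v 0) : Base O n k L' y' lam x' := by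
  refine ⟨?_, h.nonneg, h.sum_one, ?_⟩
  · intro j hj
    by_cases e : j = i
    · subst e
      exact (h.ext j hj).swap hq hc h1 h2 h3 h1y h2y h3y
    · rw [h0 j e, h0y j e]; exact h.ext j hj
  · intro v hv
    have key : ∀ d, y' i v = y i v + d → x' v 0 = x v 0 + lam i 0 * d →
        x' v 0 = ∑ j ∈ range k, lam j 0 * y' j v := by
      intro d hd hx
      have hi' := mem_range.2 hi
      rw [hx, h.x_eq v hv, ← add_sum_erase _ _ hi',
        ← add_sum_erase _ (fun j => lam j 0 * y' j v) hi', hd]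
      have : ∑ j ∈ (range k).erase i, lam j 0 * y' j v =
          ∑ j ∈ (range k).erase i, lam j 0 * y j v := by
        refine sum_congr rfl fun j hj => ?_
        rw [h0y j (mem_erase.1 hj).1]
      rw [this]; ring
    by_cases e1 : v = L i q
    · subst e1
      exact key (-c) (by rw [h2y]; ring) (by rw [h2x, hα]; ring)
    · by_cases e2 : v = L i (q + 1)
      · subst e2
        exact key c h1y (by rw [h1x, hα])
      · exact key 0 (by rw [h3y v e1 e2]; ring) (by rw [h3x v e1 e2]; ring)

end

/-- `phi` is a skew-symmetric flow with capacities `δ`. -/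
structure IsFlow (n : ℕ) (δ : ℝ) (phi : ℕ → ℕ → ℝ) : Prop where
  skew : ∀ u < n, ∀ v < n, phi u v = - phi v u
  le : ∀ u < n, ∀ v < n, phi u v ≤ δ

/-- The difference of `x` and the boundary of the flow. -/
noncomputable def zeta (n : ℕ) (x phi : ℕ → ℕ → ℝ) (v : ℕ) : ℝ := x v 0 - ∑ w ∈ range n, phi w v

/-- The sum of the negative parts. -/
noncomputable def negSum (n : ℕ) (z : ℕ → ℝ) : ℝ := ∑ v ∈ range n, min (z v) 0

section

variable {O : Set ℕ → ℝ} {n k : ℕ} {M δ : ℝ} {L : ℕ → ℕ → ℕ} {y lam x phi : ℕ → ℕ → ℝ}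

theorem IsFlow.neg_le (h : IsFlow n δ phi) {u v : ℕ} (hu : u < n) (hv : v < n) :
    -δ ≤ phi u v := by
  have := h.le v hv u hu
  rw [h.skew u hu v hv]; linarith

theorem IsFlow.diag (h : IsFlow n δ phi) {u : ℕ} (hu : u < n) : phi u u = 0 := by
  have := h.skew u hu u hu
  linarith

/-- Skew-symmetry makes the diagonal vanish. The factor n − 1 instead of n is needed in
`Base.minimizer`, where nδ + n(n − 1)δ must be less than 1. -/
theorem IsFlow.abs_boundary_le (h : IsFlow n δ phi) {v : ℕ} (hv : v < n) :
    |∑ w ∈ range n, phi w v| ≤ (n - 1) * δ := by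
  have hv' := mem_range.2 hv
  rw [← add_sum_erase _ _ hv', h.diag hv, zero_add]
  refine (abs_sum_le_sum_abs _ _).trans ?_
  refine (sum_le_card_nsmul _ _ δ ?_).trans ?_
  · intro w hw
    have hw := mem_range.1 (mem_erase.1 hw).2
    exact abs_le.2 ⟨h.neg_le hw hv, h.le w hw v hv⟩
  · rw [card_erase_of_mem hv', card_range, nsmul_eq_mul, Nat.cast_sub (by omega), Nat.cast_one]

/-- A set that no residual arc leaves has a boundary which is at most zero. -/
theorem IsFlow.sum_boundary_nonpos (h : IsFlow n δ phi) (X : Set ℕ)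
    (hX : ∀ u < n, ∀ v < n, u ∈ X → v ∉ X → 0 < phi u v) :
    ∑ v ∈ range n, (if v ∈ X then ∑ w ∈ range n, phi w v else 0) ≤ 0 := by
  have h1 : ∑ v ∈ range n, (if v ∈ X then ∑ w ∈ range n, phi w v else 0) =
      ∑ v ∈ range n, ∑ w ∈ range n, (if v ∈ X ∧ w ∈ X then phi w v else 0) +
      ∑ v ∈ range n, ∑ w ∈ range n, (if v ∈ X ∧ w ∉ X then phi w v else 0) := by
    rw [← sum_add_distrib]
    refine sum_congr rfl fun v _ => ?_
    rw [← sum_add_distrib]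
    by_cases hv : v ∈ X
    · simp only [hv, if_true, true_and]
      refine sum_congr rfl fun w _ => ?_
      by_cases hw : w ∈ X <;> simp [hw]
    · simp [hv]
  -- The flow inside X cancels: exchanging the order of summation and using skew-symmetry shows that
  -- this sum equals its own negative.
  have h2 : ∑ v ∈ range n, ∑ w ∈ range n, (if v ∈ X ∧ w ∈ X then phi w v else 0) = 0 := by
    have : ∑ v ∈ range n, ∑ w ∈ range n, (if v ∈ X ∧ w ∈ X then phi w v else 0) =
        - ∑ v ∈ range n, ∑ w ∈ range n, (if v ∈ X ∧ w ∈ X then phi w v else 0) := by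
      conv_lhs => rw [sum_comm]
      rw [← sum_neg_distrib]
      refine sum_congr rfl fun v hv => ?_
      rw [← sum_neg_distrib]
      refine sum_congr rfl fun w hw => ?_
      by_cases h1 : v ∈ X <;> by_cases h2 : w ∈ X <;> simp [h1, h2]
      exact h.skew v (mem_range.1 hv) w (mem_range.1 hw)
    linarith
  rw [h1, h2, zero_add]
  refine sum_nonpos fun v hv => sum_nonpos fun w hw => ?_
  split_ifs with hvw
  · have := hX v (mem_range.1 hv) w (mem_range.1 hw) hvw.1 hvw.2
    rw [h.skew w (mem_range.1 hw) v (mem_range.1 hv)]; linarith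
  · exact le_rfl

/-- Combined with x(X) ≤ f(X) this is weak duality, x⁻(V) ≤ f(X). -/
theorem negSum_le_sum (n : ℕ) (z : ℕ → ℝ) (X : Set ℕ) :
    negSum n z ≤ ∑ v ∈ range n, (if v ∈ X then z v else 0) := by
  refine sum_le_sum fun v _ => ?_
  split_ifs
  · exact min_le_left _ _
  · exact min_le_right _ _

/-- The negative part is monotone and 1-Lipschitz. This controls the passage from x to ζ, the
clipping of the flow, and the initial value. -/
theorem negSum_le_add {n : ℕ} {z z' : ℕ → ℝ} {d : ℝ} (hd : 0 ≤ d)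
    (h : ∀ v < n, z v ≤ z' v + d) : negSum n z ≤ negSum n z' + n * d := by
  have : negSum n z ≤ ∑ v ∈ range n, (min (z' v) 0 + d) := by
    refine sum_le_sum fun v hv => ?_
    have := h v (mem_range.1 hv)
    rw [← min_add_add_right]
    exact le_min ((min_le_left _ _).trans this) ((min_le_right _ _).trans (by linarith))
  rw [sum_add_distrib] at this
  simpa [negSum] using this

/-- The bound at the end of a phase. -/
theorem Base.le_negSum (hO : IsOracle O n M) (h : Base O n k L y lam x) (hφ : IsFlow n δ phi)
    (X : Set ℕ) (hX : ∀ i < k, ∀ a b, a < b → b < n → L i b ∈ X → L i a ∈ X)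
    (hX' : ∀ u < n, ∀ v < n, u ∈ X → v ∉ X → 0 < phi u v)
    (h1 : ∀ v < n, v ∉ X → -δ ≤ zeta n x phi v) (h2 : ∀ v < n, v ∈ X → zeta n x phi v ≤ δ)
    (hδ : 0 ≤ δ) :
    O X - n * δ ≤ negSum n (zeta n x phi) := by
  -- Termwise: on X one has ζ − δ ≤ 0 and ζ − δ ≤ ζ, off X one has −δ ≤ ζ and −δ ≤ 0. Each vertex
  -- thus loses at most δ.
  have h3 : ∑ v ∈ range n, ((if v ∈ X then zeta n x phi v else 0) - δ) ≤
      negSum n (zeta n x phi) := by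
    refine sum_le_sum fun v hv => ?_
    have hv := mem_range.1 hv
    split_ifs with hvX
    · have := h2 v hv hvX
      exact le_min (by linarith) (by linarith)
    · have := h1 v hv hvX
      exact le_min (by linarith) (by linarith)
  have h4 : ∑ v ∈ range n, (if v ∈ X then zeta n x phi v else 0) =
      ∑ v ∈ range n, (if v ∈ X then x v 0 else 0) -
      ∑ v ∈ range n, (if v ∈ X then ∑ w ∈ range n, phi w v else 0) := by
    rw [← sum_sub_distrib]
    refine sum_congr rfl fun v _ => ?_
    split_ifs <;> simp [zeta]
  rw [sum_sub_distrib, h4, h.sum_eq hO X hX] at h3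
  have := hφ.sum_boundary_nonpos X hX'
  simp only [sum_const, card_range, nsmul_eq_mul] at h3
  linarith

/-- The general upper bound. -/
theorem Base.negSum_le (hO : IsOracle O n M) (h : Base O n k L y lam x) (hφ : IsFlow n δ phi)
    (hδ : 0 ≤ δ) (X : Set ℕ) : negSum n (zeta n x phi) ≤ O X + n * (n * δ) := by
  have h1 : negSum n (zeta n x phi) ≤ negSum n (fun v => x v 0) + n * (n * δ) := by
    refine negSum_le_add (by positivity) fun v hv => ?_
    have := abs_le.1 (hφ.abs_boundary_le hv)
    simp only [zeta]
    nlinarith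
  have := (negSum_le_sum n (fun v => x v 0) X).trans (h.sum_le hO X)
  linarith

/-- The output is a minimizer. -/
theorem Base.minimizer (hO : IsOracle O n M) (h : Base O n k L y lam x) (hφ : IsFlow n δ phi)
    (hδ : 0 ≤ δ) (hδ' : δ * (n * n) < 1) (hn : 1 ≤ n) {X : Set ℕ}
    (hX : O X - n * δ ≤ negSum n (zeta n x phi)) (Y : Set ℕ) : O X ≤ O Y := by
  have hn' : (1 : ℝ) ≤ n := by exact_mod_cast hn
  have h1 : negSum n (zeta n x phi) ≤ negSum n (fun v => x v 0) + n * ((n - 1) * δ) := by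
    refine negSum_le_add (mul_nonneg (by linarith) hδ) fun v hv => ?_
    have := abs_le.1 (hφ.abs_boundary_le hv)
    simp only [zeta]
    linarith
  have h2 := (negSum_le_sum n (fun v => x v 0) Y).trans (h.sum_le hO Y)
  -- The error terms nδ and n(n − 1)δ add up to exactly n²δ.
  have h3 : O X < O Y + 1 := by nlinarith
  obtain ⟨a, ha⟩ := hO.int X
  obtain ⟨b, hb⟩ := hO.int Y
  rw [ha, hb] at h3 ⊢
  have : a < b + 1 := by exact_mod_cast h3
  exact_mod_cast Int.lt_add_one_iff.1 this

/-- An augmentation by `δ` increases the sum of the negative parts by `δ`. -/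
theorem negSum_augment {n : ℕ} {z z' : ℕ → ℝ} {δ : ℝ} {s t : ℕ} (hs : s < n) (hδ : 0 < δ)
    (hzs : z s ≤ -δ) (hzt : δ ≤ z t)
    (h : ∀ v < n, z' v = z v + (if v = s then δ else 0) - (if v = t then δ else 0)) :
    negSum n z + δ ≤ negSum n z' := by
  have hst : s ≠ t := by rintro rfl; linarith
  have : negSum n z + δ = ∑ v ∈ range n, (min (z v) 0 + if v = s then δ else 0) := by
    rw [sum_add_distrib, sum_ite_eq' (range n) s (fun _ => δ), if_pos (mem_range.2 hs)]; rfl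
  rw [this]
  refine sum_le_sum fun v hv => ?_
  rw [h v (mem_range.1 hv)]
  by_cases e1 : v = s
  · subst e1
    simp only [if_true, if_neg hst]
    rw [min_eq_left (by linarith)]
    exact le_min (by linarith) (by linarith)
  · simp only [if_neg e1, add_zero]
    by_cases e2 : v = t
    · subst e2
      rw [min_eq_right (by linarith)]
      simp only [if_true]
      exact le_min (by linarith) le_rfl
    · simp [e2]

end

end SFM

namespace SFM

/-! ## The search forest -/

/-- The first `qt` entries of the queue list the set `W` of the vertices reached so far, and `par`
describes a forest of residual arcs which is rooted in `S`. -/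
structure QInv (n : ℕ) (S T : Set ℕ) (phi : ℕ → ℕ → ℝ) (inT inW par que : ℕ → ℕ → ℕ)
    (qt hit tgt : ℕ) : Prop where
  inT_iff : ∀ v < n, inT v 0 = 1 ↔ v ∈ T
  que_lt : ∀ m < qt, que m 0 < n
  que_inj : ∀ m < qt, ∀ m' < qt, que m 0 = que m' 0 → m = m'
  inW_le : ∀ v < n, inW v 0 ≤ 1
  inW_que : ∀ m < qt, inW (que m 0) 0 = 1
  que_of : ∀ v < n, inW v 0 = 1 → ∃ m < qt, que m 0 = v
  par : ∀ m < qt, (par (que m 0) 0 = que m 0 ∧ que m 0 ∈ S) ∨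
    ∃ m' < m, par (que m 0) 0 = que m' 0 ∧ phi (que m' 0) (que m 0) ≤ 0
  S_sub : ∀ v < n, v ∈ S → inW v 0 = 1
  hit_le : hit ≤ 1
  hit0 : hit = 0 → ∀ v < n, inW v 0 = 1 → v ∉ T
  hit1 : hit = 1 → tgt < n ∧ inW tgt 0 = 1 ∧ tgt ∈ T

/-- All residual arcs that leave the first `qh` vertices of the queue end in `W`. -/
def Closed (n : ℕ) (phi : ℕ → ℕ → ℝ) (inW que : ℕ → ℕ → ℕ) (qh : ℕ) : Prop :=
  ∀ m < qh, ∀ b < n, b ≠ que m 0 → phi (que m 0) b ≤ 0 → inW b 0 = 1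

section

variable {n : ℕ} {S T : Set ℕ} {phi phi' : ℕ → ℕ → ℝ} {inT inW par que : ℕ → ℕ → ℕ}
  {qt qh hit tgt : ℕ}

theorem QInv.qt_le (h : QInv n S T phi inT inW par que qt hit tgt) : qt ≤ n := by
  have := Finset.card_le_card_of_injOn (s := Finset.range qt) (t := Finset.range n)
    (fun m => que m 0) (fun m hm => by simpa using h.que_lt m (by simpa using hm))
    (fun m hm m' hm' e => h.que_inj m (by simpa using hm) m' (by simpa using hm') e)
  simpa using this

/-- All arcs of the forest run inside W. A push changes the flow only on arcs at a vertex outside W,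
so it cannot damage the forest. -/
theorem QInv.congr_phi (h : QInv n S T phi inT inW par que qt hit tgt)
    (hφ : ∀ u < n, ∀ v < n, inW u 0 = 1 → inW v 0 = 1 → phi' u v = phi u v) :
    QInv n S T phi' inT inW par que qt hit tgt where
  __ := h
  par m hm := by
    refine (h.par m hm).imp_right ?_
    rintro ⟨m', hm', e, hle⟩
    exact ⟨m', hm', e, by
      rwa [hφ _ (h.que_lt m' (by omega)) _ (h.que_lt m hm) (h.inW_que m' (by omega))
        (h.inW_que m hm)]⟩

/-- Since b was outside W it is new in the queue, and its parent sits at the earlier position m <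
qt; parents preceding their children is what keeps the forest acyclic. -/
theorem QInv.enter (h : QInv n S T phi inT inW par que qt hit tgt) {m a b hit' tgt' : ℕ}
    (hm : m < qt) (ha : que m 0 = a) (hb : b < n) (hbW : inW b 0 = 0) (hab : phi a b ≤ 0)
    (h1 : inT b 0 = 1 → hit' = 1 ∧ tgt' = b) (h2 : inT b 0 ≠ 1 → hit' = hit ∧ tgt' = tgt) :
    QInv n S T phi inT (upd inW b 0 1) (upd par b 0 a) (upd que qt 0 b) (qt + 1) hit' tgt' := by
  have hq : ∀ m < qt, upd que qt 0 b m 0 = que m 0 := by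
    intro m hm
    have : m ≠ qt := by omega
    simp [this]
  have hqb : ∀ m < qt, que m 0 ≠ b := by
    intro m hm e
    have := h.inW_que m hm
    rw [e] at this
    omega
  have hqt : upd que qt 0 b qt 0 = b := by simp
  have hsub : ∀ v, inW v 0 = 1 → upd inW b 0 1 v 0 = 1 := by
    intro v hv
    simp only [upd_apply]
    split_ifs <;> simp [hv]
  refine ⟨h.inT_iff, ?_, ?_, ?_, ?_, ?_, ?_, ?_, ?_, ?_, ?_⟩
  · intro m hm
    rcases Nat.lt_succ_iff_lt_or_eq.1 hm with hm | rfl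
    · rw [hq m hm]; exact h.que_lt m hm
    · rwa [hqt]
  · intro m hm m' hm' e
    rcases Nat.lt_succ_iff_lt_or_eq.1 hm with hm | rfl <;>
      rcases Nat.lt_succ_iff_lt_or_eq.1 hm' with hm' | rfl
    · rw [hq m hm, hq m' hm'] at e
      exact h.que_inj m hm m' hm' e
    · rw [hq m hm, hqt] at e
      exact absurd e (hqb m hm)
    · rw [hq m' hm', hqt] at e
      exact absurd e.symm (hqb m' hm')
    · rfl
  · intro v hv
    have := h.inW_le v hv
    simp only [upd_apply]
    split_ifs <;> omega
  · intro m hm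
    rcases Nat.lt_succ_iff_lt_or_eq.1 hm with hm | rfl
    · rw [hq m hm]; exact hsub _ (h.inW_que m hm)
    · simp
  · intro v hv hvW
    by_cases e : v = b
    · exact ⟨qt, by omega, by rw [hqt, e]⟩
    · simp only [upd_apply, e, false_and, if_false] at hvW
      obtain ⟨m, hm, rfl⟩ := h.que_of v hv hvW
      exact ⟨m, by omega, hq m hm⟩
  · intro m1 hm1
    rcases Nat.lt_succ_iff_lt_or_eq.1 hm1 with hm1 | rfl
    · rw [hq m1 hm1]
      have : upd par b 0 a (que m1 0) 0 = par (que m1 0) 0 := by simp [hqb m1 hm1]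
      rw [this]
      refine (h.par m1 hm1).imp_right ?_
      rintro ⟨m', hm', e⟩
      exact ⟨m', hm', by rwa [hq m' (by omega)]⟩
    · refine Or.inr ⟨m, hm, ?_⟩
      rw [hqt, hq m hm, ha]
      simpa using hab
  · intro v hv hvS
    exact hsub v (h.S_sub v hv hvS)
  · by_cases hT : inT b 0 = 1
    · rw [(h1 hT).1]
    · rw [(h2 hT).1]; exact h.hit_le
  · intro h0 v hv hvW
    by_cases hT : inT b 0 = 1
    · rw [(h1 hT).1] at h0; omega
    · rw [(h2 hT).1] at h0
      by_cases e : v = b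
      · rwa [e, ← h.inT_iff b hb]
      · simp only [upd_apply, e, false_and, if_false] at hvW
        exact h.hit0 h0 v hv hvW
  · intro h0
    by_cases hT : inT b 0 = 1
    · rw [(h1 hT).2]
      exact ⟨hb, by simp, (h.inT_iff b hb).1 hT⟩
    · rw [(h2 hT).1] at h0
      rw [(h2 hT).2]
      have := h.hit1 h0
      exact ⟨this.1, hsub _ this.2.1, this.2.2⟩

theorem Closed.enter (h : Closed n phi inW que qh) (hqh : qh ≤ qt) (b : ℕ) :
    Closed n phi (upd inW b 0 1) (upd que qt 0 b) qh := by
  intro m hm c hc hne hle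
  have : upd que qt 0 b m 0 = que m 0 := by
    have : m ≠ qt := by omega
    simp [this]
  rw [this] at hne hle
  have := h m hm c hc hne hle
  simp only [upd_apply]
  split_ifs <;> simp [this]

end

/-! ### Execution of the breadth-first search -/

section

variable {O : Set ℕ → ℝ}

theorem wp_enterW {s : Mem} {Q : Mem → ℕ → Prop}
    (h : ∀ s' m, Frame enterW s s' →
      s'.nat .inW = upd (s.nat .inW) (s.nat .b 0 0) 0 1 →
      s'.nat .par = upd (s.nat .par) (s.nat .b 0 0) 0 (s.nat .a 0 0) →
      s'.nat .que = upd (s.nat .que) (s.nat .qt 0 0) 0 (s.nat .b 0 0) →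
      s'.nat .qt 0 0 = s.nat .qt 0 0 + 1 →
      (s.nat .inT (s.nat .b 0 0) 0 = 1 → s'.nat .hit 0 0 = 1 ∧ s'.nat .tgt 0 0 = s.nat .b 0 0) →
      (s.nat .inT (s.nat .b 0 0) 0 ≠ 1 →
        s'.nat .hit 0 0 = s.nat .hit 0 0 ∧ s'.nat .tgt 0 0 = s.nat .tgt 0 0) →
      m ≤ 60 → Q s' m) : wp O enterW Q s := by
  refine wp_mono (Q := fun s' m => _ ∧ _ ∧ _ ∧ _ ∧ _ ∧ _ ∧ _) ?_
    (fun s' m hF ⟨h1, h2, h3, h4, h5, h6, h7⟩ => h s' m hF h1 h2 h3 h4 h5 h6 h7)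
  simp only [enterW, block, ifThen, setN1, setN0, inc]
  -- Symbolic execution: the rule that matches the leading command is applied until the program is
  -- used up, leaving one goal for each path through the tests.
  repeat' with_reducible
    first | apply wp_seq | apply wp_setN | apply wp_ite | apply wp_skip | intro
  all_goals simp_all


/-- `QInv` for the current memory. -/
def QI (n : ℕ) (S T : Set ℕ) (s : Mem) : Prop :=
  QInv n S T (s.real .phi) (s.nat .inT) (s.nat .inW) (s.nat .par) (s.nat .que)
    (s.nat .qt 0 0) (s.nat .hit 0 0) (s.nat .tgt 0 0)

/-- Scanning the vertex at queue position `qh`: after the heads below i have been inspected, every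
residual arc to one of them ends in W. Earlier positions stay closed because W only grows. -/
theorem wp_closeW_body {n : ℕ} {S T : Set ℕ} {s : Mem} {qh : ℕ} (hn : s.nat .n 0 0 = n)
    (hQ : QI n S T s) (hC : Closed n (s.real .phi) (s.nat .inW) (s.nat .que) qh)
    (hqh : s.nat .qh 0 0 = qh + 1) (hlt : qh < s.nat .qt 0 0)
    (ha : s.nat .que qh 0 = s.nat .a 0 0) :
    wp O (forTo .b (n0 .n) [
      ifThen (.and (.neq (n1 .inW (n0 .b)) (.lit 0))
          (.and (.not (.neq (n0 .a) (n0 .b)))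
            (.rle (r2 .phi (n0 .a) (n0 .b)) (.lit 0)))) [
        enterW]])
      (fun s' m => QI n S T s' ∧
        Closed n (s'.real .phi) (s'.nat .inW) (s'.nat .que) (qh + 1) ∧
        s.nat .qt 0 0 ≤ s'.nat .qt 0 0 ∧
        (∀ v, s.nat .inW v 0 = 1 → s'.nat .inW v 0 = 1) ∧ m ≤ n * 120 + 20) s := by
  refine wp_mono (wp_forTo n 90 (fun i s' => QI n S T s' ∧
    Closed n (s'.real .phi) (s'.nat .inW) (s'.nat .que) qh ∧
    s.nat .qt 0 0 ≤ s'.nat .qt 0 0 ∧ (∀ v, s.nat .inW v 0 = 1 → s'.nat .inW v 0 = 1) ∧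
    s'.nat .que qh 0 = s.nat .a 0 0 ∧
    ∀ b < i, b ≠ s.nat .a 0 0 → s.real .phi (s.nat .a 0 0) b ≤ 0 → s'.nat .inW b 0 = 1)
    rfl ?_ ?_ ?_) ?_
  · intro s' hF
    simp [hF.nat .n rfl, hn]
  · simpa [QI] using ⟨hQ, hC, ha⟩
  · rintro b hb s' hF hib ⟨hQ, hC, hqt, hW, hque, hpart⟩
    have hφ := hF.real .phi rfl
    have haa := hF.nat .a rfl
    simp only [block, ifThen]
    refine wp_seq (wp_ite ?_ ?_)
    · intro ht
      simp only [BExp.holds, NExp.eval, RExp.eval, n1, n0, r2, hib, hφ, haa] at ht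
      refine wp_seq (wp_enterW ?_)
      intro s1 m1 hF1 e1 e2 e3 e4 e5 e6 hm
      refine wp_skip (wp_skip ?_)
      have hφ1 := hF1.real .phi rfl
      have hT1 := hF1.nat .inT rfl
      rw [hib] at e1 e2 e3 e5 e6
      rw [haa] at e2
      refine ⟨⟨?_, ?_, ?_, ?_, ?_, ?_⟩, ?_⟩
      · simp only [QI, Mem.real_setN, ne_eq, reduceCtorEq, not_false_eq_true, Mem.nat_setN_of_ne]
        rw [hφ1, hT1, e1, e2, e3, e4]
        refine hQ.enter (m := qh) (by omega) hque hb ht.1 ?_ e5 e6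
        rw [hφ]; simpa using ht.2.2
      · simp only [Mem.real_setN, ne_eq, reduceCtorEq, not_false_eq_true, Mem.nat_setN_of_ne]
        rw [hφ1, e1, e3]
        exact hC.enter (by omega) b
      · simp only [ne_eq, reduceCtorEq, not_false_eq_true, Mem.nat_setN_of_ne]
        omega
      · intro v hv
        have := hW v hv
        simp [e1, this]
      · have : qh ≠ s'.nat .qt 0 0 := by omega
        simp [e3, this, hque]
      · intro b' hb' hne hle
        simp only [ne_eq, reduceCtorEq, not_false_eq_true, Mem.nat_setN_of_ne]
        rw [e1]
        simp only [upd_apply]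
        split_ifs with h
        · rfl
        · exact hpart b' (by simp at h; omega) hne hle
      · simp; omega
    · intro ht
      simp only [BExp.holds, NExp.eval, RExp.eval, n1, n0, r2, hib, hφ, haa] at ht
      refine wp_skip (wp_skip ?_)
      refine ⟨⟨by simpa [QI] using hQ, by simpa using hC, by simpa using hqt, by simpa using hW,
        by simpa using hque, ?_⟩, by simp⟩
      intro b' hb' hne hle
      simp only [ne_eq, reduceCtorEq, not_false_eq_true, Mem.nat_setN_of_ne]
      rcases Nat.lt_succ_iff_lt_or_eq.1 hb' with h | rfl
      · exact hpart b' h hne hle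
      · by_contra h1
        have := hQ.inW_le b' hb
        apply ht
        refine ⟨by omega, fun e => hne e.symm, by simpa using hle⟩
  · rintro s' m hF ⟨⟨hQ, hC, hqt, hW, hque, hpart⟩, -, hm⟩
    refine ⟨hQ, ?_, hqt, hW, by simp at hm; omega⟩
    intro m hm b hb hne hle
    rcases Nat.lt_succ_iff_lt_or_eq.1 hm with h | rfl
    · exact hC m h b hb hne hle
    · rw [hque] at hne hle
      rw [hF.real .phi rfl] at hle
      exact hpart b hb hne hle

/-- Each vertex leaves the queue once and costs O(n). The cost is stated as a difference between the
final and initial positions of the queue, so that the costs of all calls within one search telescope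
to O(n²), apart from a constant for each call. -/
theorem wp_closeW {n : ℕ} {S T : Set ℕ} {s : Mem} (hn : s.nat .n 0 0 = n)
    (hQ : QI n S T s)
    (hC : Closed n (s.real .phi) (s.nat .inW) (s.nat .que) (s.nat .qh 0 0))
    (hle : s.nat .qh 0 0 ≤ s.nat .qt 0 0) :
    wp O closeW (fun s' m => QI n S T s' ∧
      Closed n (s'.real .phi) (s'.nat .inW) (s'.nat .que) (s'.nat .qt 0 0) ∧
      s'.nat .qh 0 0 = s'.nat .qt 0 0 ∧ s.nat .qt 0 0 ≤ s'.nat .qt 0 0 ∧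
      (∀ v, s.nat .inW v 0 = 1 → s'.nat .inW v 0 = 1) ∧
      m + (n * 120 + 60) * s.nat .qh 0 0 ≤ (n * 120 + 60) * s'.nat .qt 0 0 + 20) s := by
  refine wp_mono (wp_while (fun s' m => QI n S T s' ∧
    Closed n (s'.real .phi) (s'.nat .inW) (s'.nat .que) (s'.nat .qh 0 0) ∧
    s'.nat .qh 0 0 ≤ s'.nat .qt 0 0 ∧ s.nat .qt 0 0 ≤ s'.nat .qt 0 0 ∧
    (∀ v, s.nat .inW v 0 = 1 → s'.nat .inW v 0 = 1) ∧
    m + (n * 120 + 60) * s.nat .qh 0 0 ≤ (n * 120 + 60) * s'.nat .qh 0 0)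
    (fun s' => n - s'.nat .qh 0 0) ?_ ?_) ?_
  · exact ⟨hQ, hC, hle, le_rfl, fun _ h => h, by omega⟩
  · rintro s' m hF ⟨hQ, hC, hle, hqt, hW, hm⟩ ht
    simp only [BExp.holds, n0, NExp.eval] at ht
    have hqn := QInv.qt_le hQ
    have hn' : s'.nat .n 0 0 = n := by rw [hF.nat .n rfl, hn]
    simp only [block]
    apply wp_seq
    apply wp_setN
    apply wp_seq
    apply wp_setN
    apply wp_seq
    set s1 := ((s'.setN .a 0 0 (s'.nat .que (s'.nat .qh 0 0) 0)).setN .qh 0 0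
      (s'.nat .qh 0 0 + 1)) with hs1
    refine wp_mono (s := s1) (wp_closeW_body (n := n) (S := S) (T := T) (qh := s'.nat .qh 0 0)
      ?_ ?_ ?_ ?_ ?_ ?_) ?_
    · simpa [s1] using hn'
    · simpa [s1, QI] using hQ
    · simpa [s1] using hC
    · simp [s1]
    · simpa [s1] using ht
    · simp [s1]
    · rintro s2 m2 hF2 ⟨hQ2, hC2, hqt2, hW2, hm2⟩
      have hqh2 : s2.nat .qh 0 0 = s'.nat .qh 0 0 + 1 := by rw [hF2.nat .qh rfl]; simp [s1]
      have hqt1 : s1.nat .qt 0 0 = s'.nat .qt 0 0 := by simp [s1]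
      apply wp_skip
      refine ⟨⟨hQ2, by rwa [hqh2], by omega, by omega, ?_, ?_⟩, by omega⟩
      · intro v hv
        apply hW2
        simpa [s1] using hW v hv
      · rw [hqh2]
        simp
        nlinarith
  · rintro s' m hF ⟨m', ⟨hQ, hC, hle, hqt, hW, hm⟩, ht, rfl⟩
    simp only [BExp.holds, n0, NExp.eval, not_lt] at ht
    have hq : s'.nat .qh 0 0 = s'.nat .qt 0 0 := le_antisymm hle ht
    rw [hq] at hC hm
    exact ⟨hQ, hC, hq, hqt, hW, by simp; omega⟩

end

end SFM

/-! ### Computation of `S`, `T` and the first `W` -/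

namespace SFM

section

variable {n : ℕ} {S T : Set ℕ} {phi : ℕ → ℕ → ℝ} {inT inW par que inT' inW' par' que' : ℕ → ℕ → ℕ}
  {qt tgt i : ℕ}

/-- While the vertices are being classified, the forest invariant is used with the number i of
vertices treated so far in place of n; this is the step from i to i + 1 when nothing enters the
queue. -/
theorem QInv.init_succ_of_notMem (h : QInv i S T phi inT inW par que qt 0 tgt) (hiS : i ∉ S)
    (hT : ∀ v < i, inT' v 0 = inT v 0) (hTi : inT' i 0 = 1 ↔ i ∈ T)
    (hW : ∀ v < i, inW' v 0 = inW v 0) (hWi : inW' i 0 = 0) :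
    QInv (i + 1) S T phi inT' inW' par que qt 0 tgt := by
  refine ⟨?_, ?_, h.que_inj, ?_, ?_, ?_, h.par, ?_, by simp, ?_, by simp⟩
  · intro v hv
    rcases Nat.lt_succ_iff_lt_or_eq.1 hv with hv | rfl
    · rw [hT v hv]; exact h.inT_iff v hv
    · exact hTi
  · intro m hm; have := h.que_lt m hm; omega
  · intro v hv
    rcases Nat.lt_succ_iff_lt_or_eq.1 hv with hv | rfl
    · rw [hW v hv]; exact h.inW_le v hv
    · omega
  · intro m hm; rw [hW _ (h.que_lt m hm)]; exact h.inW_que m hm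
  · intro v hv hvW
    rcases Nat.lt_succ_iff_lt_or_eq.1 hv with hv | rfl
    · rw [hW v hv] at hvW; exact h.que_of v hv hvW
    · omega
  · intro v hv hvS
    rcases Nat.lt_succ_iff_lt_or_eq.1 hv with hv | rfl
    · rw [hW v hv]; exact h.S_sub v hv hvS
    · exact absurd hvS hiS
  · intro h0 v hv hvW
    rcases Nat.lt_succ_iff_lt_or_eq.1 hv with hv | rfl
    · rw [hW v hv] at hvW; exact h.hit0 h0 v hv hvW
    · omega

/-- Here i becomes a root, marked by being its own parent. All earlier queue entries are smaller
than i, so no entry is repeated. -/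
theorem QInv.init_succ_of_mem (h : QInv i S T phi inT inW par que qt 0 tgt) (hiS : i ∈ S)
    (hiT : i ∉ T) (hT : ∀ v < i, inT' v 0 = inT v 0) (hTi : inT' i 0 = 1 ↔ i ∈ T)
    (hW : ∀ v < i, inW' v 0 = inW v 0) (hWi : inW' i 0 = 1)
    (hp : ∀ v < i, par' v 0 = par v 0) (hpi : par' i 0 = i)
    (hq : ∀ m < qt, que' m 0 = que m 0) (hqi : que' qt 0 = i) :
    QInv (i + 1) S T phi inT' inW' par' que' (qt + 1) 0 tgt := by
  refine ⟨?_, ?_, ?_, ?_, ?_, ?_, ?_, ?_, by simp, ?_, by simp⟩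
  · intro v hv
    rcases Nat.lt_succ_iff_lt_or_eq.1 hv with hv | rfl
    · rw [hT v hv]; exact h.inT_iff v hv
    · exact hTi
  · intro m hm
    rcases Nat.lt_succ_iff_lt_or_eq.1 hm with hm | rfl
    · rw [hq m hm]; have := h.que_lt m hm; omega
    · omega
  · intro m hm m' hm' e
    rcases Nat.lt_succ_iff_lt_or_eq.1 hm with hm | rfl <;>
      rcases Nat.lt_succ_iff_lt_or_eq.1 hm' with hm' | rfl
    · rw [hq m hm, hq m' hm'] at e
      exact h.que_inj m hm m' hm' e
    · rw [hq m hm, hqi] at e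
      have := h.que_lt m hm
      omega
    · rw [hq m' hm', hqi] at e
      have := h.que_lt m' hm'
      omega
    · rfl
  · intro v hv
    rcases Nat.lt_succ_iff_lt_or_eq.1 hv with hv | rfl
    · rw [hW v hv]; exact h.inW_le v hv
    · omega
  · intro m hm
    rcases Nat.lt_succ_iff_lt_or_eq.1 hm with hm | rfl
    · rw [hq m hm, hW _ (h.que_lt m hm)]; exact h.inW_que m hm
    · rw [hqi, hWi]
  · intro v hv hvW
    rcases Nat.lt_succ_iff_lt_or_eq.1 hv with hv | rfl
    · rw [hW v hv] at hvW
      obtain ⟨m, hm, rfl⟩ := h.que_of v hv hvW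
      exact ⟨m, by omega, hq m hm⟩
    · exact ⟨qt, by omega, hqi⟩
  · intro m hm
    rcases Nat.lt_succ_iff_lt_or_eq.1 hm with hm | rfl
    · rw [hq m hm, hp _ (h.que_lt m hm)]
      refine (h.par m hm).imp_right ?_
      rintro ⟨m', hm', e⟩
      exact ⟨m', hm', by rwa [hq m' (by omega)]⟩
    · rw [hqi]; exact Or.inl ⟨hpi, hiS⟩
  · intro v hv hvS
    rcases Nat.lt_succ_iff_lt_or_eq.1 hv with hv | rfl
    · rw [hW v hv]; exact h.S_sub v hv hvS
    · exact hWi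
  · intro h0 v hv hvW
    rcases Nat.lt_succ_iff_lt_or_eq.1 hv with hv | rfl
    · rw [hW v hv] at hvW; exact h.hit0 h0 v hv hvW
    · exact hiT

end

section

variable {O : Set ℕ → ℝ}

/-- The sets `S` and `T`. -/
def setS (n : ℕ) (δ : ℝ) (x phi : ℕ → ℕ → ℝ) : Set ℕ := {v | zeta n x phi v ≤ -δ}
def setT (n : ℕ) (δ : ℝ) (x phi : ℕ → ℕ → ℝ) : Set ℕ := {v | δ ≤ zeta n x phi v}

theorem wp_zeta {n : ℕ} {s : Mem} (hn : s.nat .n 0 0 = n) {c : ℝ} (hz : s.real .z 0 0 = c) :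
    wp O (forTo .w (n0 .n) [
      setR0 .z (.sub (r0 .z) (r2 .phi (n0 .w) (n0 .v)))])
      (fun s' m => s'.real .z 0 0 = c - ∑ w ∈ Finset.range n, s.real .phi w (s.nat .v 0 0) ∧
        m ≤ n * 50 + 20) s := by
  refine wp_mono (wp_forTo n 30 (fun i s' =>
    s'.real .z 0 0 = c - ∑ w ∈ Finset.range i, s.real .phi w (s.nat .v 0 0)) rfl ?_ ?_ ?_) ?_
  · intro s' hF
    simp [hF.nat .n rfl, hn]
  · simp [hz]
  · rintro w hw s' hF hiw hI
    simp only [block, setR0]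
    refine wp_seq (wp_setR (wp_skip ?_))
    simp [hiw, hI, hF.nat .v rfl, hF.real .phi rfl, Finset.sum_range_succ]
    ring
  · rintro s' m hF ⟨h, -, hm⟩
    exact ⟨h, by simp at hm; omega⟩

theorem wp_computeSTW {n : ℕ} {s : Mem} {δ : ℝ} (hn : s.nat .n 0 0 = n)
    (hδ : s.real .delta 0 0 = δ) (hδ0 : 0 < δ) :
    wp O computeSTW (fun s' m =>
      QI n (setS n δ (s.real .x) (s.real .phi)) (setT n δ (s.real .x) (s.real .phi)) s' ∧
      Closed n (s'.real .phi) (s'.nat .inW) (s'.nat .que) (s'.nat .qt 0 0) ∧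
      s'.nat .qh 0 0 = s'.nat .qt 0 0 ∧
      (s'.nat .nS 0 0 = 0 → ∀ v < n, v ∉ setS n δ (s.real .x) (s.real .phi)) ∧
      (s'.nat .nT 0 0 = 0 → ∀ v < n, v ∉ setT n δ (s.real .x) (s.real .phi)) ∧
      m ≤ 200 * (n * n) + 400 * n + 100) s := by
  set S := setS n δ (s.real .x) (s.real .phi) with hS
  set T := setT n δ (s.real .x) (s.real .phi) with hT
  -- Disjointness needs δ > 0. It is the reason why `hit` may be 0 while only vertices of S have
  -- entered W.
  have hST : ∀ v, v ∈ S → v ∉ T := by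
    intro v h1 h2
    simp only [hS, hT, setS, setT, Set.mem_ofPred_eq] at h1 h2
    linarith
  simp only [computeSTW, block, setN0]
  refine wp_seq (wp_setN (wp_seq (wp_setN (wp_seq (wp_setN (wp_seq (wp_setN
    (wp_seq (wp_setN (wp_seq ?_))))))))))
  refine wp_mono (wp_forTo n (n * 50 + 200) (fun i s' => QI i S T s' ∧ s'.nat .hit 0 0 = 0 ∧
    s'.nat .qh 0 0 = 0 ∧ (s'.nat .nS 0 0 = 0 → ∀ v < i, v ∉ S) ∧
    (s'.nat .nT 0 0 = 0 → ∀ v < i, v ∉ T)) rfl ?_ ?_ ?_) ?_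
  · intro s' hF
    simp [hF.nat .n rfl, hn]
  · simp only [QI]
    simp
    constructor <;> simp
  · rintro v hv s1 hF1 hvv ⟨hQ, hhit, hqh, hnS, hnT⟩
    have hx1 : s1.real .x = s.real .x := by simp [hF1.real .x rfl]
    have hp1 : s1.real .phi = s.real .phi := by simp [hF1.real .phi rfl]
    have hd1 : s1.real .delta = s.real .delta := by simp [hF1.real .delta rfl]
    simp only [block]
    refine wp_seq (wp_setR (wp_seq ?_))
    refine wp_mono (wp_zeta (n := n) (c := s.real .x v 0) (by simp [hF1.nat .n rfl, hn])
      (by simp [hvv, hx1])) ?_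
    rintro s2 m2 hF2 ⟨hz, hm2⟩
    have hv2 : s2.nat .v 0 0 = v := by simp [hF2.nat .v rfl, hvv]
    have hd2 : s2.real .delta 0 0 = δ := by simp [hF2.real .delta rfl, hd1, hδ]
    have hz2 : s2.real .z 0 0 = zeta n (s.real .x) (s.real .phi) v := by
      rw [hz]; simp [zeta, hp1, hvv]
    have hSv : s2.real .z 0 0 ≤ -δ ↔ v ∈ S := by rw [hz2]; simp [hS, setS]
    have hTv : δ ≤ s2.real .z 0 0 ↔ v ∈ T := by rw [hz2]; simp [hT, setT]
    have e1 : s2.nat .inT = s1.nat .inT := by simp [hF2.nat .inT rfl]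
    have e2 : s2.nat .inW = s1.nat .inW := by simp [hF2.nat .inW rfl]
    have e3 : s2.nat .par = s1.nat .par := by simp [hF2.nat .par rfl]
    have e4 : s2.nat .que = s1.nat .que := by simp [hF2.nat .que rfl]
    have e5 : s2.nat .qt = s1.nat .qt := by simp [hF2.nat .qt rfl]
    have e6 : s2.nat .hit = s1.nat .hit := by simp [hF2.nat .hit rfl]
    have e7 : s2.nat .tgt = s1.nat .tgt := by simp [hF2.nat .tgt rfl]
    have e8 : s2.nat .nS = s1.nat .nS := by simp [hF2.nat .nS rfl]
    have e9 : s2.nat .nT = s1.nat .nT := by simp [hF2.nat .nT rfl]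
    have e10 : s2.nat .qh = s1.nat .qh := by simp [hF2.nat .qh rfl]
    have e11 : s2.real .phi = s1.real .phi := by simp [hF2.real .phi rfl]
    simp only [QI, hhit] at hQ
    by_cases hvS : v ∈ S
    · have hvT := hST v hvS
      have c1 := hSv.2 hvS
      have c2 : ¬ δ ≤ s2.real .z 0 0 := fun h => hvT (hTv.1 h)
      simp only [block, ifThen, setN1, setN0, inc]
      repeat' with_reducible
        first | apply wp_seq | apply wp_setN | apply wp_ite | apply wp_skip | intro
      · rename_i h; exact absurd (by simpa [hd2] using h) c2
      · refine ⟨⟨?_, ?_, ?_, ?_, ?_⟩, ?_⟩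
        · simp only [QI]
          simp [hv2, e1, e2, e3, e4, e5, e6, e7, e11, hhit]
          refine hQ.init_succ_of_mem hvS hvT ?_ ?_ ?_ ?_ ?_ ?_ ?_ ?_
          · intro w hw; simp [hw.ne]
          · simp [hvT]
          · intro w hw; simp [hw.ne]
          · simp
          · intro w hw; simp [hw.ne]
          · simp
          · intro w hw; simp [hw.ne]
          · simp
        · simp [e6, hhit]
        · simp [e10, hqh]
        · simp
        · simp only [ne_eq, reduceCtorEq, not_false_eq_true, Mem.nat_setN_of_ne, e9]
          intro h0 w hw
          rcases Nat.lt_succ_iff_lt_or_eq.1 hw with hw | rfl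
          · exact hnT h0 w hw
          · exact hvT
        · simp; omega
      · rename_i h _; exact absurd (by simpa [hd2] using c1) h
      · rename_i h _; exact absurd (by simpa [hd2] using c1) h
    · have c1 : ¬ s2.real .z 0 0 ≤ -δ := fun h => hvS (hSv.1 h)
      by_cases hvT : v ∈ T
      · have c2 := hTv.2 hvT
        simp only [block, ifThen, setN1, setN0, inc]
        repeat' with_reducible
          first | apply wp_seq | apply wp_setN | apply wp_ite | apply wp_skip | intro
        · rename_i h _; exact absurd (by simpa [hd2] using h) c1
        · rename_i h _; exact absurd (by simpa [hd2] using h) c1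
        · refine ⟨⟨?_, ?_, ?_, ?_, ?_⟩, ?_⟩
          · simp only [QI]
            simp [hv2, e1, e2, e3, e4, e5, e6, e7, e11, hhit]
            refine hQ.init_succ_of_notMem hvS ?_ ?_ ?_ ?_
            · intro w hw; simp [hw.ne]
            · simp [hvT]
            · intro w hw; simp [hw.ne]
            · simp
          · simp [e6, hhit]
          · simp [e10, hqh]
          · simp only [ne_eq, reduceCtorEq, not_false_eq_true, Mem.nat_setN_of_ne, e8]
            intro h0 w hw
            rcases Nat.lt_succ_iff_lt_or_eq.1 hw with hw | rfl
            · exact hnS h0 w hw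
            · exact hvS
          · simp
          · simp; omega
        · rename_i h; exact absurd (by simpa [hd2] using c2) h
      · have c2 : ¬ δ ≤ s2.real .z 0 0 := fun h => hvT (hTv.1 h)
        simp only [block, ifThen, setN1, setN0, inc]
        repeat' with_reducible
          first | apply wp_seq | apply wp_setN | apply wp_ite | apply wp_skip | intro
        · rename_i h _; exact absurd (by simpa [hd2] using h) c1
        · rename_i h _; exact absurd (by simpa [hd2] using h) c1
        · rename_i h; exact absurd (by simpa [hd2] using h) c2
        · refine ⟨⟨?_, ?_, ?_, ?_, ?_⟩, ?_⟩
          · simp only [QI]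
            simp [hv2, e1, e2, e3, e4, e5, e6, e7, e11, hhit]
            refine hQ.init_succ_of_notMem hvS ?_ ?_ ?_ ?_
            · intro w hw; simp [hw.ne]
            · simp [hvT]
            · intro w hw; simp [hw.ne]
            · simp
          · simp [e6, hhit]
          · simp [e10, hqh]
          · simp only [ne_eq, reduceCtorEq, not_false_eq_true, Mem.nat_setN_of_ne, e8]
            intro h0 w hw
            rcases Nat.lt_succ_iff_lt_or_eq.1 hw with hw | rfl
            · exact hnS h0 w hw
            · exact hvS
          · simp only [ne_eq, reduceCtorEq, not_false_eq_true, Mem.nat_setN_of_ne, e9]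
            intro h0 w hw
            rcases Nat.lt_succ_iff_lt_or_eq.1 hw with hw | rfl
            · exact hnT h0 w hw
            · exact hvT
          · simp; omega
  · rintro s1 m1 hF1 ⟨⟨hQ, hhit, hqh, hnS, hnT⟩, -, hm1⟩
    apply wp_seq
    refine wp_mono (wp_closeW (n := n) (S := S) (T := T) ?_ hQ ?_ ?_) ?_
    · simp [hF1.nat .n rfl, hn]
    · rw [hqh]; intro m hm; omega
    · omega
    · rintro s2 m2 hF2 ⟨hQ2, hC2, hq2, hqt2, hW2, hm2⟩
      apply wp_skip
      have hqn := QInv.qt_le hQ2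
      rw [hF2.nat .nS rfl, hF2.nat .nT rfl]
      refine ⟨hQ2, hC2, hq2, hnS, hnT, ?_⟩
      simp at hm1 ⊢
      nlinarith

end

end SFM

namespace SFM

open Finset

/-! ## Pushes -/

theorem IsOracle.congr {O : Set ℕ → ℝ} {n : ℕ} {M : ℝ} (hO : IsOracle O n M) {X Y : Set ℕ}
    (h : ∀ m < n, m ∈ X ↔ m ∈ Y) : O X = O Y := by
  rw [← hO.inter X, ← hO.inter Y]
  congr 1
  ext m
  simp only [Set.mem_inter_iff, Set.mem_Iio]
  constructor
  · rintro ⟨h1, h2⟩; exact ⟨(h m h2).1 h1, h2⟩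
  · rintro ⟨h1, h2⟩; exact ⟨(h m h2).2 h1, h2⟩

/-- Sending `-α` units of flow along the arc `(u, v)`. -/
structure FlowChange (n : ℕ) (u v : ℕ) (α : ℝ) (phi phi' : ℕ → ℕ → ℝ) : Prop where
  eq : ∀ a b, phi' a b = phi a b - (if a = u ∧ b = v then α else 0) +
    (if a = v ∧ b = u then α else 0)

/-- The boundary falls by α at v and rises by α at u, just as x does in a push. This is why ζ is
invariant. -/
theorem FlowChange.sum {n u v : ℕ} {α : ℝ} {phi phi' : ℕ → ℕ → ℝ}
    (h : FlowChange n u v α phi phi') (hu : u < n) (hv : v < n) (b : ℕ) :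
    ∑ w ∈ range n, phi' w b =
      ∑ w ∈ range n, phi w b - (if b = v then α else 0) + (if b = u then α else 0) := by
  simp_rw [h.eq, sum_add_distrib, sum_sub_distrib]
  congr 1
  · congr 1
    by_cases hb : b = v
    · simp [hb, hu]
    · simp [hb]
  · by_cases hb : b = u
    · simp [hb, hv]
    · simp [hb]

theorem FlowChange.isFlow {n u v : ℕ} {α δ : ℝ} {phi phi' : ℕ → ℕ → ℝ}
    (h : FlowChange n u v α phi phi') (hφ : IsFlow n δ phi) (hu : u < n) (hv : v < n)
    (h1 : -δ ≤ phi u v - α) (h2 : phi u v - α ≤ δ) (huv : u ≠ v) : IsFlow n δ phi' := by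
  constructor
  · intro a ha b hb
    rw [h.eq, h.eq, hφ.skew a ha b hb]
    have e1 : (b = u ∧ a = v) ↔ (a = v ∧ b = u) := and_comm
    have e2 : (b = v ∧ a = u) ↔ (a = u ∧ b = v) := and_comm
    rw [if_congr e1 rfl rfl, if_congr e2 rfl rfl]
    ring
  · intro a ha b hb
    rw [h.eq]
    by_cases e1 : a = u ∧ b = v
    · obtain ⟨rfl, rfl⟩ := e1
      simp [huv]
      linarith
    · by_cases e2 : a = v ∧ b = u
      · obtain ⟨rfl, rfl⟩ := e2
        have := hφ.skew b hb a ha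
        simp [huv.symm]
        linarith
      · simp only [e1, e2, if_false]
        have := hφ.le a ha b hb
        linarith

/-- The invariant of the search: `ζ` is the difference of `x` and the boundary of the flow. -/
structure Core (O : Set ℕ → ℝ) (n : ℕ) (δ : ℝ) (ζ : ℕ → ℝ) (s : Mem) : Prop where
  n_eq : s.nat .n 0 0 = n
  delta_eq : s.real .delta 0 0 = δ
  base : Base O n (s.nat .k 0 0) (s.nat .L) (s.real .y) (s.real .lam) (s.real .x)
  flow : IsFlow n δ (s.real .phi)
  zeta_eq : ∀ v < n, zeta n (s.real .x) (s.real .phi) v = ζ v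

/-- The commands of `push` before the update of the flow. -/
def pushCap : List Cmd := [
  setN1 .qry (n0 .u) (.lit 1),
  query0 .g,
  setN1 .qry (n0 .v) (.lit 0),
  query0 .h,
  setN1 .qry (n0 .v) (.lit 1),
  setR0 .cap (.add (.sub (r0 .h) (r0 .g)) (r2 .y (n0 .i) (n0 .v))),
  ifElse (.rle (.mul (r1 .lam (n0 .i)) (r0 .cap)) (r0 .delta))
    [setR0 .alpha (.mul (r1 .lam (n0 .i)) (r0 .cap))]
    [setR0 .alpha (r0 .delta)]]

def pushFlow : List Cmd := [
  setR2 .phi (n0 .u) (n0 .v) (.sub (r2 .phi (n0 .u) (n0 .v)) (r0 .alpha)),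
  setR2 .phi (n0 .v) (n0 .u) (.add (r2 .phi (n0 .v) (n0 .u)) (r0 .alpha))]

/-- The part of `push` that splits the coefficient of the extreme base. -/
def pushCopy : List Cmd := [
  ifThen (.rlt (r0 .alpha) (.mul (r1 .lam (n0 .i)) (r0 .cap))) [
    setR1 .lam (n0 .k) (.sub (r1 .lam (n0 .i)) (.div (r0 .alpha) (r0 .cap))),
    setR1 .lam (n0 .i) (.div (r0 .alpha) (r0 .cap)),
    forTo .w (n0 .n) [
      setR2 .y (n0 .k) (n0 .w) (r2 .y (n0 .i) (n0 .w)),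
      setN2 .L (n0 .k) (n0 .w) (n2 .L (n0 .i) (n0 .w))],
    inc .k]]

/-- The part of `push` that changes the extreme base. -/
def pushSwap : List Cmd := [
  setR2 .y (n0 .i) (n0 .u) (.add (r2 .y (n0 .i) (n0 .u)) (r0 .cap)),
  setR2 .y (n0 .i) (n0 .v) (.sub (r2 .y (n0 .i) (n0 .v)) (r0 .cap)),
  setN2 .L (n0 .i) (n0 .q) (n0 .u),
  setN2 .L (n0 .i) (.succ (n0 .q)) (n0 .v),
  setR1 .x (n0 .u) (.add (r1 .x (n0 .u)) (r0 .alpha)),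
  setR1 .x (n0 .v) (.sub (r1 .x (n0 .v)) (r0 .alpha))]

section

variable {O : Set ℕ → ℝ} {n : ℕ} {M : ℝ}

/-- The query array already holds the initial segment ending at v, so both oracle arguments arise by
changing single entries. This keeps the cost independent of n. -/
theorem wp_pushCap (hO : IsOracle O n M) {s : Mem} {L : ℕ → ℕ} {q i v u : ℕ}
    (hi : s.nat .i 0 0 = i) (hv : s.nat .v 0 0 = v) (hu : s.nat .u 0 0 = u)
    (hLv : L q = v) (hLu : L (q + 1) = u)
    (hqry : ∀ m < n, s.nat .qry m 0 ≠ 0 ↔ m ∈ pre L (q + 1)) :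
    wp O (block pushCap) (fun s' m =>
      s'.real .cap 0 0 = O (pre L (q + 2) \ {v}) - O (pre L (q + 2)) + s.real .y i v ∧
      s'.real .alpha 0 0 = min (s.real .delta 0 0) (s.real .lam i 0 *
        (O (pre L (q + 2) \ {v}) - O (pre L (q + 2)) + s.real .y i v)) ∧
      (∀ m < n, s'.nat .qry m 0 ≠ 0 ↔ m ∈ pre L (q + 2)) ∧ m ≤ 100) s := by
  have hvp : v ∈ pre L (q + 2) := ⟨q, by omega, hLv⟩
  have hsucc : ∀ m, m ∈ pre L (q + 2) ↔ m = u ∨ m ∈ pre L (q + 1) := by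
    intro m; rw [pre_succ, hLu]; simp
  set s1 := s.setN .qry u 0 1 with hs1
  have h1 : ∀ m < n, s1.nat .qry m 0 ≠ 0 ↔ m ∈ pre L (q + 2) := by
    intro m hm
    rw [hsucc, ← hqry m hm]
    by_cases e : m = u <;> simp [s1, e]
  have hg : O s1.querySet = O (pre L (q + 2)) := hO.congr (fun m hm => by
    simpa [Mem.querySet] using h1 m hm)
  set s2 := s1.setR .g 0 0 (O (pre L (q + 2))) with hs2
  set s3 := s2.setN .qry v 0 0 with hs3
  have h3 : ∀ m < n, s3.nat .qry m 0 ≠ 0 ↔ m ∈ pre L (q + 2) \ {v} := by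
    intro m hm
    simp only [s3, s2, Set.mem_sdiff, ← h1 m hm]
    simp
    tauto
  have hh : O s3.querySet = O (pre L (q + 2) \ {v}) := hO.congr (fun m hm => by
    simpa [Mem.querySet] using h3 m hm)
  have h5 : ∀ m < n, (s3.setN .qry v 0 1).nat .qry m 0 ≠ 0 ↔ m ∈ pre L (q + 2) := by
    intro m hm
    by_cases e : m = v
    · simp [e, hvp]
    · have := h3 m hm
      simp only [Set.mem_sdiff, Set.mem_singleton_iff, e, not_false_eq_true, and_true] at this
      rw [← this]
      simp [e]
  simp only [pushCap, block, setN1, setR0, query0, ifElse, n0, r0]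
  refine wp_seq (wp_setN (wp_seq (wp_query (wp_seq (wp_setN (wp_seq (wp_query (wp_seq (wp_setN
    (wp_seq (wp_setR ?_)))))))))))
  simp only [NExp.eval, hu, ← hs1, hg, ← hs2, Mem.nat_setR]
  have hv3 : s3.nat .v 0 0 = v := by simp [s3, s2, s1, hv]
  have hi3 : s3.nat .i 0 0 = i := by simp [s3, s2, s1, hi]
  have hr3 : s3.real .y = s.real .y := by simp [s3, s2, s1]
  have hl3 : s3.real .lam = s.real .lam := by simp [s3, s2, s1]
  have hd3 : s3.real .delta = s.real .delta := by simp [s3, s2, s1]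
  have hv2 : s2.nat .v 0 0 = v := by simp [s2, s1, hv]
  have hg3 : s3.real .g 0 0 = O (pre L (q + 2)) := by simp [s3, s2]
  simp only [r2, r1, hv2, ← hs3]
  rw [hh]
  refine wp_seq (wp_ite ?_ ?_) <;> intro ht <;>
    refine wp_seq (wp_setR (wp_skip (wp_skip ?_))) <;>
    simp [hi3, hl3, hd3, hr3, hv3, hg3] at ht ⊢
  · refine ⟨ht, ?_⟩
    intro m hm
    simpa using h5 m hm
  · refine ⟨ht.le, ?_⟩
    intro m hm
    simpa using h5 m hm

/-- Only the branch that copies an ordering costs O(n); it is kept apart because it must be paid for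
by growth of W. -/
theorem wp_pushCopy {s : Mem} {i k : ℕ} (hn : s.nat .n 0 0 = n) (hi : s.nat .i 0 0 = i)
    (hk : s.nat .k 0 0 = k) (hik : i < k) :
    wp O (block pushCopy) (fun s' m =>
      (s'.real .lam = s.real .lam ∧ s'.real .y = s.real .y ∧ s'.nat .L = s.nat .L ∧
        s'.nat .k 0 0 = k ∧ s.real .lam i 0 * s.real .cap 0 0 ≤ s.real .alpha 0 0 ∧ m ≤ 60) ∨
      (s.real .alpha 0 0 < s.real .lam i 0 * s.real .cap 0 0 ∧
        s'.nat .k 0 0 = k + 1 ∧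
        s'.real .lam i 0 = s.real .alpha 0 0 / s.real .cap 0 0 ∧
        s'.real .lam k 0 = s.real .lam i 0 - s.real .alpha 0 0 / s.real .cap 0 0 ∧
        (∀ j, j ≠ i → j ≠ k → s'.real .lam j 0 = s.real .lam j 0) ∧
        (∀ j, j ≠ k → s'.real .y j = s.real .y j) ∧
        (∀ j, j ≠ k → s'.nat .L j = s.nat .L j) ∧
        (∀ w < n, s'.real .y k w = s.real .y i w) ∧
        (∀ w < n, s'.nat .L k w = s.nat .L i w) ∧ m ≤ n * 100 + 160)) s := by
  have hne : i ≠ k := by omega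
  simp only [pushCopy, block, ifThen, setR1]
  refine wp_seq (wp_ite ?_ ?_) <;> intro ht
  · refine wp_seq (wp_setR (wp_seq (wp_setR (wp_seq ?_))))
    refine wp_mono (wp_forTo n 60 (fun p s' => (∀ j, j ≠ k → s'.real .y j = s.real .y j) ∧
        (∀ j, j ≠ k → s'.nat .L j = s.nat .L j) ∧
        (∀ w < p, s'.real .y k w = s.real .y i w) ∧
        (∀ w < p, s'.nat .L k w = s.nat .L i w)) rfl ?_ ?_ ?_) ?_
    · intro s' hF
      simp [hF.nat .n rfl, hn]
    · simp
    · rintro p hp s' hF hw ⟨h1, h2, h3, h4⟩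
      have hk' : s'.nat .k 0 0 = k := by simp [hF.nat .k rfl, hk]
      have hi' : s'.nat .i 0 0 = i := by simp [hF.nat .i rfl, hi]
      simp only [block, setR2, setN2]
      refine wp_seq (wp_setR (wp_seq (wp_setN (wp_skip ?_))))
      simp [hk', hi', hw]
      refine ⟨?_, ?_, ?_, ?_⟩
      · intro j hj
        funext w
        simp [hj, h1 j hj]
      · intro j hj
        funext w
        simp [hj, h2 j hj]
      · intro w hwp
        split_ifs with e
        · rw [h1 i hne, e]
        · exact h3 w (by omega)
      · intro w hwp
        split_ifs with e
        · rw [h2 i hne, e]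
        · exact h4 w (by omega)
    · rintro s' m hF ⟨⟨h1, h2, h3, h4⟩, -, hm⟩
      have hl : s'.real .lam = _ := hF.real .lam rfl
      have hk' : s'.nat .k 0 0 = k := by simp [hF.nat .k rfl, hk]
      simp only [inc, setN0]
      refine wp_seq (wp_setN (wp_skip (wp_skip ?_)))
      right
      simp [hi] at ht
      refine ⟨ht, by simp [hk'], ?_, ?_, ?_, ?_, ?_, ?_, ?_, ?_⟩
      · simp [hl, hi]
      · simp [hl, hk, hi, hne.symm]
      · intro j h1 h2; simp [hl, hk, hi, h1, h2]
      · simpa using h1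
      · simpa using h2
      · simpa using h3
      · simpa using h4
      · simp at hm ⊢; omega
  · simp [hi] at ht
    refine wp_skip (wp_skip ?_)
    left
    simp [hk, ht]

/-- A push along the residual-free arc `(u, v)`. -/
theorem wp_push (hO : IsOracle O n M) {s : Mem} {δ : ℝ} {ζ : ℕ → ℝ} {q i v u k : ℕ}
    (hδ : 0 ≤ δ) (hC : Core O n δ ζ s) (hk : s.nat .k 0 0 = k) (hik : i < k) (hq : q + 1 < n)
    (hi : s.nat .i 0 0 = i) (hv : s.nat .v 0 0 = v) (hu : s.nat .u 0 0 = u)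
    (hqq : s.nat .q 0 0 = q) (hLv : s.nat .L i q = v) (hLu : s.nat .L i (q + 1) = u)
    (hφ : 0 < s.real .phi u v)
    (hqry : ∀ m < n, s.nat .qry m 0 ≠ 0 ↔ m ∈ pre (s.nat .L i) (q + 1)) :
    wp O push (fun s' m => Core O n δ ζ s' ∧
      (∀ m < n, s'.nat .qry m 0 ≠ 0 ↔ m ∈ pre (s.nat .L i) (q + 2)) ∧
      (∃ α, FlowChange n u v α (s.real .phi) (s'.real .phi)) ∧
      s'.nat .L i q = u ∧ s'.nat .L i (q + 1) = v ∧
      (∀ p, p ≠ q → p ≠ q + 1 → s'.nat .L i p = s.nat .L i p) ∧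
      (∀ j < k, j ≠ i → s'.nat .L j = s.nat .L j) ∧
      ((s'.nat .k 0 0 = k ∧ m ≤ 600) ∨
        (s'.nat .k 0 0 = k + 1 ∧ s'.real .phi u v ≤ 0 ∧
          (∀ p < n, s'.nat .L k p = s.nat .L i p) ∧ m ≤ n * 100 + 600))) s := by
  have hbase := hC.base
  rw [hk] at hbase
  have hext := hbase.ext i hik
  have hord := hext.toIsOrd
  have hvn : v < n := hLv ▸ hord.lt q (by omega)
  have hun : u < n := hLu ▸ hord.lt _ hq
  have huv : u ≠ v := by
    rintro rfl
    have := hord.inj _ hq q (by omega) (hLu.trans hLv.symm)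
    omega
  have hcap := hext.cap_nonneg hO hq
  rw [hLv] at hcap
  set c := O (pre (s.nat .L i) (q + 2) \ {v}) - O (pre (s.nat .L i) (q + 2)) +
    s.real .y i v with hc
  set α := min δ (s.real .lam i 0 * c) with hα
  have hlam := hbase.nonneg i hik
  have hα0 : 0 ≤ α := le_min hδ (mul_nonneg hlam hcap)
  have hαδ : α ≤ δ := min_le_left _ _
  have hpush : push = block (pushCap ++ (pushFlow ++ (pushCopy ++ pushSwap))) := rfl
  rw [hpush]
  apply wp_block_append
  refine wp_mono (wp_pushCap hO hi hv hu hLv hLu hqry) ?_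
  rintro s1 m1 hF1 ⟨h1c, h1a, h1q, hm1⟩
  rw [← hc] at h1c
  rw [hC.delta_eq, ← hc, ← hα] at h1a
  have hφ1 := hF1.real .phi rfl
  have hu1 := hF1.nat .u rfl
  have hv1 := hF1.nat .v rfl
  apply wp_block_append
  simp only [pushFlow, block, setR2]
  refine wp_seq (wp_setR (wp_seq (wp_setR (wp_skip ?_))))
  simp only [NExp.eval, RExp.eval, n0, r2, r0, hu1, hv1, hu, hv, Mem.nat_setR]
  rw [hφ1]
  set s2 := (s1.setR .phi u v (s.real .phi u v - s1.real .alpha 0 0)) with hs2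
  have h2phi : s2.real .phi v u = s.real .phi v u := by
    simp [hs2, huv.symm, hφ1]
  have h2a : s2.real .alpha 0 0 = α := by simp [hs2, h1a]
  rw [h2phi, h2a]
  set s3 := s2.setR .phi v u (s.real .phi v u + α) with hs3
  have hFC : FlowChange n u v α (s.real .phi) (s3.real .phi) := by
    constructor
    intro a b
    simp only [hs3, hs2, Mem.real_setR_self, upd_apply, h1a, hφ1]
    by_cases e1 : a = v ∧ b = u
    · obtain ⟨rfl, rfl⟩ := e1
      simp [huv.symm]
    · by_cases e2 : a = u ∧ b = v
      · obtain ⟨rfl, rfl⟩ := e2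
        simp [huv]
      · simp [e1, e2]
  have hφ3 : s3.real .phi u v = s.real .phi u v - α := by
    rw [hFC.eq]; simp [huv]
  have hflow : IsFlow n δ (s3.real .phi) :=
    hFC.isFlow hC.flow hun hvn (by linarith) (by have := hC.flow.le u hun v hvn; linarith) huv
  have hn3 : s3.nat .n 0 0 = n := by simp [hs3, hs2, hF1.nat .n rfl, hC.n_eq]
  have hi3 : s3.nat .i 0 0 = i := by simp [hs3, hs2, hF1.nat .i rfl, hi]
  have hk3 : s3.nat .k 0 0 = k := by simp [hs3, hs2, hF1.nat .k rfl, hk]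
  have hlam3 : s3.real .lam = s.real .lam := by simp [hs3, hs2, hF1.real .lam rfl]
  have hy3 : s3.real .y = s.real .y := by simp [hs3, hs2, hF1.real .y rfl]
  have hL3 : s3.nat .L = s.nat .L := by simp [hs3, hs2, hF1.nat .L rfl]
  have hx3 : s3.real .x = s.real .x := by simp [hs3, hs2, hF1.real .x rfl]
  have hq3 : s3.nat .q 0 0 = q := by simp [hs3, hs2, hF1.nat .q rfl, hqq]
  have hu3 : s3.nat .u 0 0 = u := by simp [hs3, hs2, hu1, hu]
  have hv3 : s3.nat .v 0 0 = v := by simp [hs3, hs2, hv1, hv]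
  have hqry3 : s3.nat .qry = s1.nat .qry := by simp [hs3, hs2]
  have hc3 : s3.real .cap 0 0 = c := by simp [hs3, hs2, h1c]
  have ha3 : s3.real .alpha 0 0 = α := by simp [hs3, h2a]
  have hd3 : s3.real .delta = s.real .delta := by simp [hs3, hs2, hF1.real .delta rfl]
  clear_value s3
  apply wp_block_append
  refine wp_mono (wp_pushCopy hn3 hi3 hk3 hik) ?_
  rintro s4 m4 hF4 h4
  rw [hlam3, hy3, hL3, hc3, ha3] at h4
  have hi4 : s4.nat .i 0 0 = i := by simp [hF4.nat .i rfl, hi3]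
  have hu4 : s4.nat .u 0 0 = u := by simp [hF4.nat .u rfl, hu3]
  have hv4 : s4.nat .v 0 0 = v := by simp [hF4.nat .v rfl, hv3]
  have hq4 : s4.nat .q 0 0 = q := by simp [hF4.nat .q rfl, hq3]
  have hc4 : s4.real .cap 0 0 = c := by simp [hF4.real .cap rfl, hc3]
  have ha4 : s4.real .alpha 0 0 = α := by simp [hF4.real .alpha rfl, ha3]
  have hφ4 : s4.real .phi = s3.real .phi := hF4.real .phi rfl
  have hx4 : s4.real .x = s.real .x := by simp [hF4.real .x rfl, hx3]
  -- Both branches meet here: whether or not the coefficient was split, α = λ_i c now holds, so the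
  -- change of x is λ_i times the change of y_i.
  have key : ∃ k', s4.nat .k 0 0 = k' ∧ i < k' ∧ k ≤ k' ∧
      Base O n k' (s4.nat .L) (s4.real .y) (s4.real .lam) (s.real .x) ∧
      α = s4.real .lam i 0 * c ∧ (∀ j < k, s4.nat .L j = s.nat .L j) ∧
      (∀ j < k, s4.real .y j = s.real .y j) ∧
      ((k' = k ∧ m4 ≤ 60) ∨
        (k' = k + 1 ∧ s3.real .phi u v ≤ 0 ∧
          (∀ p < n, s4.nat .L k p = s.nat .L i p) ∧ m4 ≤ n * 100 + 160)) := by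
    rcases h4 with ⟨h1, h2, h3, h4, h5, h6⟩ | ⟨h1, h2, h3, h4, h5, h6, h7, h8, h9, h10⟩
    · refine ⟨k, h4, hik, le_rfl, ?_, ?_, ?_, ?_, Or.inl ⟨rfl, h6⟩⟩
      · rw [h1, h2, h3]; exact hbase
      · rw [h1]; exact le_antisymm (min_le_right _ _) h5
      · intro j _; rw [h3]
      · intro j _; rw [h2]
    -- The copy is made only if α < λ_i c; as α ≥ 0 this rules out c = 0 and the division by c is
    -- legitimate.
    · have hc0 : 0 < c := by
        rcases hcap.lt_or_eq with h | h
        · exact h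
        · rw [← h, mul_zero] at h1; linarith
      have hne : ∀ j < k, j ≠ k := fun j hj => by omega
      refine ⟨k + 1, h2, by omega, by omega, ?_, ?_, ?_, ?_, Or.inr ⟨rfl, ?_, h9, h10⟩⟩
      · refine hbase.split hik (fun j hj => h7 j (hne j hj)) (fun j hj => h6 j (hne j hj)) h9 h8
          (fun j hj hji => h5 j hji (hne j hj)) ?_ ?_ ?_
        · rw [h3, h4]; ring
        · rw [h3]; positivity
        · rw [h4, sub_nonneg, div_le_iff₀ hc0]; exact h1.le
      · rw [h3]; field_simp
      · exact fun j hj => h7 j (hne j hj)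
      · exact fun j hj => h6 j (hne j hj)
      · rw [hφ3]
        -- The minimum is not attained by λ_i c, so the push carries δ, and φ(u, v) ≤ δ drops to at
        -- most 0: (u, v) becomes residual.
        have : α = δ := by
          rcases min_choice δ (s.real .lam i 0 * c) with h | h
          · exact h
          · rw [← hα] at h; linarith
        rw [this]
        have := hC.flow.le u hun v hvn
        linarith
  obtain ⟨k', hk4, hik', hkk', hbase4, hα4, hL4, hy4, hfin⟩ := key
  simp only [pushSwap, block, setR2, setN2, setR1]
  repeat' with_reducible
    first | apply wp_seq | apply wp_setN | apply wp_setR | apply wp_skip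
  have hvu : v ≠ u := huv.symm
  simp only [NExp.eval, RExp.eval, n0, r2, r0, r1, Mem.nat_setR, Mem.real_setN, Mem.nat_setN_self,
    Mem.real_setR_self, hu4, hi4, hv4, hq4, hc4, ha4, upd_apply, hvu, ne_eq, reduceCtorEq,
    not_false_eq_true, Mem.nat_setN_of_ne, Mem.real_setR_of_ne, and_false, false_and, if_false]
  refine ⟨⟨?_, ?_, ?_, ?_, ?_⟩, ?_, ⟨α, ?_⟩, ?_, ?_, ?_, ?_, ?_⟩
  · simp [hF4.nat .n rfl, hn3]
  · simp [hF4.real .delta rfl, hd3, hC.delta_eq]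
  · simp only [Mem.nat_setR, Mem.real_setN, Mem.nat_setN_self,
      Mem.real_setR_self, ne_eq, reduceCtorEq,
      not_false_eq_true, Mem.nat_setN_of_ne, Mem.real_setR_of_ne, hk4]
    refine hbase4.swap hik' hq (c := c) (α := α) ?_ hα4 ?_ ?_ ?_ ?_ ?_ ?_ ?_ ?_ ?_ ?_ ?_
    · rw [hL4 i hik, hy4 i hik, hLv]
    · intro j hj; funext p; simp [hj]
    · simp [hL4 i hik, hLu]
    · simp [hL4 i hik, hLv]
    · intro p h1 h2; simp [h1, h2]
    · intro j hj; funext p; simp [hj]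
    · simp [hL4 i hik, hLu, huv]
    · simp [hL4 i hik, hLv]
    · intro w h1 h2
      rw [hL4 i hik, hLv] at h1
      rw [hL4 i hik, hLu] at h2
      simp [h1, h2]
    · simp [hL4 i hik, hLu, huv, hx4]
    · simp [hL4 i hik, hLv, hx4]
    · intro w h1 h2
      rw [hL4 i hik, hLv] at h1
      rw [hL4 i hik, hLu] at h2
      simp [h1, h2, hx4]
  · simpa [hφ4] using hflow
  · intro w hw
    rw [← hC.zeta_eq w hw]
    simp only [zeta, Mem.real_setR_self, ne_eq, reduceCtorEq, not_false_eq_true,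
      Mem.real_setR_of_ne, Mem.real_setN, hφ4, hFC.sum hun hvn, upd_apply, hx4, and_true]
    by_cases e1 : w = v
    · subst e1; simp [hvu]
    · by_cases e2 : w = u
      · subst e2; simp [huv]
      · simp [e1, e2]
  · simpa [hF4.nat .qry rfl, hqry3] using h1q
  · simpa [hφ4] using hFC
  · simp
  · simp
  · intro p h1 h2
    simp [h1, h2, hL4 i hik]
  · intro j hj hji
    rw [← hL4 j hj]
    funext p
    simp [hji]
  · rcases hfin with ⟨h1, h2⟩ | ⟨h1, h2, h3, h4⟩
    · left
      refine ⟨by simp [hk4, h1], ?_⟩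
      simp; omega
    · right
      refine ⟨by simp [hk4, h1], by simpa [hφ4] using h2, ?_, by simp; omega⟩
      intro p hp
      have : k ≠ i := by omega
      simp [this, h3 p hp]

end

end SFM

namespace SFM

open Finset

/-! ## The search -/

/-- The number of pairs of positions of `L` whose first entry is not in `W` (counting the end of
the ordering as a position). -/
def psi (n : ℕ) (inW : ℕ → ℕ → ℕ) (L : ℕ → ℕ) : ℕ :=
  ∑ p ∈ range n, if inW (L p) 0 = 1 then 0 else n - p

/-- The potential that pays for the pushes. -/
def psiSum (n k : ℕ) (inW L : ℕ → ℕ → ℕ) : ℕ := ∑ i ∈ range k, psi n inW (L i)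

section

variable {n k : ℕ} {inW inW' : ℕ → ℕ → ℕ}

theorem psi_le (n : ℕ) (inW : ℕ → ℕ → ℕ) (L : ℕ → ℕ) : psi n inW L ≤ n * n := by
  have : psi n inW L ≤ ∑ _p ∈ range n, n := by
    refine sum_le_sum fun p _ => ?_
    split_ifs <;> omega
  simpa using this

theorem psiSum_le (n k : ℕ) (inW L : ℕ → ℕ → ℕ) : psiSum n k inW L ≤ k * (n * n) := by
  have : psiSum n k inW L ≤ ∑ _i ∈ range k, n * n := sum_le_sum fun i _ => psi_le _ _ _
  simpa using this

theorem psi_mono (h : ∀ v, inW v 0 = 1 → inW' v 0 = 1) (L : ℕ → ℕ) :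
    psi n inW' L ≤ psi n inW L := by
  refine sum_le_sum fun p _ => ?_
  by_cases e : inW (L p) 0 = 1
  · simp [e, h _ e]
  · simp only [e, if_false]
    split_ifs <;> omega

theorem psiSum_mono (h : ∀ v, inW v 0 = 1 → inW' v 0 = 1) (L : ℕ → ℕ → ℕ) :
    psiSum n k inW' L ≤ psiSum n k inW L :=
  sum_le_sum fun _ _ => psi_mono h _

/-- A vertex outside W at position p has weight n − p; the interchange moves one such vertex from
position q to q + 1, past a vertex of W, which has weight 0. -/
theorem psi_swap {L L' : ℕ → ℕ} {q : ℕ} (hq : q + 1 < n) (h1 : L' q = L (q + 1))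
    (h2 : L' (q + 1) = L q) (h3 : ∀ p, p ≠ q → p ≠ q + 1 → L' p = L p)
    (hv : inW (L q) 0 ≠ 1) (hu : inW (L (q + 1)) 0 = 1) :
    psi n inW L' + 1 = psi n inW L := by
  -- The old and new weights are added on opposite sides, so that no truncated subtraction of
  -- potentials occurs.
  have key : psi n inW L' + ∑ p ∈ range n, (if p = q then n - q else 0) =
      psi n inW L + ∑ p ∈ range n, (if p = q + 1 then n - (q + 1) else 0) := by
    unfold psi
    rw [← sum_add_distrib, ← sum_add_distrib]
    refine sum_congr rfl fun p _ => ?_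
    by_cases e1 : p = q
    · subst e1; simp [h1, hv, hu]
    · by_cases e2 : p = q + 1
      · subst e2; simp [h2, hv, hu]
      · simp [e1, e2, h3 p e1 e2]
  rw [sum_ite_eq' (range n) q (fun _ => n - q),
    sum_ite_eq' (range n) (q + 1) (fun _ => n - (q + 1)), if_pos (mem_range.2 (by omega)),
    if_pos (mem_range.2 hq)] at key
  omega

theorem psiSum_swap {L L' : ℕ → ℕ → ℕ} {i q : ℕ} (hi : i < k) (hq : q + 1 < n)
    (h0 : ∀ j < k, j ≠ i → L' j = L j) (h1 : L' i q = L i (q + 1))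
    (h2 : L' i (q + 1) = L i q) (h3 : ∀ p, p ≠ q → p ≠ q + 1 → L' i p = L i p)
    (hv : inW (L i q) 0 ≠ 1) (hu : inW (L i (q + 1)) 0 = 1) :
    psiSum n k inW L' + 1 = psiSum n k inW L := by
  unfold psiSum
  have hi' := mem_range.2 hi
  rw [← add_sum_erase _ _ hi', ← add_sum_erase _ (fun j => psi n inW (L j)) hi',
    ← psi_swap hq h1 h2 h3 hv hu]
  have : ∑ j ∈ (range k).erase i, psi n inW (L' j) = ∑ j ∈ (range k).erase i, psi n inW (L j) := by
    refine sum_congr rfl fun j hj => ?_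
    have hj := mem_erase.1 hj
    rw [h0 j (mem_range.1 hj.2) hj.1]
  rw [this]; omega

end

section

variable {O : Set ℕ → ℝ} {n : ℕ} {M : ℝ} {S T : Set ℕ}

/-- After a push, (u, v) is the only arc leaving W that can have become residual. Hence W either
stays closed or is enlarged by entering v and resuming the search from there. -/
theorem wp_updateW {s : Mem} {u v : ℕ} (hn : s.nat .n 0 0 = n) (hQ : QI n S T s)
    (hC : ∀ m < s.nat .qt 0 0, ∀ b < n, b ≠ s.nat .que m 0 → s.real .phi (s.nat .que m 0) b ≤ 0 →
      s.nat .inW b 0 = 1 ∨ (s.nat .que m 0 = u ∧ b = v))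
    (hqh : s.nat .qh 0 0 = s.nat .qt 0 0) (hu : s.nat .u 0 0 = u) (hv : s.nat .v 0 0 = v)
    (hun : u < n) (huW : s.nat .inW u 0 = 1) (hvn : v < n) (hvW : s.nat .inW v 0 = 0) :
    wp O updateW (fun s' m => QI n S T s' ∧
      Closed n (s'.real .phi) (s'.nat .inW) (s'.nat .que) (s'.nat .qt 0 0) ∧
      s'.nat .qh 0 0 = s'.nat .qt 0 0 ∧
      (∀ v, s.nat .inW v 0 = 1 → s'.nat .inW v 0 = 1) ∧
      ((s'.nat .chg 0 0 = 1 ∧ s.nat .qt 0 0 < s'.nat .qt 0 0) ∨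
        (0 < s.real .phi u v ∧ s'.nat .chg 0 0 = s.nat .chg 0 0 ∧ s'.nat .inW = s.nat .inW ∧
          s.nat .qt 0 0 = s'.nat .qt 0 0)) ∧
      m + (n * 120 + 60) * s.nat .qt 0 0 ≤ (n * 120 + 60) * s'.nat .qt 0 0 + 200) s := by
  obtain ⟨m0, hm0, hqm0⟩ := hQ.que_of u hun huW
  simp only [updateW, ifThen, block, setN0]
  refine wp_ite ?_ ?_ <;> intro ht <;> simp [hu, hv] at ht
  · refine wp_seq (wp_setN (wp_seq (wp_setN (wp_seq (wp_enterW ?_)))))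
    intro s1 m1 hF1 e1 e2 e3 e4 e5 e6 hm1
    simp [hu, hv] at e1 e2 e3 e4 e5 e6
    have hφ1 : s1.real .phi = s.real .phi := by simp [hF1.real .phi rfl]
    have hT1 : s1.nat .inT = s.nat .inT := by simp [hF1.nat .inT rfl]
    have hqh1 : s1.nat .qh 0 0 = s.nat .qt 0 0 := by simp [hF1.nat .qh rfl, hqh]
    refine wp_seq (wp_mono (wp_closeW (n := n) (S := S) (T := T) ?_ ?_ ?_ ?_) ?_)
    · simp [hF1.nat .n rfl, hn]
    · simp only [QI]
      rw [hφ1, hT1, e1, e2, e3, e4]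
      exact hQ.enter hm0 hqm0 hvn hvW ht e5 e6
    · rw [hφ1, e1, e3, hqh1]
      intro m hm b hb hne hle
      have hmq : m ≠ s.nat .qt 0 0 := by omega
      simp only [upd_apply, hmq, false_and, if_false] at hne hle
      simp only [upd_apply]
      rcases hC m hm b hb hne hle with h | ⟨-, h⟩
      · split_ifs <;> simp [h]
      · simp [h]
    · omega
    · rintro s2 m2 hF2 ⟨hQ2, hC2, hq2, hqt2, hW2, hm2⟩
      refine wp_seq (wp_setN (wp_skip ?_))
      refine ⟨by simpa [QI] using hQ2, by simpa using hC2, by simpa using hq2, ?_, Or.inl ?_, ?_⟩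
      · intro w hw
        simp only [ne_eq, reduceCtorEq, not_false_eq_true, Mem.nat_setN_of_ne]
        apply hW2
        rw [e1]
        simp only [upd_apply]
        split_ifs <;> simp [hw]
      · simp; omega
      · rw [hqh1] at hm2
        simp
        omega
  · refine wp_skip ⟨hQ, ?_, hqh, fun _ h => h, Or.inr ⟨ht, rfl, rfl, rfl⟩, by simp; omega⟩
    intro m hm b hb hne hle
    rcases hC m hm b hb hne hle with h | ⟨h1, h2⟩
    · exact h
    · rw [h1, h2] at hle; linarith

/-- The state `s` of a search is reached from the state `s0`; the row `i` of `L` may have been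
changed, and `chg` tells whether `W` has grown. -/
structure ScanRel (O : Set ℕ → ℝ) (n : ℕ) (δ : ℝ) (ζ : ℕ → ℝ) (S T : Set ℕ) (s0 s : Mem) :
    Prop where
  core : Core O n δ ζ s
  qi : QI n S T s
  closed : Closed n (s.real .phi) (s.nat .inW) (s.nat .que) (s.nat .qt 0 0)
  qh : s.nat .qh 0 0 = s.nat .qt 0 0
  qt_le : s0.nat .qt 0 0 ≤ s.nat .qt 0 0
  mono : ∀ v, s0.nat .inW v 0 = 1 → s.nat .inW v 0 = 1
  k_le : s0.nat .k 0 0 ≤ s.nat .k 0 0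
  k_qt : s.nat .k 0 0 + s0.nat .qt 0 0 ≤ s0.nat .k 0 0 + s.nat .qt 0 0
  chg_le : s.nat .chg 0 0 ≤ 1
  same : s.nat .chg 0 0 = 0 → s.nat .inW = s0.nat .inW ∧ s.nat .k 0 0 = s0.nat .k 0 0
  grew : s.nat .chg 0 0 = 1 → s0.nat .qt 0 0 < s.nat .qt 0 0

/-- In the positions from `p` on, the vertices of `W` come first. -/
def WFirst (n : ℕ) (inW : ℕ → ℕ → ℕ) (L : ℕ → ℕ) (p : ℕ) : Prop :=
  ∀ a b, p ≤ a → a < b → b < n → inW (L b) 0 = 1 → inW (L a) 0 = 1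

/-- The potential of a state. -/
def pot (n : ℕ) (s : Mem) : ℕ := 2000 * psiSum n (s.nat .k 0 0) (s.nat .inW) (s.nat .L)

/-- The body of the loop of `scanOrdering` that pushes one vertex to the right. -/
def pushRight : List Cmd := [
  setN0 .v (n2 .L (n0 .i) (n0 .q)),
  setN0 .u (n2 .L (n0 .i) (.succ (n0 .q))),
  push,
  updateW,
  inc .q]

/-- The accounting for one push. The 2000 units released by `pot` pay for the constant part and
leave 1000 for the surrounding loops. Each new vertex of W brings 4000n² units, which pay for
closing W, for copying an ordering, and for the potential of the copy, at most 2000n². -/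
theorem wp_pushRight (hO : IsOracle O n M) {δ : ℝ} {ζ : ℕ → ℝ} {s0 s : Mem} {i q : ℕ} (hδ : 0 ≤ δ)
    (hR : ScanRel O n δ ζ S T s0 s) (hchg : s.nat .chg 0 0 = 0) (hi : s.nat .i 0 0 = i)
    (hik : i < s0.nat .k 0 0) (hqq : s.nat .q 0 0 = q) (hq : q + 1 < n)
    (hvW : s.nat .inW (s.nat .L i q) 0 = 0) (huW : s.nat .inW (s.nat .L i (q + 1)) 0 = 1)
    (hqry : ∀ m < n, s.nat .qry m 0 ≠ 0 ↔ m ∈ pre (s.nat .L i) (q + 1)) :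
    wp O (block pushRight) (fun s' m => ScanRel O n δ ζ S T s0 s' ∧
      s'.nat .q 0 0 = q + 1 ∧
      (∀ m < n, s'.nat .qry m 0 ≠ 0 ↔ m ∈ pre (s'.nat .L i) (q + 2)) ∧
      s'.nat .L i q = s.nat .L i (q + 1) ∧ s'.nat .L i (q + 1) = s.nat .L i q ∧
      (∀ p, p ≠ q → p ≠ q + 1 → s'.nat .L i p = s.nat .L i p) ∧
      (∀ j < s0.nat .k 0 0, j ≠ i → s'.nat .L j = s.nat .L j) ∧
      m + pot n s' + 4000 * (n * n) * s.nat .qt 0 0 + 1000 ≤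
        pot n s + 4000 * (n * n) * s'.nat .qt 0 0) s := by
  obtain ⟨hW0, hk0⟩ := hR.same hchg
  have hik' : i < s.nat .k 0 0 := by omega
  have hord := (hR.core.base.ext i hik').toIsOrd
  have hvn := hord.lt q (by omega)
  have hun := hord.lt _ hq
  set v := s.nat .L i q with hv
  set u := s.nat .L i (q + 1) with hu
  have huv : u ≠ v := by
    intro e
    rw [e] at huW
    omega
  -- As u is in W and v is not, closedness of W forbids that (u, v) is residual.
  have hφ : 0 < s.real .phi u v := by
    by_contra hle
    obtain ⟨m, hm, e⟩ := hR.qi.que_of u hun huW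
    have := hR.closed m hm v hvn (by rw [e]; exact huv.symm) (by rw [e]; linarith)
    omega
  simp only [pushRight, block, setN0]
  refine wp_seq (wp_setN (wp_seq (wp_setN (wp_seq ?_))))
  simp only [NExp.eval, n0, n2, hi, hqq, ne_eq, reduceCtorEq,
    not_false_eq_true, Mem.nat_setN_of_ne, ← hv, ← hu]
  refine wp_mono (wp_push hO (n := n) (δ := δ) (ζ := ζ) (q := q) (i := i) (v := v) (u := u) hδ
    ?_ rfl ?_ hq ?_ ?_ ?_ ?_ ?_ ?_ ?_ ?_) ?_
  · have := hR.core
    exact ⟨by simpa using this.n_eq, by simpa using this.delta_eq, by simpa using this.base,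
      by simpa using this.flow, by simpa using this.zeta_eq⟩
  · simpa using hik'
  · simpa using hi
  · simp
  · simp
  · simpa using hqq
  · simp [hv]
  · simp [hu]
  · simpa using hφ
  · simpa using hqry
  rintro s1 m1 hF1 ⟨hC1, hqry1, ⟨α, hFC⟩, hL1, hL2, hL3, hL4, hcase⟩
  simp only [ne_eq, reduceCtorEq, not_false_eq_true, Mem.nat_setN_of_ne, Mem.real_setN] at *
  have hW1 : s1.nat .inW = s.nat .inW := by simp [hF1.nat .inW rfl]
  have hT1 : s1.nat .inT = s.nat .inT := by simp [hF1.nat .inT rfl]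
  have hp1 : s1.nat .par = s.nat .par := by simp [hF1.nat .par rfl]
  have hqe1 : s1.nat .que = s.nat .que := by simp [hF1.nat .que rfl]
  have hqt1 : s1.nat .qt = s.nat .qt := by simp [hF1.nat .qt rfl]
  have hqh1 : s1.nat .qh = s.nat .qh := by simp [hF1.nat .qh rfl]
  have hhit1 : s1.nat .hit = s.nat .hit := by simp [hF1.nat .hit rfl]
  have htgt1 : s1.nat .tgt = s.nat .tgt := by simp [hF1.nat .tgt rfl]
  have hchg1 : s1.nat .chg = s.nat .chg := by simp [hF1.nat .chg rfl]
  -- The interchange does not affect the segment that contains both vertices, so the query set left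
  -- by the push is right for the new position of v.
  have hpre1 : pre (s1.nat .L i) (q + 2) = pre (s.nat .L i) (q + 2) := by
    rw [pre_succ, pre_succ, pre_succ, pre_succ, hL1, hL2, ← hv, ← hu, Set.insert_comm]
    congr 2
    exact pre_congr (fun r hr => hL3 r (by omega) (by omega))
  refine wp_seq (wp_mono (wp_updateW (n := n) (S := S) (T := T) (u := u) (v := v)
    hC1.n_eq ?_ ?_ ?_ ?_ ?_ hun ?_ hvn ?_) ?_)
  · simp only [QI, hW1, hT1, hp1, hqe1, hqt1, hhit1, htgt1]
    refine QInv.congr_phi hR.qi ?_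
    intro a ha b hb haW hbW
    have e1 : a ≠ v := by rintro rfl; omega
    have e2 : b ≠ v := by rintro rfl; omega
    rw [hFC.eq]; simp [e1, e2]
  · rw [hW1, hqe1, hqt1]
    intro m hm b hb hne hle
    by_cases e1 : s.nat .que m 0 = u ∧ b = v
    · exact Or.inr e1
    · left
      refine hR.closed m hm b hb hne ?_
      have e2 : s.nat .que m 0 ≠ v := by
        intro e
        have := hR.qi.inW_que m hm
        rw [e] at this
        omega
      rw [hFC.eq] at hle
      simpa [e1, e2] using hle
  · rw [hqh1, hqt1, hR.qh]
  · simp [hF1.nat .u rfl]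
  · simp [hF1.nat .v rfl]
  · rw [hW1]; exact huW
  · rw [hW1]; exact hvW
  rintro s2 m2 hF2 ⟨hQ2, hCl2, hqh2, hmono2, hch2, hm2⟩
  simp only [inc, setN0]
  refine wp_seq (wp_setN (wp_skip ?_))
  have hL2' : s2.nat .L = s1.nat .L := hF2.nat .L rfl
  have hk2' : s2.nat .k = s1.nat .k := hF2.nat .k rfl
  have hqry2 : s2.nat .qry = s1.nat .qry := hF2.nat .qry rfl
  have hq2 : s2.nat .q 0 0 = q := by simp [hF2.nat .q rfl, hF1.nat .q rfl, hqq]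
  have hφ2 : s2.real .phi = s1.real .phi := hF2.real .phi rfl
  rw [hW1, hchg1, hqt1] at hch2
  rw [hqt1] at hm2
  rw [hW1] at hmono2
  have hqt2 : s.nat .qt 0 0 ≤ s2.nat .qt 0 0 := by
    rcases hch2 with ⟨_, h⟩ | ⟨_, _, _, h⟩ <;> omega
  -- A copy forces φ(u, v) ≤ 0, which excludes the case in which W stays the same. So each new
  -- ordering is matched with an enlargement of W.
  have hk12 : (s1.nat .k 0 0 = s.nat .k 0 0 ∧ m1 ≤ 600) ∨
      (s1.nat .k 0 0 = s.nat .k 0 0 + 1 ∧ s.nat .qt 0 0 < s2.nat .qt 0 0 ∧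
        (∀ p < n, s1.nat .L (s.nat .k 0 0) p = s.nat .L i p) ∧ m1 ≤ n * 100 + 600) := by
    rcases hcase with h | ⟨h1, h2, h3, h4⟩
    · exact Or.inl h
    · refine Or.inr ⟨h1, ?_, h3, h4⟩
      rcases hch2 with ⟨_, h⟩ | ⟨h, _⟩
      · exact h
      · exact absurd h (not_lt.2 h2)
  have hqt0 := hR.qt_le
  simp only [ne_eq, reduceCtorEq, not_false_eq_true, Mem.nat_setN_of_ne, Mem.nat_setN_self, pot]
  refine ⟨⟨?_, ?_, ?_, ?_, ?_, ?_, ?_, ?_, ?_, ?_, ?_⟩, ?_, ?_, ?_, ?_, ?_, ?_, ?_⟩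
  · have := hC1
    refine ⟨?_, ?_, ?_, ?_, ?_⟩
    · simpa [hF2.nat .n rfl] using this.n_eq
    · simpa [hF2.real .delta rfl] using this.delta_eq
    · simpa [hk2', hL2', hF2.real .y rfl, hF2.real .lam rfl, hF2.real .x rfl] using this.base
    · simpa [hφ2] using this.flow
    · simpa [hF2.real .x rfl, hφ2] using this.zeta_eq
  · simpa [QI] using hQ2
  · simpa using hCl2
  · simpa using hqh2
  · simp; omega
  · intro w hw
    simpa using hmono2 w (hR.mono w hw)
  · simp [hk2']; omega
  · simp [hk2']; omega
  · simp; rcases hch2 with ⟨h, _⟩ | ⟨_, h, _⟩ <;> omega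
  · simp only [ne_eq, reduceCtorEq, not_false_eq_true, Mem.nat_setN_of_ne, hk2']
    intro h0
    rcases hch2 with ⟨h, _⟩ | ⟨_, _, h1, h2⟩
    · omega
    · refine ⟨h1.trans hW0, ?_⟩
      rcases hk12 with h | h <;> omega
  · simp only [ne_eq, reduceCtorEq, not_false_eq_true, Mem.nat_setN_of_ne]
    intro h1
    rcases hch2 with ⟨_, h⟩ | ⟨_, h, _⟩ <;> omega
  · simp [hq2]
  · rw [hqry2, hL2', hpre1]; exact hqry1
  · rw [hL2', hL1]
  · rw [hL2', hL2]
  · rw [hL2']; exact hL3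
  · rw [hL2']
    intro j hj hji
    exact hL4 j (by omega) hji
  · rw [hL2', hk2']
    have hswap : psiSum n (s.nat .k 0 0) (s.nat .inW) (s1.nat .L) + 1 =
        psiSum n (s.nat .k 0 0) (s.nat .inW) (s.nat .L) :=
      psiSum_swap hik' hq hL4 hL1 hL2 hL3 (by rw [← hv]; omega) huW
    have hmon := psiSum_mono (n := n) (k := s1.nat .k 0 0) hmono2 (s1.nat .L)
    obtain ⟨d, hd⟩ := Nat.exists_eq_add_of_le hqt2
    rw [hd] at hm2 ⊢
    have hn1 : 1 ≤ n := by omega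
    have hnn : n ≤ n * n := Nat.le_mul_of_pos_left n hn1
    have hdn : d * n ≤ d * (n * n) := Nat.mul_le_mul_left d hnn
    have hdn1 : d ≤ d * n := Nat.le_mul_of_pos_right d hn1
    have e1 : (n * 120 + 60) * (s.nat .qt 0 0 + d) =
        (n * 120 + 60) * s.nat .qt 0 0 + 120 * (d * n) + 60 * d := by ring
    have e2 : 4000 * (n * n) * (s.nat .qt 0 0 + d) =
        4000 * (n * n) * s.nat .qt 0 0 + 4000 * (d * (n * n)) := by ring
    rw [e1] at hm2
    rw [e2]
    simp only [NExp.cost, n0]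
    rcases hk12 with ⟨h1, h2⟩ | ⟨h1, h2, h3, h4⟩
    · rw [h1] at hmon ⊢
      omega
    · have hd1 : 1 ≤ d := by omega
      have hdn2 : n * n ≤ d * (n * n) := Nat.le_mul_of_pos_left _ hd1
      have hsucc : psiSum n (s.nat .k 0 0 + 1) (s.nat .inW) (s1.nat .L) ≤
          psiSum n (s.nat .k 0 0) (s.nat .inW) (s1.nat .L) + n * n := by
        unfold psiSum
        rw [sum_range_succ]
        exact Nat.add_le_add_left (psi_le _ _ _) _
      rw [h1] at hmon ⊢
      omega

end

end SFM

/-! ### Scanning one ordering -/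

namespace SFM

open Finset

section

variable {O : Set ℕ → ℝ} {n : ℕ} {M : ℝ} {S T : Set ℕ} {δ : ℝ} {ζ : ℕ → ℝ}

/-- The arrays on which the invariant of the search depends. -/
def searchN : List NArr := [.n, .k, .L, .inT, .inW, .par, .que, .qt, .qh, .hit, .tgt, .chg]
def searchR : List RArr := [.delta, .y, .lam, .x, .phi]

theorem ScanRel.congr {s0 s s' : Mem} (h : ScanRel O n δ ζ S T s0 s)
    (hN : ∀ A ∈ searchN, s'.nat A = s.nat A) (hR : ∀ A ∈ searchR, s'.real A = s.real A) :
    ScanRel O n δ ζ S T s0 s' := by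
  simp only [searchN, searchR, List.forall_mem_cons] at hN hR
  obtain ⟨h1, h2, h3, h4, h5, h6, h7, h8, h9, h10, h11, h12, -⟩ := hN
  obtain ⟨r1, r2, r3, r4, r5, -⟩ := hR
  refine ⟨⟨?_, ?_, ?_, ?_, ?_⟩, ?_, ?_, ?_, ?_, ?_, ?_, ?_, ?_, ?_, ?_⟩
  · rw [h1]; exact h.core.n_eq
  · rw [r1]; exact h.core.delta_eq
  · rw [h2, h3, r2, r3, r4]; exact h.core.base
  · rw [r5]; exact h.core.flow
  · rw [r4, r5]; exact h.core.zeta_eq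
  · simp only [QI, r5, h4, h5, h6, h7, h8, h10, h11]; exact h.qi
  · rw [r5, h5, h7, h8]; exact h.closed
  · rw [h8, h9]; exact h.qh
  · rw [h8]; exact h.qt_le
  · rw [h5]; exact h.mono
  · rw [h2]; exact h.k_le
  · rw [h2, h8]; exact h.k_qt
  · rw [h12]; exact h.chg_le
  · rw [h12, h5, h2]; exact h.same
  · rw [h12, h8]; exact h.grew

theorem ScanRel.frame {s0 s s' : Mem} (h : ScanRel O n δ ζ S T s0 s) {P : Cmd} (hF : Frame P s s')
    (hN : ∀ A ∈ searchN, P.wrN A = false) (hR : ∀ A ∈ searchR, P.wrR A = false) :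
    ScanRel O n δ ζ S T s0 s' :=
  h.congr (fun A hA => hF.nat A (hN A hA)) (fun A hA => hF.real A (hR A hA))

theorem WFirst.of_succ {inW : ℕ → ℕ → ℕ} {L : ℕ → ℕ} {p : ℕ} (h : WFirst n inW L (p + 1))
    (hp : inW (L p) 0 = 1) : WFirst n inW L p := by
  intro a b hpa hab hb hW
  rcases hpa.eq_or_lt with rfl | hlt
  · exact hp
  · exact h a b hlt hab hb hW

/-- Pushing the vertex at position `p` to the right as long as it is active. -/
theorem wp_pushLoop (hO : IsOracle O n M) (hδ : 0 ≤ δ) {s0 s : Mem} {i p : ℕ}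
    (hR : ScanRel O n δ ζ S T s0 s) (hi : s.nat .i 0 0 = i)
    (hik : i < s0.nat .k 0 0) (hp : p < n) (hqp : s.nat .q 0 0 = p)
    (hqry : ∀ m < n, s.nat .qry m 0 ≠ 0 ↔ m ∈ pre (s.nat .L i) (p + 1))
    (hW : WFirst n (s.nat .inW) (s.nat .L i) (p + 1)) :
    wp O (.while (.and (.neq (n0 .chg) (.lit 0))
        (.and (.nlt (.succ (n0 .q)) (n0 .n))
          (.and (.neq (n1 .inW (n2 .L (n0 .i) (n0 .q))) (.lit 0))
            (.neq (n1 .inW (n2 .L (n0 .i) (.succ (n0 .q)))) (.lit 1))))) (block pushRight))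
      (fun s' m => ScanRel O n δ ζ S T s0 s' ∧ p ≤ s'.nat .q 0 0 ∧ s'.nat .q 0 0 < n ∧
        (∀ m < n, s'.nat .qry m 0 ≠ 0 ↔ m ∈ pre (s'.nat .L i) (s'.nat .q 0 0 + 1)) ∧
        (s'.nat .chg 0 0 = 0 → WFirst n (s'.nat .inW) (s'.nat .L i) p) ∧
        (∀ j < s0.nat .k 0 0, j ≠ i → s'.nat .L j = s.nat .L j) ∧
        m + pot n s' + 4000 * (n * n) * s.nat .qt 0 0 + 200 * s'.nat .q 0 0 ≤
          pot n s + 4000 * (n * n) * s'.nat .qt 0 0 + 200 * p + 60) s := by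
  -- As long as W has not grown: positions p to q − 1 hold vertices of W that were passed, position
  -- q holds the pushed vertex unless no push was made, and W comes first from q + 1 on. Each push
  -- also saves 200 units with which `wp_restore` is paid later.
  refine wp_mono (wp_while (fun s' m => ScanRel O n δ ζ S T s0 s' ∧ p ≤ s'.nat .q 0 0 ∧
      s'.nat .q 0 0 < n ∧
      (∀ m < n, s'.nat .qry m 0 ≠ 0 ↔ m ∈ pre (s'.nat .L i) (s'.nat .q 0 0 + 1)) ∧
      (s'.nat .chg 0 0 = 0 → (∀ a, p ≤ a → a < s'.nat .q 0 0 →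
          s'.nat .inW (s'.nat .L i a) 0 = 1) ∧
        (s'.nat .q 0 0 = p ∨ s'.nat .inW (s'.nat .L i (s'.nat .q 0 0)) 0 ≠ 1) ∧
        WFirst n (s'.nat .inW) (s'.nat .L i) (s'.nat .q 0 0 + 1)) ∧
      (∀ j < s0.nat .k 0 0, j ≠ i → s'.nat .L j = s.nat .L j) ∧
      m + pot n s' + 4000 * (n * n) * s.nat .qt 0 0 + 200 * s'.nat .q 0 0 ≤
        pot n s + 4000 * (n * n) * s'.nat .qt 0 0 + 200 * p)
    (fun s' => n - s'.nat .q 0 0) ?_ ?_) ?_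
  · rw [hqp]
    refine ⟨hR, le_rfl, hp, hqry, fun _ => ⟨fun a h1 h2 => by omega, Or.inl rfl, hW⟩,
      fun _ _ _ => rfl, by omega⟩
  · rintro s1 m hF ⟨hR1, hpq, hqn, hqry1, hfirst, hrows, hm⟩ ht
    have hi1 : s1.nat .i 0 0 = i := by rw [hF.nat .i rfl, hi]
    have hn1 := hR1.core.n_eq
    simp only [BExp.holds, NExp.eval, n0, n1, n2, hi1, hn1] at ht
    obtain ⟨ht1, ht2, ht3, ht4⟩ := ht
    obtain ⟨hf1, hf2, hf3⟩ := hfirst ht1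
    refine wp_mono (wp_pushRight hO hδ hR1 ht1 hi1 hik rfl ht2 ht3 ht4 hqry1) ?_
    rintro s2 m2 hF2 ⟨hR2, hq2, hqry2, hL1, hL2, hL3, hrows2, hm2⟩
    rw [hq2]
    refine ⟨⟨hR2, by omega, by omega, hqry2, ?_, ?_, ?_⟩, by omega⟩
    · intro hc2
      have hW2 : s2.nat .inW = s1.nat .inW := (hR2.same hc2).1.trans (hR1.same ht1).1.symm
      rw [hW2]
      refine ⟨?_, Or.inr ?_, ?_⟩
      · intro a ha1 ha2
        rcases Nat.lt_succ_iff_lt_or_eq.1 ha2 with h | rfl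
        · rw [hL3 a (by omega) (by omega)]; exact hf1 a ha1 h
        · rw [hL1]; exact ht4
      · rw [hL2, ht3]; decide
      · intro a b ha hab hb
        rw [hL3 a (by omega) (by omega), hL3 b (by omega) (by omega)]
        exact hf3 a b (by omega) hab hb
    · intro j hj hji
      rw [hrows2 j hj hji, hrows j hj hji]
    · simp only [BExp.cost, NExp.cost, n0, n1, n2]
      omega
  · rintro s1 m hF ⟨m', ⟨hR1, hpq, hqn, hqry1, hfirst, hrows, hm⟩, ht, rfl⟩
    have hi1 : s1.nat .i 0 0 = i := by rw [hF.nat .i rfl, hi]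
    have hn1 := hR1.core.n_eq
    simp only [BExp.holds, NExp.eval, n0, n1, n2, hi1, hn1] at ht
    refine ⟨hR1, hpq, hqn, hqry1, ?_, hrows, ?_⟩
    · intro hc
      obtain ⟨hf1, hf2, hf3⟩ := hfirst hc
      by_cases hq : s1.nat .inW (s1.nat .L i (s1.nat .q 0 0)) 0 = 1
      · have hqp : s1.nat .q 0 0 = p := hf2.resolve_right (fun h => h hq)
        rw [hqp] at hf3 hq
        exact hf3.of_succ hq
      · have hord := (hR1.core.base.ext i (by have := hR1.k_le; omega)).toIsOrd
        have hle := hR1.qi.inW_le _ (hord.lt _ hqn)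
        -- The loop stopped with a vertex outside W at q, so the next position, if any, is not in W;
        -- and since W comes first after q, no later position is either.
        have hnone : ∀ b, s1.nat .q 0 0 ≤ b → b < n → s1.nat .inW (s1.nat .L i b) 0 ≠ 1 := by
          intro b hb hbn hbW
          rcases hb.eq_or_lt with rfl | hb
          · exact hq hbW
          · have : s1.nat .inW (s1.nat .L i (s1.nat .q 0 0 + 1)) 0 = 1 := by
              rcases (Nat.succ_le_of_lt hb).eq_or_lt with h | h
              · rw [← Nat.succ_eq_add_one, h]; exact hbW
              · exact hf3 _ b le_rfl h hbn hbW
            exact ht ⟨hc, by omega, by omega, this⟩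
        intro a b ha hab hb hbW
        by_cases hbq : b < s1.nat .q 0 0
        · exact hf1 a ha (by omega)
        · exact absurd hbW (hnone b (by omega) hb)
    · simp only [BExp.cost, NExp.cost, n0, n1, n2]
      omega

/-- Restoring the query set. -/
theorem wp_restore {s : Mem} {L : ℕ → ℕ} {i p Q : ℕ} (hL : IsOrd n L) (hi : s.nat .i 0 0 = i)
    (hLi : s.nat .L i = L) (hp : s.nat .p 0 0 = p) (hq : s.nat .q 0 0 = Q) (hpQ : p ≤ Q)
    (hQn : Q ≤ n) (hqry : ∀ m < n, s.nat .qry m 0 ≠ 0 ↔ m ∈ pre L Q) :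
    wp O (whileDo (.nlt (n0 .p) (n0 .q)) [
      setN0 .q (.pred (n0 .q)),
      setN1 .qry (n2 .L (n0 .i) (n0 .q)) (.lit 0)])
      (fun s' m => (∀ m < n, s'.nat .qry m 0 ≠ 0 ↔ m ∈ pre L p) ∧
        m + 60 * p ≤ 60 * Q + 20) s := by
  refine wp_mono (wp_while (fun s' m => p ≤ s'.nat .q 0 0 ∧ s'.nat .q 0 0 ≤ n ∧
    (∀ m < n, s'.nat .qry m 0 ≠ 0 ↔ m ∈ pre L (s'.nat .q 0 0)) ∧
    m + 60 * s'.nat .q 0 0 ≤ 60 * Q) (fun s' => s'.nat .q 0 0) ?_ ?_) ?_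
  · rw [hq]
    exact ⟨hpQ, hQn, hqry, by omega⟩
  · rintro s1 m hF ⟨h1, h2, h3, h4⟩ ht
    have hi1 : s1.nat .i 0 0 = i := by rw [hF.nat .i rfl, hi]
    have hp1 : s1.nat .p 0 0 = p := by rw [hF.nat .p rfl, hp]
    have hL1 : s1.nat .L i = L := by rw [hF.nat .L rfl, hLi]
    simp only [BExp.holds, NExp.eval, n0, hp1] at ht
    obtain ⟨q, hq⟩ : ∃ q, s1.nat .q 0 0 = q + 1 := ⟨s1.nat .q 0 0 - 1, by omega⟩
    rw [hq] at h2 h3 h4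
    simp only [block, setN0, setN1]
    refine wp_seq (wp_setN (wp_seq (wp_setN (wp_skip ?_))))
    simp [hq, hi1, hL1]
    refine ⟨by omega, by omega, ?_, by omega⟩
    intro m hm
    have := h3 m hm
    rw [pre_succ] at this
    simp only [Set.mem_insert_iff] at this
    by_cases e : m = L q
    · subst e
      simp [hL.notMem_pre (show q < n by omega) le_rfl]
    · simpa [e] using this
  · rintro s1 m hF ⟨m', ⟨h1, h2, h3, h4⟩, ht, rfl⟩
    have hp1 : s1.nat .p 0 0 = p := by rw [hF.nat .p rfl, hp]
    simp only [BExp.holds, NExp.eval, n0, hp1, not_lt] at ht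
    have : s1.nat .q 0 0 = p := by omega
    rw [this] at h3 h4
    refine ⟨h3, ?_⟩
    simp; omega

/-- Insertion sort from the right: if W does not grow, then after position p has been treated W
comes first from p on. The query set shrinks along with p, starting from all vertices, so it never
has to be rebuilt. Apart from the amortized pushes, every position costs O(1), covered by the term
400p of the invariant. -/
theorem wp_scanOrdering (hO : IsOracle O n M) (hδ : 0 ≤ δ) {s0 s : Mem} {i : ℕ}
    (hR : ScanRel O n δ ζ S T s0 s) (hi : s.nat .i 0 0 = i)
    (hik : i < s0.nat .k 0 0) :
    wp O scanOrdering (fun s' m => ScanRel O n δ ζ S T s0 s' ∧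
        (s'.nat .chg 0 0 = 0 → WFirst n (s'.nat .inW) (s'.nat .L i) 0) ∧
        (∀ j < s0.nat .k 0 0, j ≠ i → s'.nat .L j = s.nat .L j) ∧
        m + pot n s' + 4000 * (n * n) * s.nat .qt 0 0 ≤
          pot n s + 4000 * (n * n) * s'.nat .qt 0 0 + 600 * n + 100) s := by
  have hk := hR.k_le
  have hord := (hR.core.base.ext i (by omega)).toIsOrd
  simp only [scanOrdering, block, setN0]
  refine wp_seq (wp_mono (wp_forTo n 20 (fun w s' => ∀ m < w, s'.nat .qry m 0 ≠ 0) rfl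
    ?_ ?_ ?_) ?_)
  · intro s' hF
    simp [hF.nat .n rfl, hR.core.n_eq]
  · simp
  · intro w hw s' hF hww hI
    simp only [block, setN1]
    refine wp_seq (wp_setN (wp_skip ?_))
    simp [hww]
    intro m hm
    by_cases e : m = w
    · simp [e]
    · simpa [e] using hI m (by omega)
  rintro s1 m1 hF1 ⟨hq1, -, hm1⟩
  have hR1 := hR.frame hF1 (by decide) (by decide)
  have hi1 : s1.nat .i 0 0 = i := by rw [hF1.nat .i rfl, hi]
  have hL1 : s1.nat .L = s.nat .L := hF1.nat .L rfl
  have hpot1 : pot n s1 = pot n s := by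
    simp [pot, hF1.nat .k rfl, hF1.nat .L rfl, hF1.nat .inW rfl]
  have hqt1 : s1.nat .qt 0 0 = s.nat .qt 0 0 := by rw [hF1.nat .qt rfl]
  have hn1 := hR1.core.n_eq
  refine wp_seq (wp_setN (wp_seq ?_))
  refine wp_mono (wp_while (fun s' m => ScanRel O n δ ζ S T s0 s' ∧ s'.nat .p 0 0 ≤ n ∧
      (∀ m < n, s'.nat .qry m 0 ≠ 0 ↔ m ∈ pre (s'.nat .L i) (s'.nat .p 0 0)) ∧
      (s'.nat .chg 0 0 = 0 → WFirst n (s'.nat .inW) (s'.nat .L i) (s'.nat .p 0 0)) ∧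
      (∀ j < s0.nat .k 0 0, j ≠ i → s'.nat .L j = s.nat .L j) ∧
      m + pot n s' + 4000 * (n * n) * s.nat .qt 0 0 + 400 * s'.nat .p 0 0 ≤
        pot n s + 4000 * (n * n) * s'.nat .qt 0 0 + 400 * n)
    (fun s' => s'.nat .p 0 0) ?_ ?_) ?_
  · have hp : (s1.setN .p 0 0 n).nat .p 0 0 = n := by simp
    simp only [NExp.eval, n0, hn1]
    rw [hp]
    refine ⟨hR1.congr (by simp [searchN]) (by simp), le_rfl, ?_, ?_, ?_, ?_⟩
    · intro m hm
      simp only [ne_eq, reduceCtorEq, not_false_eq_true, Mem.nat_setN_of_ne, hL1, hord.pre_eq,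
        Set.mem_Iio, hm, iff_true]
      exact hq1 m hm
    · intro _ a b h1 h2 h3; omega
    · intro j _ _; simp [hL1]
    · have : pot n (s1.setN .p 0 0 n) = pot n s := by rw [← hpot1]; simp [pot]
      rw [this]
      simp [hqt1]
  · rintro s2 m2 hF2 ⟨hR2, hpn, hqry2, hW2, hrows2, hm2⟩ ht
    have hi2 : s2.nat .i 0 0 = i := by rw [hF2.nat .i rfl]; simp [hi1]
    simp only [BExp.holds, NExp.eval, n0] at ht
    obtain ⟨htp, htc⟩ := ht
    obtain ⟨p, hp⟩ : ∃ p, s2.nat .p 0 0 = p + 1 := ⟨s2.nat .p 0 0 - 1, by omega⟩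
    rw [hp] at hpn hqry2 hW2 hm2
    refine wp_seq (wp_setN (wp_seq (wp_setN (wp_seq ?_))))
    simp only [NExp.eval, n0, hp, Nat.add_sub_cancel, Mem.nat_setN_self, upd_apply, and_self,
      if_true]
    set s3 := (s2.setN .p 0 0 p).setN .q 0 0 p with hs3
    have hR3 : ScanRel O n δ ζ S T s0 s3 :=
      hR2.congr (by simp [searchN, s3]) (by simp [s3])
    have hpot3 : pot n s3 = pot n s2 := by simp [pot, s3]
    refine wp_mono (wp_pushLoop hO hδ (p := p) (i := i) hR3 ?_ hik (by omega) ?_ ?_ ?_) ?_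
    · simpa [s3] using hi2
    · simp [s3]
    · simpa [s3] using hqry2
    · simpa [s3] using hW2 htc
    rintro s4 m4 hF4 ⟨hR4, hpq4, hqn4, hqry4, hW4, hrows4, hm4⟩
    have hp4 : s4.nat .p 0 0 = p := by rw [hF4.nat .p rfl]; simp [s3]
    have hi4 : s4.nat .i 0 0 = i := by rw [hF4.nat .i rfl]; simp [s3, hi2]
    have hqt3 : s3.nat .qt 0 0 = s2.nat .qt 0 0 := by simp [s3]
    have hrow3 : s3.nat .L = s2.nat .L := by simp [s3]
    rw [hpot3, hqt3] at hm4
    clear_value s3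
    simp only [inc, setN0]
    refine wp_seq (wp_setN (wp_seq ?_))
    simp only [NExp.eval, n0]
    have hord4 := (hR4.core.base.ext i (by have := hR4.k_le; omega)).toIsOrd
    refine wp_mono (wp_restore (n := n) (L := s4.nat .L i) (i := i) (p := p)
      (Q := s4.nat .q 0 0 + 1) hord4 ?_ ?_ ?_ ?_ (by omega) (by omega) ?_) ?_
    · simpa using hi4
    · simp
    · simpa using hp4
    · simp
    · simpa using hqry4
    rintro s5 m5 hF5 ⟨hqry5, hm5⟩
    have hR5 : ScanRel O n δ ζ S T s0 s5 :=
      (hR4.congr (by simp [searchN]) (by simp)).frame hF5 (by decide) (by decide)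
    have hp5 : s5.nat .p 0 0 = p := by rw [hF5.nat .p rfl]; simp [hp4]
    have hL5 : s5.nat .L = s4.nat .L := by rw [hF5.nat .L rfl]; simp
    have hpot5 : pot n s5 = pot n s4 := by
      simp [pot, hF5.nat .k rfl, hF5.nat .L rfl, hF5.nat .inW rfl]
    have hqt5 : s5.nat .qt 0 0 = s4.nat .qt 0 0 := by rw [hF5.nat .qt rfl]; simp
    refine wp_skip ?_
    rw [hp5]
    refine ⟨⟨hR5, by omega, ?_, ?_, ?_, ?_⟩, by omega⟩
    · rw [hL5]; exact hqry5
    · rw [hL5, hF5.nat .chg rfl, hF5.nat .inW rfl]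
      simpa using hW4
    · intro j hj hji
      rw [hL5, hrows4 j hj hji, hrow3, hrows2 j hj hji]
    · rw [hpot5, hqt5]
      simp only [BExp.cost, NExp.cost]
      omega
  · rintro s2 m2 hF2 ⟨m', ⟨hR2, hpn, hqry2, hW2, hrows2, hm2⟩, ht, rfl⟩
    simp only [BExp.holds, NExp.eval, n0] at ht
    refine wp_skip ⟨hR2, ?_, hrows2, ?_⟩
    · intro hc
      have : s2.nat .p 0 0 = 0 := by
        by_contra h
        exact ht ⟨by omega, hc⟩
      rw [this] at hW2
      exact hW2 hc
    · simp only [BExp.cost, NExp.cost, n0] at hm1 ⊢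
      omega

end

end SFM

/-! ### Passes over all orderings and the complete search -/

namespace SFM

open Finset

section

variable {O : Set ℕ → ℝ} {n : ℕ} {M : ℝ} {S T : Set ℕ} {δ : ℝ} {ζ : ℕ → ℝ}

theorem ScanRel.refl {s : Mem} (h1 : Core O n δ ζ s) (h2 : QI n S T s)
    (h3 : Closed n (s.real .phi) (s.nat .inW) (s.nat .que) (s.nat .qt 0 0))
    (h4 : s.nat .qh 0 0 = s.nat .qt 0 0) (h5 : s.nat .chg 0 0 = 0) :
    ScanRel O n δ ζ S T s s :=
  ⟨h1, h2, h3, h4, le_rfl, fun _ h => h, le_rfl, le_rfl, by omega, fun _ => ⟨rfl, rfl⟩,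
    fun h => by omega⟩

/-- One pass over the orderings. -/
theorem wp_pass (hO : IsOracle O n M) (hδ : 0 ≤ δ) {s : Mem}
    (hR : ScanRel O n δ ζ S T s s) (hi : s.nat .i 0 0 = 0) :
    wp O (whileDo (.and (.nlt (n0 .i) (n0 .k)) (.neq (n0 .chg) (.lit 0))) [
      scanOrdering,
      inc .i])
      (fun s' m => ScanRel O n δ ζ S T s s' ∧
        (s'.nat .chg 0 0 = 0 → ∀ j < s'.nat .k 0 0, WFirst n (s'.nat .inW) (s'.nat .L j) 0) ∧
        m + pot n s' + 4000 * (n * n) * s.nat .qt 0 0 ≤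
          pot n s + 4000 * (n * n) * s'.nat .qt 0 0 + (600 * n + 200) * s.nat .k 0 0 + 20) s := by
  refine wp_mono (wp_while (fun s' m => ScanRel O n δ ζ S T s s' ∧
      s'.nat .i 0 0 ≤ s.nat .k 0 0 ∧
      (s'.nat .chg 0 0 = 0 → ∀ j < s'.nat .i 0 0, WFirst n (s'.nat .inW) (s'.nat .L j) 0) ∧
      m + pot n s' + 4000 * (n * n) * s.nat .qt 0 0 ≤
          pot n s + 4000 * (n * n) * s'.nat .qt 0 0 + (600 * n + 200) * s'.nat .i 0 0)
    (fun s' => s.nat .k 0 0 - s'.nat .i 0 0) ?_ ?_) ?_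
  · rw [hi]
    exact ⟨hR, by omega, fun _ j hj => by omega, by omega⟩
  · rintro s1 m1 hF ⟨hR1, hi1, hW1, hm1⟩ ht
    simp only [BExp.holds, NExp.eval, n0] at ht
    obtain ⟨ht1, ht2⟩ := ht
    -- While W has not grown it is the same set as at the start of the pass, so the rows already
    -- scanned still have W first and no row has been added.
    have hsame1 := hR1.same ht2
    rw [hsame1.2] at ht1
    simp only [block, inc, setN0]
    refine wp_seq (wp_mono (wp_scanOrdering hO hδ hR1 rfl ht1) ?_)
    rintro s2 m2 hF2 ⟨hR2, hW2, hrows, hm2⟩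
    have hi2 : s2.nat .i 0 0 = s1.nat .i 0 0 := by rw [hF2.nat .i rfl]
    refine wp_seq (wp_setN (wp_skip ?_))
    have hpot : pot n (s2.setN .i 0 0 (s2.nat .i 0 0 + 1)) = pot n s2 := by simp [pot]
    simp only [NExp.eval, n0, hpot]
    simp only [Mem.nat_setN_self, upd_apply, and_self, if_true, ne_eq, reduceCtorEq,
      not_false_eq_true, Mem.nat_setN_of_ne, hi2]
    refine ⟨⟨hR2.congr (by simp [searchN]) (by simp), by omega, ?_, ?_⟩, by omega⟩
    · intro hc j hj
      rcases Nat.lt_succ_iff_lt_or_eq.1 hj with h | rfl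
      · rw [hrows j (by omega) (by omega), (hR2.same hc).1, ← hsame1.1]
        exact hW1 ht2 j h
      · exact hW2 hc
    · have : (600 * n + 200) * (s1.nat .i 0 0 + 1) =
          (600 * n + 200) * s1.nat .i 0 0 + (600 * n + 200) := by ring
      rw [this]
      simp only [BExp.cost, NExp.cost]
      omega
  · rintro s1 m1 hF ⟨m', ⟨hR1, hi1, hW1, hm1⟩, ht, rfl⟩
    simp only [BExp.holds, NExp.eval, n0] at ht
    refine ⟨hR1, ?_, ?_⟩
    · intro hc j hj
      have := (hR1.same hc).2
      exact hW1 hc j (by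
        by_contra h
        exact ht ⟨by omega, hc⟩)
    · have := Nat.mul_le_mul_left (600 * n + 200) hi1
      simp only [BExp.cost, NExp.cost, n0]
      omega

/-- A pass that leaves W unchanged certifies that no active pair exists; every other pass enlarges
W, so there are O(n) passes of O(n²) overhead. As copies are matched with growth of W, the number of
orderings rises by at most n. -/
theorem wp_search (hO : IsOracle O n M) (hδ : 0 ≤ δ) (hn : 1 ≤ n) {s : Mem}
    (h1 : Core O n δ ζ s) (h2 : QI n S T s)
    (h3 : Closed n (s.real .phi) (s.nat .inW) (s.nat .que) (s.nat .qt 0 0))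
    (h4 : s.nat .qh 0 0 = s.nat .qt 0 0) (hk : s.nat .k 0 0 ≤ n + 1) :
    wp O search (fun s' m => Core O n δ ζ s' ∧ QI n S T s' ∧
      Closed n (s'.real .phi) (s'.nat .inW) (s'.nat .que) (s'.nat .qt 0 0) ∧
      s'.nat .k 0 0 ≤ 2 * n + 1 ∧
      (s'.nat .hit 0 0 = 1 ∨
        (s'.nat .hit 0 0 = 0 ∧ ∀ j < s'.nat .k 0 0, WFirst n (s'.nat .inW) (s'.nat .L j) 0)) ∧
      m ≤ 17000 * (n * (n * n))) s := by
  simp only [search, block, setN0]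
  refine wp_seq (wp_setN (wp_seq ?_))
  simp only [NExp.eval]
  set s0 := s.setN .chg 0 0 1 with hs0
  have hk0 : s0.nat .k 0 0 ≤ n + 1 := by simpa [s0] using hk
  have hpot0 : pot n s0 ≤ 2000 * ((n + 1) * (n * n)) := by
    refine Nat.mul_le_mul_left 2000 ((psiSum_le _ _ _ _).trans ?_)
    exact Nat.mul_le_mul_right _ hk0
  have hnn : n ≤ n * n := Nat.le_mul_of_pos_left n hn
  have hnn2 : n * n ≤ n * (n * n) := Nat.le_mul_of_pos_left _ hn
  -- Each vertex entering W brings 8000n² units: 4000n² for the pushes as in `wp_pushRight`, and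
  -- 4000n² for the overhead of the pass. The conditional term pays for the final pass, in which W
  -- does not grow. In the variant, n + 1 rather than n makes the drop to 0 in that pass strict.
  refine wp_mono (wp_while (fun s' m => Core O n δ ζ s' ∧ QI n S T s' ∧
      Closed n (s'.real .phi) (s'.nat .inW) (s'.nat .que) (s'.nat .qt 0 0) ∧
      s'.nat .qh 0 0 = s'.nat .qt 0 0 ∧ s'.nat .chg 0 0 ≤ 1 ∧
      s'.nat .k 0 0 + s0.nat .qt 0 0 ≤ s0.nat .k 0 0 + s'.nat .qt 0 0 ∧
      (s'.nat .chg 0 0 = 0 → ∀ j < s'.nat .k 0 0, WFirst n (s'.nat .inW) (s'.nat .L j) 0) ∧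
      m + pot n s' + 8000 * (n * n) * s0.nat .qt 0 0 ≤
        pot n s0 + 8000 * (n * n) * s'.nat .qt 0 0 +
          (if s'.nat .chg 0 0 = 1 then 0 else 4000 * (n * n)))
    (fun s' => if s'.nat .chg 0 0 = 1 then n + 1 - s'.nat .qt 0 0 else 0) ?_ ?_) ?_
  · refine ⟨?_, by simpa [s0, QI] using h2, by simpa [s0] using h3, by simpa [s0] using h4,
      by simp [s0], by omega, by simp [s0], by omega⟩
    exact ⟨by simpa [s0] using h1.n_eq, by simpa [s0] using h1.delta_eq,
      by simpa [s0] using h1.base, by simpa [s0] using h1.flow, by simpa [s0] using h1.zeta_eq⟩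
  · rintro s1 m1 hF ⟨hC1, hQ1, hCl1, hqh1, hchg1, hk1, hW1, hm1⟩ ht
    simp only [BExp.holds, NExp.eval, n0] at ht
    obtain ⟨htc, hth⟩ := ht
    have hqt1 := QInv.qt_le hQ1
    rw [if_pos htc] at hm1 ⊢
    refine wp_seq (wp_setN (wp_seq (wp_setN (wp_seq ?_))))
    simp only [NExp.eval]
    set s2 := (s1.setN .chg 0 0 0).setN .i 0 0 0 with hs2
    have hR2 : ScanRel O n δ ζ S T s2 s2 := by
      refine .refl ?_ (by simpa [s2, QI] using hQ1) (by simpa [s2] using hCl1)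
        (by simpa [s2] using hqh1) (by simp [s2])
      exact ⟨by simpa [s2] using hC1.n_eq, by simpa [s2] using hC1.delta_eq,
        by simpa [s2] using hC1.base, by simpa [s2] using hC1.flow,
        by simpa [s2] using hC1.zeta_eq⟩
    refine wp_mono (wp_pass hO hδ hR2 (by simp [s2])) ?_
    rintro s3 m3 hF3 ⟨hR3, hW3, hm3⟩
    have e1 : pot n s2 = pot n s1 := by simp [pot, s2]
    have e2 : s2.nat .qt 0 0 = s1.nat .qt 0 0 := by simp [s2]
    have e3 : s2.nat .k 0 0 = s1.nat .k 0 0 := by simp [s2]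
    have hkq := hR3.k_qt
    have hgrew := hR3.grew
    have hle := hR3.qt_le
    have hchg3 := hR3.chg_le
    rw [e2, e3] at hkq
    rw [e2] at hle hgrew
    rw [e1, e2, e3] at hm3
    refine wp_skip ⟨⟨hR3.core, hR3.qi, hR3.closed, hR3.qh, hchg3, by omega, hW3, ?_⟩, ?_⟩
    · obtain ⟨d, hd⟩ := Nat.exists_eq_add_of_le hle
      rw [hd] at hm3 hgrew ⊢
      have hk3 : s1.nat .k 0 0 ≤ 3 * n := by omega
      have hk4 : (600 * n + 200) * s1.nat .k 0 0 ≤ (600 * n + 200) * (3 * n) :=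
        Nat.mul_le_mul_left _ hk3
      have e4 : (600 * n + 200) * (3 * n) = 1800 * (n * n) + 600 * n := by ring
      have e5 : 4000 * (n * n) * (s1.nat .qt 0 0 + d) =
          4000 * (n * n) * s1.nat .qt 0 0 + 4000 * (d * (n * n)) := by ring
      have e6 : 8000 * (n * n) * (s1.nat .qt 0 0 + d) =
          8000 * (n * n) * s1.nat .qt 0 0 + 8000 * (d * (n * n)) := by ring
      rw [e5] at hm3
      rw [e6]
      rw [e4] at hk4
      simp only [BExp.cost, NExp.cost, n0]
      split_ifs with hc
      · have hd1 : 1 ≤ d := by have := hgrew hc; omega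
        have hdn2 : n * n ≤ d * (n * n) := Nat.le_mul_of_pos_left _ hd1
        omega
      · omega
    · split_ifs with hc
      · have := hgrew hc
        omega
      · omega
  · rintro s1 m1 hF ⟨m', ⟨hC1, hQ1, hCl1, hqh1, hchg1, hk1, hW1, hm1⟩, ht, rfl⟩
    simp only [BExp.holds, NExp.eval, n0] at ht
    have hqt1 := QInv.qt_le hQ1
    refine wp_skip ⟨hC1, hQ1, hCl1, by omega, ?_, ?_⟩
    · by_cases hh : s1.nat .hit 0 0 = 0
      · exact Or.inr ⟨hh, hW1 (by
          by_contra h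
          exact ht ⟨by omega, hh⟩)⟩
      · have := hQ1.hit_le
        exact Or.inl (by omega)
    · have e1 : 2000 * ((n + 1) * (n * n)) = 2000 * (n * (n * n)) + 2000 * (n * n) := by ring
      have e2 : 8000 * (n * n) * s1.nat .qt 0 0 ≤ 8000 * (n * n) * n :=
        Nat.mul_le_mul_left _ hqt1
      have e3 : 8000 * (n * n) * n = 8000 * (n * (n * n)) := by ring
      simp only [BExp.cost, NExp.cost, n0]
      split_ifs at hm1 <;> omega

/-! ## Augmentations -/

/-- The commands of `augment` after the label. -/
def augmentPath : List Cmd := [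
  setN0 .t (n0 .tgt),
  whileDo (.not (.neq (n1 .par (n0 .t)) (n0 .t))) [
    setN0 .s (n1 .par (n0 .t)),
    setR2 .phi (n0 .s) (n0 .t) (.add (r2 .phi (n0 .s) (n0 .t)) (r0 .delta)),
    setR2 .phi (n0 .t) (n0 .s) (.sub (r2 .phi (n0 .t) (n0 .s)) (r0 .delta)),
    setN0 .t (n0 .s)]]

/-- Walking from the target towards the root, the changes of the boundary cancel at all inner
vertices, so ζ rises by δ at the root, which lies in S, and falls by δ at the target. -/
theorem wp_augmentPath {s : Mem} (hδ : 0 ≤ δ) (hC : Core O n δ ζ s) (hQ : QI n S T s)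
    (hhit : s.nat .hit 0 0 = 1) :
    wp O (block augmentPath) (fun s' m => IsFlow n δ (s'.real .phi) ∧
      (∃ a ∈ S, a < n ∧ ∃ b ∈ T, ∀ v < n, zeta n (s.real .x) (s'.real .phi) v =
        ζ v + (if v = a then δ else 0) - (if v = b then δ else 0)) ∧
      m ≤ 100 * n + 40) s := by
  obtain ⟨htn, htW, htT⟩ := hQ.hit1 hhit
  set t := s.nat .tgt 0 0 with htdef
  obtain ⟨mt, hmt, hqt⟩ := hQ.que_of t htn htW
  have hqn := QInv.qt_le hQ
  -- The position of a vertex in the queue; it decreases from child to parent and serves as the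
  -- variant of the loop.
  obtain ⟨ρ, hρ⟩ : ∃ ρ : ℕ → ℕ, ∀ r < s.nat .qt 0 0, ρ (s.nat .que r 0) = r := by
    have hinj : Set.InjOn (fun r => s.nat .que r 0) (Set.Iio (s.nat .qt 0 0)) :=
      fun r hr r' hr' e => hQ.que_inj r hr r' hr' e
    exact ⟨_, fun r hr => hinj.leftInvOn_invFunOn hr⟩
  simp only [augmentPath, block, setN0, whileDo]
  refine wp_seq (wp_setN (wp_seq ?_))
  simp only [NExp.eval, n0, ← htdef]
  -- The flow among the first r + 1 queue entries is still the original one, so the next forest arc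
  -- still carries at most 0 and can take δ more without exceeding the capacity.
  refine wp_mono (wp_while (fun s' m => IsFlow n δ (s'.real .phi) ∧
      ∃ r ≤ mt, s.nat .que r 0 = s'.nat .t 0 0 ∧ m + 100 * r ≤ 100 * mt ∧
        (∀ a ≤ r, ∀ b ≤ r, s'.real .phi (s.nat .que a 0) (s.nat .que b 0) =
          s.real .phi (s.nat .que a 0) (s.nat .que b 0)) ∧
        ∀ v < n, ∑ w ∈ range n, s'.real .phi w v = ∑ w ∈ range n, s.real .phi w v +
          (if v = t then δ else 0) - (if v = s'.nat .t 0 0 then δ else 0))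
    (fun s' => ρ (s'.nat .t 0 0)) ?_ ?_) ?_
  · refine ⟨by simpa using hC.flow, mt, le_rfl, by simpa using hqt, by omega, by simp, ?_⟩
    intro v hv
    simp
  · rintro s1 m1 hF ⟨hfl, r, hr, hqr, hm, hsame, hsum⟩ ht
    have hpar1 : s1.nat .par = s.nat .par := by simp [hF.nat .par rfl]
    have hd1 : s1.real .delta 0 0 = δ := by simp [hF.real .delta rfl, hC.delta_eq]
    simp only [BExp.holds, NExp.eval, n1, hpar1] at ht
    have htn' : s1.nat .t 0 0 < n := by rw [← hqr]; exact hQ.que_lt r (by omega)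
    rcases hQ.par r (by omega) with ⟨h, -⟩ | ⟨r', hr', hp, hle⟩
    · rw [hqr] at h; exact absurd h ht
    have hun := hQ.que_lt r' (by omega)
    rw [hqr] at hp
    rw [hp] at ht
    have hphi : s1.real .phi (s.nat .que r' 0) (s1.nat .t 0 0) ≤ 0 := by
      rw [← hqr, hsame r' (by omega) r le_rfl]; exact hle
    have hlow := hfl.neg_le hun htn'
    generalize hue : s.nat .que r' 0 = u at *
    generalize hte : s1.nat .t 0 0 = t' at *
    simp only [setR2]
    repeat' with_reducible
      first | apply wp_seq | apply wp_setN | apply wp_setR | apply wp_skip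
    simp only [NExp.eval, RExp.eval, n1, r2, r0, hpar1, hte, hp, hd1, Mem.nat_setN_self,
      Mem.nat_setR, Mem.real_setN, Mem.real_setR_self, upd_apply, and_self, if_true, ne_eq,
      reduceCtorEq, not_false_eq_true, Mem.nat_setN_of_ne, Mem.real_setR_of_ne, ht, and_false,
      if_false]
    have hFC : FlowChange n u t' (-δ) (s1.real .phi)
        (upd (upd (s1.real .phi) u t' (s1.real .phi u t' + δ)) t' u (s1.real .phi t' u - δ)) := by
      constructor
      intro a b
      simp only [upd_apply]
      by_cases e1 : a = t' ∧ b = u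
      · obtain ⟨rfl, rfl⟩ := e1
        have := Ne.symm ht
        simp [this, sub_eq_add_neg]
      · by_cases e2 : a = u ∧ b = t'
        · obtain ⟨rfl, rfl⟩ := e2
          simp [ht]
        · simp [e1, e2]
    refine ⟨⟨?_, r', by omega, hue, ?_, ?_, ?_⟩, ?_⟩
    · exact hFC.isFlow hfl hun htn' (by linarith) (by linarith) ht
    · simp only [BExp.cost, NExp.cost, RExp.cost]
      omega
    · intro a ha b hb
      rw [← hsame a (by omega) b (by omega)]
      refine (hFC.eq _ _).trans ?_
      have ha' : s.nat .que a 0 ≠ t' := by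
        rw [← hqr]; intro e
        have := hQ.que_inj a (by omega) r (by omega) e
        omega
      have hb' : s.nat .que b 0 ≠ t' := by
        rw [← hqr]; intro e
        have := hQ.que_inj b (by omega) r (by omega) e
        omega
      simp [ha', hb']
    · intro v hv
      refine (hFC.sum hun htn' v).trans ?_
      rw [hsum v hv]
      split_ifs <;> ring
    · rw [← hue, ← hqr, hρ r' (by omega), hρ r (by omega)]
      exact hr'
  · rintro s1 m1 hF ⟨m', ⟨hfl, r, hr, hqr, hm, hsame, hsum⟩, ht, rfl⟩
    have hpar1 : s1.nat .par = s.nat .par := by simp [hF.nat .par rfl]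
    simp only [BExp.holds, NExp.eval, n1, hpar1, not_not] at ht
    have hS : s1.nat .t 0 0 ∈ S := by
      rcases hQ.par r (by omega) with ⟨-, h⟩ | ⟨r', hr', hp, -⟩
      · rwa [hqr] at h
      · rw [hqr, ht, ← hqr] at hp
        have := hQ.que_inj r (by omega) r' (by omega) hp
        omega
    refine wp_skip ⟨hfl, ⟨s1.nat .t 0 0, hS, ?_, t, htT, ?_⟩, ?_⟩
    · rw [← hqr]; exact hQ.que_lt r (by omega)
    · intro v hv
      rw [← hC.zeta_eq v hv]
      simp only [zeta, hsum v hv]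
      ring
    · simp only [BExp.cost, NExp.cost, n1]
      omega

end

end SFM

namespace SFM

open Finset

/-! ## Reduction of the convex combination -/

/-- The invariant of the elimination. The first `j` columns of `orig` have been treated. -/
structure Tab (n k j : ℕ) (orig : ℕ → ℕ → ℝ) (lam0 lam tab : ℕ → ℕ → ℝ) (bas keep : ℕ → ℕ → ℕ) :
    Prop where
  ker : ∀ a : ℕ → ℝ, (∀ w ≤ n, ∑ c ∈ range k, a c * tab w c = 0) →
    ∀ w ≤ n, ∑ c ∈ range k, a c * orig w c = 0
  bas_le : ∀ w ≤ n, bas w 0 ≤ j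
  bas_col : ∀ w ≤ n, ∀ c, bas w 0 = c + 1 → ∀ w' ≤ n, tab w' c = if w' = w then 1 else 0
  bas_keep : ∀ w ≤ n, ∀ c, bas w 0 = c + 1 → keep c 0 = 1
  keep_bas : ∀ c < j, keep c 0 = 1 → ∃ w ≤ n, bas w 0 = c + 1
  keep_zero : ∀ c < j, keep c 0 ≠ 1 → lam c 0 = 0
  nonneg : ∀ c < k, 0 ≤ lam c 0
  sum : ∀ w ≤ n, ∑ c ∈ range k, lam c 0 * orig w c = ∑ c ∈ range k, lam0 c 0 * orig w c

section

variable {n k j : ℕ} {orig lam0 lam lam' tab tab' : ℕ → ℕ → ℝ} {bas keep : ℕ → ℕ → ℕ}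

theorem Tab.bas_inj (h : Tab n k j orig lam0 lam tab bas keep) {w w' c : ℕ} (hw : w ≤ n)
    (hw' : w' ≤ n) (e : bas w 0 = c + 1) (e' : bas w' 0 = c + 1) : w = w' := by
  have h1 := h.bas_col w hw c e w hw
  have h2 := h.bas_col w' hw' c e' w hw
  rw [h1] at h2
  by_contra hne
  simp [hne] at h2

/-- A pivot consists of invertible row operations, so it adds no affine dependencies; the inclusion
of kernels in the field `ker` is all that is needed later. -/
theorem Tab.pivot (h : Tab n k j orig lam0 lam tab bas keep) {r : ℕ} (hr : r ≤ n) (hj : j < k)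
    (hbr : bas r 0 = 0) (hd : tab r j ≠ 0) (h1 : ∀ c < k, tab' r c = tab r c / tab r j)
    (h2 : ∀ w ≤ n, w ≠ r → ∀ c < k, tab' w c = tab w c - tab w j * tab' r c) :
    Tab n k (j + 1) orig lam0 lam tab' (upd bas r 0 (j + 1)) (upd keep j 0 1) := by
  -- Columns that are basic in another row vanish in row r and hence survive the pivot unchanged.
  have hcol : ∀ c, tab r c = 0 → c < k → ∀ w ≤ n, tab' w c = tab w c := by
    intro c h0 hc w hw
    by_cases e : w = r
    · rw [e, h1 c hc, h0, zero_div]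
    · rw [h2 w hw e c hc, h1 c hc, h0, zero_div, mul_zero, sub_zero]
  refine ⟨?_, ?_, ?_, ?_, ?_, ?_, h.nonneg, h.sum⟩
  · intro a ha
    refine h.ker a ?_
    have hr0 : ∑ c ∈ range k, a c * tab r c = 0 := by
      have : ∑ c ∈ range k, a c * tab r c = tab r j * ∑ c ∈ range k, a c * tab' r c := by
        rw [mul_sum]
        refine sum_congr rfl fun c hc => ?_
        rw [h1 c (mem_range.1 hc)]
        field_simp
      rw [this, ha r hr, mul_zero]
    intro w hw
    by_cases e : w = r
    · rw [e]; exact hr0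
    · have : ∑ c ∈ range k, a c * tab w c = ∑ c ∈ range k, a c * tab' w c +
          tab w j * ∑ c ∈ range k, a c * tab' r c := by
        rw [mul_sum, ← sum_add_distrib]
        refine sum_congr rfl fun c hc => ?_
        rw [h2 w hw e c (mem_range.1 hc)]
        ring
      rw [this, ha w hw, ha r hr, mul_zero, add_zero]
  · intro w hw
    have := h.bas_le w hw
    simp only [upd_apply]
    split_ifs <;> omega
  · intro w hw c hc w' hw'
    by_cases e : w = r
    · subst e
      have hcj : c = j := by simpa [eq_comm] using hc
      subst hcj
      by_cases e' : w' = w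
      · rw [e', h1 c hj, div_self hd, if_pos rfl]
      · rw [h2 w' hw' e' c hj, h1 c hj, div_self hd, if_neg e']
        ring
    · have hc' : bas w 0 = c + 1 := by simpa [e] using hc
      have hcj := h.bas_le w hw
      have h0 : tab r c = 0 := by
        rw [h.bas_col w hw c hc' r hr, if_neg (Ne.symm e)]
      rw [hcol c h0 (by omega) w' hw']
      exact h.bas_col w hw c hc' w' hw'
  · intro w hw c hc
    by_cases e : w = r
    · subst e
      have hcj : c = j := by simpa [eq_comm] using hc
      simp [hcj]
    · have hc' : bas w 0 = c + 1 := by simpa [e] using hc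
      have := h.bas_keep w hw c hc'
      simp [this]
  · intro c hc hk
    by_cases e : c = j
    · exact ⟨r, hr, by simp [e]⟩
    · obtain ⟨w, hw, hb⟩ := h.keep_bas c (by omega) (by simpa [e] using hk)
      refine ⟨w, hw, ?_⟩
      have : w ≠ r := by rintro rfl; omega
      simpa [this] using hb
  · intro c hc hk
    by_cases e : c = j
    · simp [e] at hk
    · exact h.keep_zero c (by omega) (by simpa [e] using hk)

/-- The coefficients that express column `j` by the basic columns. -/
noncomputable def basCoeff (n j : ℕ) (tab : ℕ → ℕ → ℝ) (bas : ℕ → ℕ → ℕ) (c : ℕ) : ℝ :=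
  ∑ w ∈ range (n + 1), if bas w 0 = c + 1 then tab w j else 0

theorem Tab.basCoeff_eq (h : Tab n k j orig lam0 lam tab bas keep) {w c : ℕ} (hw : w ≤ n)
    (e : bas w 0 = c + 1) : basCoeff n j tab bas c = tab w j := by
  unfold basCoeff
  rw [sum_eq_single w]
  · simp [e]
  · intro w' hw' hne
    rw [if_neg]
    intro e'
    exact hne (h.bas_inj (by have := mem_range.1 hw'; omega) hw e' e)
  · intro h'; exact absurd (mem_range.2 (by omega)) h'

theorem basCoeff_eq_zero {c : ℕ} (h : ∀ w ≤ n, bas w 0 ≠ c + 1) :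
    basCoeff n j tab bas c = 0 := by
  refine sum_eq_zero fun w hw => ?_
  rw [if_neg (h w (by have := mem_range.1 hw; omega))]

/-- Basic columns of the tableau are unit vectors and column j vanishes in the rows without one, so
the tableau annihilates the coefficients minus the unit vector at j. By `ker` the original columns
satisfy the same dependency. -/
theorem Tab.sum_basCoeff (h : Tab n k j orig lam0 lam tab bas keep) (hj : j < k)
    (h0 : ∀ w ≤ n, bas w 0 = 0 → tab w j = 0) {w : ℕ} (hw : w ≤ n) :
    ∑ c ∈ range k, basCoeff n j tab bas c * orig w c = orig w j := by
  have key := h.ker (fun c => basCoeff n j tab bas c - if c = j then 1 else 0) ?_ w hw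
  · simp_rw [sub_mul] at key
    rw [sum_sub_distrib] at key
    simp [hj] at key
    linarith
  · intro w' hw'
    simp_rw [sub_mul]
    rw [sum_sub_distrib]
    have e1 : ∑ c ∈ range k, (if c = j then (1 : ℝ) else 0) * tab w' c = tab w' j := by
      simp [hj]
    have e2 : ∑ c ∈ range k, basCoeff n j tab bas c * tab w' c =
        ∑ w ∈ range (n + 1), if w' = w then tab w' j else 0 := by
      unfold basCoeff
      simp_rw [sum_mul]
      rw [sum_comm]
      refine sum_congr rfl fun w hw => ?_
      have hw := Nat.lt_succ_iff.1 (mem_range.1 hw)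
      have hle := h.bas_le w hw
      rcases hb : bas w 0 with _ | b
      · have := h0 w hw hb
        by_cases e : w' = w
        · rw [← e] at this; simp [this]
        · simp [e]
      · rw [sum_eq_single b]
        · rw [h.bas_col w hw b hb w' hw']
          by_cases e : w' = w <;> simp [e]
        · intro c _ hne
          rw [if_neg (by omega), zero_mul]
        · intro h'
          exact absurd (mem_range.2 (by omega)) h'
    rw [e1, e2]
    simp [Nat.lt_succ_iff.2 hw']

/-- The row of ones says that the coefficients expressing column j sum to 1, so one of them is
positive and the ratio test has a candidate. -/
theorem Tab.exists_pos (h : Tab n k j orig lam0 lam tab bas keep) (hj : j < k)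
    (h0 : ∀ w ≤ n, bas w 0 = 0 → tab w j = 0) (hone : ∀ c, orig n c = 1) :
    ∃ w ≤ n, bas w 0 ≠ 0 ∧ 0 < tab w j := by
  by_contra! hcon
  have := h.sum_basCoeff hj h0 le_rfl
  simp_rw [hone, mul_one] at this
  have hle : ∑ c ∈ range k, basCoeff n j tab bas c ≤ 0 := by
    refine sum_nonpos fun c _ => sum_nonpos fun w hw => ?_
    have hw := Nat.lt_succ_iff.1 (mem_range.1 hw)
    split_ifs with e
    · exact hcon w hw (by omega)
    · exact le_rfl
  linarith

/-- Moving λ along an affine dependency keeps all row sums; the minimal ratio keeps λ nonnegative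
and makes λ_b = 0, so column b may be released. Row r is then regarded as having no basic column,
which makes `Tab.pivot` applicable exactly as in the independent case; in the program that pivot
follows at once. -/
theorem Tab.exchange (h : Tab n k j orig lam0 lam tab bas keep) (hj : j < k)
    (h0 : ∀ w ≤ n, bas w 0 = 0 → tab w j = 0) {r b : ℕ} {θ : ℝ} (hr : r ≤ n)
    (hb : bas r 0 = b + 1) (hpos : 0 < tab r j) (hθ : θ = lam b 0 / tab r j)
    (hmin : ∀ w ≤ n, ∀ c, bas w 0 = c + 1 → 0 < tab w j → θ ≤ lam c 0 / tab w j)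
    (hlam : ∀ c < k, lam' c 0 = lam c 0 - θ * basCoeff n j tab bas c + if c = j then θ else 0) :
    Tab n k j orig lam0 lam' tab (upd bas r 0 0) (upd keep b 0 0) := by
  have hbj := h.bas_le r hr
  have hθ0 : 0 ≤ θ := by
    rw [hθ]; exact div_nonneg (h.nonneg b (by omega)) hpos.le
  have hjc : basCoeff n j tab bas j = 0 := by
    refine basCoeff_eq_zero fun w hw => ?_
    have := h.bas_le w hw
    omega
  refine ⟨h.ker, ?_, ?_, ?_, ?_, ?_, ?_, ?_⟩
  · intro w hw
    have := h.bas_le w hw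
    simp only [upd_apply]
    split_ifs <;> omega
  · intro w hw c hc
    by_cases e : w = r
    · simp [e] at hc
    · exact h.bas_col w hw c (by simpa [e] using hc)
  · intro w hw c hc
    by_cases e : w = r
    · simp [e] at hc
    · have hc' : bas w 0 = c + 1 := by simpa [e] using hc
      have : c ≠ b := by
        rintro rfl
        exact e (h.bas_inj hw hr hc' hb)
      simpa [this] using h.bas_keep w hw c hc'
  · intro c hc hk
    have hcb : c ≠ b := by rintro rfl; simp at hk
    obtain ⟨w, hw, e⟩ := h.keep_bas c hc (by simpa [hcb] using hk)
    refine ⟨w, hw, ?_⟩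
    have : w ≠ r := by rintro rfl; omega
    simpa [this] using e
  · intro c hc hk
    rw [hlam c (by omega), if_neg (by omega)]
    by_cases e : c = b
    · subst e
      rw [h.basCoeff_eq hr hb, hθ]
      field_simp
      ring
    · have hk' : keep c 0 ≠ 1 := by simpa [e] using hk
      rw [h.keep_zero c hc hk', basCoeff_eq_zero]
      · ring
      · intro w hw e'
        exact hk' (h.bas_keep w hw c e')
  · intro c hc
    have hc0 := h.nonneg c hc
    rw [hlam c hc]
    by_cases e : c = j
    · rw [e, hjc, if_pos rfl]
      rw [e] at hc0
      linarith
    · rw [if_neg e, add_zero]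
      by_cases hw : ∃ w ≤ n, bas w 0 = c + 1
      · obtain ⟨w, hw, e'⟩ := hw
        rw [h.basCoeff_eq hw e']
        by_cases hp : 0 < tab w j
        · have := hmin w hw c e' hp
          rw [le_div_iff₀ hp] at this
          linarith
        · have := mul_nonneg hθ0 (sub_nonneg.2 (not_lt.1 hp))
          linarith
      · push Not at hw
        rw [basCoeff_eq_zero hw]
        linarith
  · intro w hw
    rw [← h.sum w hw]
    have : ∑ c ∈ range k, lam' c 0 * orig w c = ∑ c ∈ range k, lam c 0 * orig w c -
        θ * ∑ c ∈ range k, basCoeff n j tab bas c * orig w c +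
        ∑ c ∈ range k, (if c = j then θ else 0) * orig w c := by
      rw [mul_sum, ← sum_sub_distrib, ← sum_add_distrib]
      refine sum_congr rfl fun c hc => ?_
      rw [hlam c (mem_range.1 hc)]
      ring
    rw [this, h.sum_basCoeff hj h0 hw]
    simp [hj]

end

section

variable {O : Set ℕ → ℝ} {n k : ℕ}

theorem wp_pivot {s : Mem} {r j : ℕ} (hn : s.nat .n 0 0 = n) (hk : s.nat .k 0 0 = k)
    (hr : s.nat .r 0 0 = r) (hj : s.nat .j 0 0 = j) (hjk : j < k) :
    wp O pivot (fun s' m =>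
      (∀ c < k, s'.real .tab r c = s.real .tab r c / s.real .tab r j) ∧
      (∀ w ≤ n, w ≠ r → ∀ c < k, s'.real .tab w c =
        s.real .tab w c - s.real .tab w j * s'.real .tab r c) ∧
      m ≤ k * 60 + (n + 1) * (k * 60 + 100) + 100) s := by
  simp only [pivot, block, setR0]
  refine wp_seq (wp_setR (wp_seq ?_))
  simp only [NExp.eval, RExp.eval, r2, n0, hr, hj]
  refine wp_mono (wp_forTo k 40 (fun i s' =>
    (∀ c < i, s'.real .tab r c = s.real .tab r c / s.real .tab r j) ∧
    (∀ c, i ≤ c → s'.real .tab r c = s.real .tab r c) ∧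
    (∀ w, w ≠ r → ∀ c, s'.real .tab w c = s.real .tab w c)) rfl ?_ ?_ ?_) ?_
  · intro s' hF; simp [hF.nat .k rfl, hk]
  · simp
  · rintro i hi s' hF hci ⟨h1, h2, h3⟩
    have hr' : s'.nat .r 0 0 = r := by simp [hF.nat .r rfl, hr]
    have hd' : s'.real .d 0 0 = s.real .tab r j := by simp [hF.real .d rfl]
    simp only [block, setR2]
    refine wp_seq (wp_setR (wp_skip ?_))
    simp [hr', hci, hd']
    refine ⟨?_, ?_, ?_⟩
    · intro c hc
      split_ifs with e
      · rw [e, h2 i le_rfl]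
      · exact h1 c (by omega)
    · intro c hc
      rw [if_neg (by omega)]
      exact h2 c (by omega)
    · intro w hw c
      simp [hw, h3 w hw c]
  rintro s1 m1 hF1 ⟨⟨h1, -, h2⟩, -, hm1⟩
  have hn1 : s1.nat .n 0 0 = n := by simp [hF1.nat .n rfl, hn]
  have hk1 : s1.nat .k 0 0 = k := by simp [hF1.nat .k rfl, hk]
  have hr1 : s1.nat .r 0 0 = r := by simp [hF1.nat .r rfl, hr]
  have hj1 : s1.nat .j 0 0 = j := by simp [hF1.nat .j rfl, hj]
  refine wp_seq (wp_mono (wp_forTo (n + 1) (k * 60 + 60) (fun i s' =>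
    (∀ c, s'.real .tab r c = s1.real .tab r c) ∧
    (∀ w, i ≤ w → ∀ c, s'.real .tab w c = s1.real .tab w c) ∧
    (∀ w < i, w ≠ r → ∀ c < k, s'.real .tab w c = s1.real .tab w c -
        s1.real .tab w j * s1.real .tab r c)) rfl ?_ ?_ ?_) ?_)
  · intro s' hF; simp [hF.nat .n rfl, hn1]
  · simp
  · rintro i hi s2 hF2 hwi ⟨h3, h4, h5⟩
    have hr2 : s2.nat .r 0 0 = r := by simp [hF2.nat .r rfl, hr1]
    have hk2 : s2.nat .k 0 0 = k := by simp [hF2.nat .k rfl, hk1]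
    have hj2 : s2.nat .j 0 0 = j := by simp [hF2.nat .j rfl, hj1]
    simp only [block, ifThen]
    refine wp_seq (wp_ite ?_ ?_)
    · intro ht
      simp only [BExp.holds, NExp.eval, hwi, hr2] at ht
      refine wp_seq (wp_setR (wp_seq ?_))
      simp only [NExp.eval, RExp.eval, hwi, hj2]
      -- The multiplier is kept in the scalar `d` because its entry in column j is overwritten
      -- during this loop; row r is not touched.
      refine wp_mono (wp_forTo k 40 (fun p s' =>
        (∀ c, s'.real .tab r c = s1.real .tab r c) ∧
        (∀ w, i < w → ∀ c, s'.real .tab w c = s1.real .tab w c) ∧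
        (∀ w < i, w ≠ r → ∀ c < k, s'.real .tab w c = s1.real .tab w c -
          s1.real .tab w j * s1.real .tab r c) ∧
        (∀ c < p, s'.real .tab i c = s1.real .tab i c -
          s1.real .tab i j * s1.real .tab r c) ∧
        (∀ c, p ≤ c → s'.real .tab i c = s1.real .tab i c)) rfl ?_ ?_ ?_) ?_
      · intro s' hF; simp [hF.nat .k rfl, hk2]
      · simp
        exact ⟨h3, fun w hw c => h4 w hw.le c, h5, fun c => h4 i le_rfl c⟩
      · rintro p hp s3 hF3 hcp ⟨h6, h7, h8, h9, h10⟩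
        have hr3 : s3.nat .r 0 0 = r := by simp [hF3.nat .r rfl, hr2]
        have hw3 : s3.nat .w 0 0 = i := by simp [hF3.nat .w rfl, hwi]
        have hd3 : s3.real .d 0 0 = s1.real .tab i j := by
          simp [hF3.real .d rfl, h4 i le_rfl]
        simp only [block, setR2]
        refine wp_seq (wp_setR (wp_skip ?_))
        have hri : r ≠ i := Ne.symm ht
        simp [hr3, hcp, hw3, hd3, hri, h6]
        refine ⟨?_, ?_, ?_, ?_⟩
        · intro w hw c
          rw [if_neg (by omega)]
          exact h7 w hw c
        · intro w hw hwr c hc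
          rw [if_neg (by omega)]
          exact h8 w hw hwr c hc
        · intro c hc
          split_ifs with e
          · rw [h10 p le_rfl, e]
          · exact h9 c (by omega)
        · intro c hc
          rw [if_neg (by omega)]
          exact h10 c (by omega)
      · rintro s3 m3 hF3 ⟨⟨h6, h7, h8, h9, h10⟩, -, hm3⟩
        refine wp_skip (wp_skip ?_)
        simp only [Mem.real_setN]
        refine ⟨⟨h6, fun w hw => h7 w (by omega), ?_⟩, ?_⟩
        · intro w hw hwr c hc
          rcases Nat.lt_succ_iff_lt_or_eq.1 hw with h | rfl
          · exact h8 w h hwr c hc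
          · exact h9 c hc
        · simp at hm3 ⊢; omega
    · intro ht
      simp only [BExp.holds, NExp.eval, hwi, hr2, not_not] at ht
      refine wp_skip (wp_skip ?_)
      simp only [Mem.real_setN]
      refine ⟨⟨h3, fun w hw => h4 w (by omega), ?_⟩, ?_⟩
      · intro w hw hwr c hc
        exact h5 w (by omega) hwr c hc
      · simp
  rintro s2 m2 hF2 ⟨⟨h3, -, h5⟩, -, hm2⟩
  refine wp_skip ⟨?_, ?_, ?_⟩
  · intro c hc
    rw [h3, h1 c hc]
  · intro w hw hwr c hc
    rw [h5 w (by omega) hwr c hc, h3, h2 w hwr, h2 w hwr]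
  · simp at hm1 hm2 ⊢
    nlinarith

end

end SFM

/-! ### Treatment of one column -/

namespace SFM

open Finset

section

variable {O : Set ℕ → ℝ} {n k j : ℕ} {orig lam0 : ℕ → ℕ → ℝ}

/-- Search for a row without a basic column that is not zero in column `j`. -/
def findRow : Cmd :=
  forTo .w (.succ (n0 .n)) [
    ifThen (.and (.neq (n1 .bas (n0 .w)) (.lit 0))
        (.or (.rlt (r2 .tab (n0 .w) (n0 .j)) (.lit 0))
          (.rlt (.lit 0) (r2 .tab (n0 .w) (n0 .j))))) [
      setN0 .r (n0 .w)]]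

/-- The ratio test. -/
def ratioTest : Cmd :=
  forTo .w (.succ (n0 .n)) [
    ifThen (.and (.not (.neq (n1 .bas (n0 .w)) (.lit 0)))
        (.rlt (.lit 0) (r2 .tab (n0 .w) (n0 .j)))) [
      setR0 .d (.div (r1 .lam basicCol) (r2 .tab (n0 .w) (n0 .j))),
      ifThen (.or (.neq (n0 .r) (.succ (n0 .n))) (.rlt (r0 .d) (r0 .theta))) [
        setR0 .theta (r0 .d),
        setN0 .r (n0 .w)]]]

/-- Subtraction of the affine dependency from the coefficients. -/
def updateLam : Cmd :=
  forTo .w (.succ (n0 .n)) [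
    ifThen (.not (.neq (n1 .bas (n0 .w)) (.lit 0))) [
      setR1 .lam basicCol
        (.sub (r1 .lam basicCol) (.mul (r0 .theta) (r2 .tab (n0 .w) (n0 .j))))]]

/-- The treatment of column `j`. -/
def reduceStep : List Cmd := [
  setN0 .r (.succ (n0 .n)),
  findRow,
  ifThen (.neq (n0 .r) (.succ (n0 .n))) [
    ratioTest,
    updateLam,
    setR1 .lam (n0 .j) (.add (r1 .lam (n0 .j)) (r0 .theta)),
    setN1 .keep (.pred (n1 .bas (n0 .r))) (.lit 0)],
  pivot,
  setN1 .bas (n0 .r) (.succ (n0 .j)),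
  setN1 .keep (n0 .j) (.lit 1)]

/-- The rows are 0, …, n, so the value n + 1 of `r` encodes that no row was found, which means that
column j depends on the basic columns. -/
theorem wp_findRow {s : Mem} (hn : s.nat .n 0 0 = n) (hj : s.nat .j 0 0 = j)
    (hr : s.nat .r 0 0 = n + 1) :
    wp O findRow (fun s' m =>
      ((s'.nat .r 0 0 = n + 1 ∧ ∀ w ≤ n, s.nat .bas w 0 = 0 → s.real .tab w j = 0) ∨
        (s'.nat .r 0 0 ≤ n ∧ s.nat .bas (s'.nat .r 0 0) 0 = 0 ∧
          s.real .tab (s'.nat .r 0 0) j ≠ 0)) ∧ m ≤ n * 120 + 200) s := by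
  refine wp_mono (wp_forTo (n + 1) 90 (fun i s' =>
      (s'.nat .r 0 0 = n + 1 ∧ ∀ w < i, s.nat .bas w 0 = 0 → s.real .tab w j = 0) ∨
        (s'.nat .r 0 0 ≤ n ∧ s.nat .bas (s'.nat .r 0 0) 0 = 0 ∧
          s.real .tab (s'.nat .r 0 0) j ≠ 0)) rfl ?_ ?_ ?_) ?_
  · intro s' hF; simp [hF.nat .n rfl, hn]
  · left; simpa using hr
  · rintro i hi s1 hF hwi hI
    have hb : s1.nat .bas = s.nat .bas := hF.nat .bas rfl
    have ht1 : s1.real .tab = s.real .tab := hF.real .tab rfl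
    have hj1 : s1.nat .j 0 0 = j := by rw [hF.nat .j rfl, hj]
    simp only [block, ifThen, setN0]
    refine wp_seq (wp_ite ?_ ?_)
    · intro ht
      simp only [BExp.holds, NExp.eval, RExp.eval, n0, n1, r2, hwi, hb, ht1, hj1,
        Nat.cast_zero] at ht
      refine wp_seq (wp_setN (wp_skip (wp_skip ?_)))
      refine ⟨Or.inr ?_, by simp⟩
      simp [hwi]
      exact ⟨by omega, ht.1, fun e => by simp [e] at ht⟩
    · intro ht
      simp only [BExp.holds, NExp.eval, RExp.eval, n0, n1, r2, hwi, hb, ht1, hj1,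
        Nat.cast_zero] at ht
      refine wp_skip (wp_skip ⟨?_, by simp⟩)
      simp only [ne_eq, reduceCtorEq, not_false_eq_true, Mem.nat_setN_of_ne]
      refine hI.imp_left ?_
      rintro ⟨h1, h2⟩
      refine ⟨h1, ?_⟩
      intro w hw hbw
      rcases Nat.lt_succ_iff_lt_or_eq.1 hw with h | rfl
      · exact h2 w h hbw
      · by_contra hne
        exact ht ⟨hbw, lt_or_gt_of_ne hne⟩
  · rintro s1 m1 hF ⟨hI, -, hm⟩
    refine ⟨?_, by simp at hm; omega⟩
    refine hI.imp_left ?_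
    rintro ⟨h1, h2⟩
    exact ⟨h1, fun w hw => h2 w (by omega)⟩

/-- The test starts from the sentinel r = n + 1, so the first candidate is accepted whatever `theta`
contains; the positivity hypothesis excludes that the sentinel survives. -/
theorem wp_ratioTest {s : Mem} (hn : s.nat .n 0 0 = n) (hj : s.nat .j 0 0 = j)
    (hr : s.nat .r 0 0 = n + 1) (hpos : ∃ w ≤ n, s.nat .bas w 0 ≠ 0 ∧ 0 < s.real .tab w j) :
    wp O ratioTest (fun s' m => (s'.nat .r 0 0 ≤ n ∧ s.nat .bas (s'.nat .r 0 0) 0 ≠ 0 ∧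
        0 < s.real .tab (s'.nat .r 0 0) j ∧
        s'.real .theta 0 0 = s.real .lam (s.nat .bas (s'.nat .r 0 0) 0 - 1) 0 /
          s.real .tab (s'.nat .r 0 0) j ∧
        ∀ w ≤ n, s.nat .bas w 0 ≠ 0 → 0 < s.real .tab w j →
          s'.real .theta 0 0 ≤ s.real .lam (s.nat .bas w 0 - 1) 0 / s.real .tab w j) ∧
        m ≤ n * 140 + 200) s := by
  refine wp_mono (wp_forTo (n + 1) 110 (fun i s' =>
      (s'.nat .r 0 0 = n + 1 ∧ ∀ w < i, s.nat .bas w 0 ≠ 0 → ¬ 0 < s.real .tab w j) ∨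
      (s'.nat .r 0 0 ≤ n ∧ s.nat .bas (s'.nat .r 0 0) 0 ≠ 0 ∧
        0 < s.real .tab (s'.nat .r 0 0) j ∧
        s'.real .theta 0 0 = s.real .lam (s.nat .bas (s'.nat .r 0 0) 0 - 1) 0 /
          s.real .tab (s'.nat .r 0 0) j ∧
        ∀ w < i, s.nat .bas w 0 ≠ 0 → 0 < s.real .tab w j →
          s'.real .theta 0 0 ≤ s.real .lam (s.nat .bas w 0 - 1) 0 / s.real .tab w j))
      rfl ?_ ?_ ?_) ?_
  · intro s' hF; simp [hF.nat .n rfl, hn]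
  · left; simpa using hr
  · rintro i hi s1 hF hwi hI
    have hb : s1.nat .bas = s.nat .bas := hF.nat .bas rfl
    have ht1 : s1.real .tab = s.real .tab := hF.real .tab rfl
    have hl1 : s1.real .lam = s.real .lam := hF.real .lam rfl
    have hj1 : s1.nat .j 0 0 = j := by rw [hF.nat .j rfl, hj]
    have hn1 : s1.nat .n 0 0 = n := by rw [hF.nat .n rfl, hn]
    simp only [block, ifThen, setN0, setR0]
    refine wp_seq (wp_ite ?_ ?_)
    · intro ht
      simp only [BExp.holds, NExp.eval, RExp.eval, n0, n1, r2, hwi, hb, ht1, hj1,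
        Nat.cast_zero] at ht
      refine wp_seq (wp_setR ?_)
      simp only [NExp.eval, RExp.eval, n0, n1, r1, r2, basicCol, hwi, hb, ht1, hj1, hl1]
      refine wp_seq (wp_ite ?_ ?_)
      · intro ht'
        simp [hn1] at ht'
        refine wp_seq (wp_setR (wp_seq (wp_setN (wp_skip (wp_skip (wp_skip ⟨Or.inr ?_, ?_⟩))))))
        · simp [hwi]
          refine ⟨by omega, ht.1, ht.2, ?_⟩
          intro w hw hbw hpw
          rcases Nat.lt_succ_iff_lt_or_eq.1 (Nat.lt_succ_iff.2 hw) with h | rfl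
          · rcases hI with ⟨-, h2⟩ | ⟨h1, -, -, -, h2⟩
            · exact absurd hpw (h2 w h hbw)
            · rcases ht' with h3 | h3
              · omega
              · exact h3.le.trans (h2 w h hbw hpw)
          · exact le_rfl
        · simp
      · intro ht'
        simp [hn1] at ht'
        refine wp_skip (wp_skip (wp_skip ⟨Or.inr ?_, by simp⟩))
        simp
        rcases hI with ⟨h1, -⟩ | ⟨h1, h2, h3, h4, h5⟩
        · omega
        · refine ⟨h1, h2, h3, h4, ?_⟩
          intro w hw hbw hpw
          rcases Nat.lt_succ_iff_lt_or_eq.1 (Nat.lt_succ_iff.2 hw) with h | rfl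
          · exact h5 w h hbw hpw
          · exact ht'.2
    · intro ht
      simp only [BExp.holds, NExp.eval, RExp.eval, n0, n1, r2, hwi, hb, ht1, hj1,
        Nat.cast_zero] at ht
      refine wp_skip (wp_skip ⟨?_, by simp⟩)
      simp only [ne_eq, reduceCtorEq, not_false_eq_true, Mem.nat_setN_of_ne, Mem.real_setN]
      refine hI.imp ?_ ?_
      · rintro ⟨h1, h2⟩
        refine ⟨h1, ?_⟩
        intro w hw hbw hpw
        rcases Nat.lt_succ_iff_lt_or_eq.1 hw with h | rfl
        · exact h2 w h hbw hpw
        · exact ht ⟨hbw, hpw⟩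
      · rintro ⟨h1, h2, h3, h4, h5⟩
        refine ⟨h1, h2, h3, h4, ?_⟩
        intro w hw hbw hpw
        rcases Nat.lt_succ_iff_lt_or_eq.1 hw with h | rfl
        · exact h5 w h hbw hpw
        · exact absurd ⟨hbw, hpw⟩ ht
  · rintro s1 m1 hF ⟨hI, -, hm⟩
    refine ⟨?_, by simp at hm; omega⟩
    rcases hI with ⟨-, h2⟩ | ⟨h1, h2, h3, h4, h5⟩
    · obtain ⟨w, hw, hbw, hpw⟩ := hpos
      exact absurd hpw (h2 w (by omega) hbw)
    · exact ⟨h1, h2, h3, h4, fun w hw => h5 w (by omega)⟩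

/-- The loop over the rows adds up precisely the terms of the sum that defines `basCoeff`; no
injectivity of `bas` is needed here. -/
theorem wp_updateLam {s : Mem} (hn : s.nat .n 0 0 = n) (hj : s.nat .j 0 0 = j) :
    wp O updateLam (fun s' m => (∀ c, s'.real .lam c 0 = s.real .lam c 0 -
        s.real .theta 0 0 * basCoeff n j (s.real .tab) (s.nat .bas) c) ∧
        m ≤ n * 120 + 200) s := by
  refine wp_mono (wp_forTo (n + 1) 80 (fun i s' => ∀ c, s'.real .lam c 0 = s.real .lam c 0 -
      s.real .theta 0 0 * ∑ w ∈ range i, if s.nat .bas w 0 = c + 1 then s.real .tab w j else 0)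
      rfl ?_ ?_ ?_) ?_
  · intro s' hF; simp [hF.nat .n rfl, hn]
  · simp
  · rintro i hi s1 hF hwi hI
    have hb : s1.nat .bas = s.nat .bas := hF.nat .bas rfl
    have ht1 : s1.real .tab = s.real .tab := hF.real .tab rfl
    have hθ1 : s1.real .theta = s.real .theta := hF.real .theta rfl
    have hj1 : s1.nat .j 0 0 = j := by rw [hF.nat .j rfl, hj]
    simp only [block, ifThen, setR1]
    refine wp_seq (wp_ite ?_ ?_)
    · intro ht
      simp only [BExp.holds, NExp.eval, n0, n1, hwi, hb] at ht
      obtain ⟨b, hbi⟩ : ∃ b, s.nat .bas i 0 = b + 1 := ⟨s.nat .bas i 0 - 1, by omega⟩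
      refine wp_seq (wp_setR (wp_skip (wp_skip ?_)))
      simp [basicCol, hwi, hb, ht1, hθ1, hj1, hbi]
      intro c
      rw [sum_range_succ, hI, hI, hbi]
      by_cases e : c = b
      · subst e; simp; ring
      · have : b ≠ c := Ne.symm e
        simp [e, this]
    · intro ht
      simp only [BExp.holds, NExp.eval, n0, n1, hwi, hb, not_not] at ht
      refine wp_skip (wp_skip ⟨?_, by simp⟩)
      intro c
      rw [sum_range_succ, ht]
      simpa using hI c
  · rintro s1 m1 hF ⟨hI, -, hm⟩
    exact ⟨hI, by simp at hm; omega⟩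

/-- An independent column finds a free row; a dependent one frees a row by the exchange. In both
cases the pivot then acts at a nonzero entry of a row without basic column. -/
theorem wp_reduceStep {s : Mem} (hn : s.nat .n 0 0 = n) (hk : s.nat .k 0 0 = k)
    (hj : s.nat .j 0 0 = j) (hjk : j < k) (hone : ∀ c, orig n c = 1)
    (hT : Tab n k j orig lam0 (s.real .lam) (s.real .tab) (s.nat .bas) (s.nat .keep)) :
    wp O (block reduceStep) (fun s' m =>
      Tab n k (j + 1) orig lam0 (s'.real .lam) (s'.real .tab) (s'.nat .bas) (s'.nat .keep) ∧
      m ≤ k * 60 + (n + 1) * (k * 60 + 100) + n * 380 + 1200) s := by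
  simp only [reduceStep, block, setN0, setN1, ifThen, setR1]
  refine wp_seq (wp_setN (wp_seq ?_))
  simp only [NExp.eval, n0, hn]
  refine wp_mono (wp_findRow (n := n) (j := j) (by simpa using hn) (by simpa using hj)
    (by simp)) ?_
  rintro s1 m1 hF1 ⟨hcase, hm1⟩
  have hn1 : s1.nat .n 0 0 = n := by simp [hF1.nat .n rfl, hn]
  have hk1 : s1.nat .k 0 0 = k := by simp [hF1.nat .k rfl, hk]
  have hj1 : s1.nat .j 0 0 = j := by simp [hF1.nat .j rfl, hj]
  have hb1 : s1.nat .bas = s.nat .bas := by simp [hF1.nat .bas rfl]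
  have hp1 : s1.nat .keep = s.nat .keep := by simp [hF1.nat .keep rfl]
  have ht1 : s1.real .tab = s.real .tab := by simp [hF1.real .tab rfl]
  have hl1 : s1.real .lam = s.real .lam := by simp [hF1.real .lam rfl]
  simp only [ne_eq, reduceCtorEq, not_false_eq_true, Mem.nat_setN_of_ne, Mem.real_setN] at hcase
  -- The state after the change of the coefficients.
  suffices H : wp O (.ite (.neq (.rd .r (.lit 0) (.lit 0)) (.succ (.rd .n (.lit 0) (.lit 0))))
      (.seq ratioTest (.seq updateLam
        (.seq (.setR .lam (.rd .j (.lit 0) (.lit 0)) (.lit 0)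
          (.add (r1 .lam (.rd .j (.lit 0) (.lit 0))) (r0 .theta)))
        (.seq (.setN .keep (.pred (n1 .bas (.rd .r (.lit 0) (.lit 0)))) (.lit 0) (.lit 0))
          .skip)))) .skip)
      (fun s2 m2 => s2.nat .n 0 0 = n ∧ s2.nat .k 0 0 = k ∧ s2.nat .j 0 0 = j ∧
        ∃ r ≤ n, s2.nat .r 0 0 = r ∧ s2.real .tab r j ≠ 0 ∧
        Tab n k j orig lam0 (s2.real .lam) (s2.real .tab) (upd (s2.nat .bas) r 0 0)
          (s2.nat .keep) ∧ m2 ≤ n * 260 + 600) s1 by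
    refine wp_seq (wp_mono H ?_)
    rintro s2 m2 - ⟨hn2, hk2, hj2, r, hr, hr2, htr, hT2, hm2⟩
    refine wp_seq (wp_mono (wp_pivot hn2 hk2 hr2 hj2 hjk) ?_)
    rintro s3 m3 hF3 ⟨h1, h2, hm3⟩
    have hr3 : s3.nat .r 0 0 = r := by rw [hF3.nat .r rfl, hr2]
    have hj3 : s3.nat .j 0 0 = j := by rw [hF3.nat .j rfl, hj2]
    refine wp_seq (wp_setN (wp_seq (wp_setN (wp_skip ?_))))
    have hT3 := hT2.pivot hr hjk (by simp) htr h1 h2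
    simp only [NExp.eval, hr3, hj3, Mem.real_setN, ne_eq, reduceCtorEq, not_false_eq_true,
      Mem.nat_setN_of_ne, Mem.nat_setN_self]
    rw [hF3.real .lam rfl, hF3.nat .bas rfl, hF3.nat .keep rfl]
    refine ⟨?_, ?_⟩
    · convert hT3 using 1
      funext a b
      simp only [upd_apply]
      split_ifs <;> rfl
    · simp only [NExp.cost]
      omega
  refine wp_ite ?_ ?_
  · intro ht
    simp only [BExp.holds, NExp.eval, hn1] at ht
    have h0 : ∀ w ≤ n, s.nat .bas w 0 = 0 → s.real .tab w j = 0 := by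
      rcases hcase with ⟨-, h⟩ | ⟨h, -⟩
      · exact h
      · omega
    have hpos := hT.exists_pos hjk h0 hone
    refine wp_seq (wp_mono (wp_ratioTest hn1 hj1 ht (by rwa [hb1, ht1])) ?_)
    rintro s2 m2 hF2 ⟨⟨h1, h2, h3, h4, h5⟩, hm2⟩
    simp only [hb1, ht1, hl1] at h2 h3 h4 h5
    have hn2 : s2.nat .n 0 0 = n := by rw [hF2.nat .n rfl, hn1]
    have hj2 : s2.nat .j 0 0 = j := by rw [hF2.nat .j rfl, hj1]
    refine wp_seq (wp_mono (wp_updateLam hn2 hj2) ?_)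
    rintro s3 m3 hF3 ⟨h6, hm3⟩
    rw [hF2.real .lam rfl, hF2.real .tab rfl, hF2.nat .bas rfl, hb1, ht1, hl1] at h6
    set r := s2.nat .r 0 0 with hr
    set θ := s2.real .theta 0 0 with hθ
    obtain ⟨b, hb⟩ : ∃ b, s.nat .bas r 0 = b + 1 := ⟨s.nat .bas r 0 - 1, by omega⟩
    have hj3 : s3.nat .j 0 0 = j := by rw [hF3.nat .j rfl, hj2]
    have hr3 : s3.nat .r 0 0 = r := by rw [hF3.nat .r rfl]
    have hθ3 : s3.real .theta 0 0 = θ := by rw [hF3.real .theta rfl]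
    have hb3 : s3.nat .bas = s.nat .bas := by rw [hF3.nat .bas rfl, hF2.nat .bas rfl, hb1]
    have ht3 : s3.real .tab = s.real .tab := by rw [hF3.real .tab rfl, hF2.real .tab rfl, ht1]
    have hp3 : s3.nat .keep = s.nat .keep := by rw [hF3.nat .keep rfl, hF2.nat .keep rfl, hp1]
    refine wp_seq (wp_setR (wp_seq (wp_setN (wp_skip ?_))))
    simp only [NExp.eval, RExp.eval, n1, r1, r0, hj3, hr3, hθ3, hb3, hb, Nat.add_sub_cancel,
      Mem.nat_setR, Mem.real_setN, Mem.nat_setN_self, Mem.real_setR_self, ne_eq, reduceCtorEq,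
      not_false_eq_true, Mem.nat_setN_of_ne, Mem.real_setR_of_ne]
    refine ⟨?_, ?_, trivial, r, h1, rfl, ?_, ?_, ?_⟩
    · rw [hF3.nat .n rfl, hn2]
    · rw [hF3.nat .k rfl, hF2.nat .k rfl, hk1]
    · rw [ht3]; exact h3.ne'
    · rw [ht3, hp3]
      refine hT.exchange (θ := θ) hjk h0 h1 hb h3 ?_ ?_ ?_
      · rw [hb] at h4; exact h4
      · intro w hw c hc hpw
        have := h5 w hw (by omega) hpw
        rw [hc] at this
        exact this
      · intro c hc
        simp only [upd_apply, and_true]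
        split_ifs with e
        · rw [h6, e]
        · rw [h6, add_zero]
    · simp only [BExp.cost, NExp.cost, RExp.cost]
      omega
  · intro ht
    simp only [BExp.holds, NExp.eval, hn1] at ht
    rcases hcase with ⟨h, -⟩ | ⟨h1, h2, h3⟩
    · exact absurd h ht
    · refine wp_skip ⟨hn1, hk1, hj1, _, h1, rfl, ?_, ?_, ?_⟩
      · rwa [ht1]
      · rw [hl1, ht1, hb1, hp1]
        convert hT using 1
        funext a b
        simp only [upd_apply]
        split_ifs with e
        · rw [e.1, e.2, h2]
        · rfl
      · simp only [BExp.cost, NExp.cost]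
        omega

end

end SFM

/-! ### Set-up of the tableau, renumbering, and the complete reduction -/

namespace SFM

open Finset

section

variable {O : Set ℕ → ℝ} {n k : ℕ}

/-- The tableau with the columns `(y_i, 1)`. -/
def origTab (n : ℕ) (y : ℕ → ℕ → ℝ) (w c : ℕ) : ℝ := if w = n then 1 else y c w

/-- Set up of the tableau. -/
def reduceInit : List Cmd := [
  forTo .c (n0 .k) [
    forTo .w (n0 .n) [
      setR2 .tab (n0 .w) (n0 .c) (r2 .y (n0 .c) (n0 .w))],
    setR2 .tab (n0 .n) (n0 .c) (.lit 1),
    setN1 .keep (n0 .c) (.lit 0)],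
  forTo .w (.succ (n0 .n)) [setN1 .bas (n0 .w) (.lit 0)]]

/-- Renumbering. -/
def compress : List Cmd := [
  setN0 .kk (.lit 0),
  forTo .c (n0 .k) [
    ifThen (.and (.neq (n1 .keep (n0 .c)) (.lit 1)) (.rlt (.lit 0) (r1 .lam (n0 .c)))) [
      setR1 .lam (n0 .kk) (r1 .lam (n0 .c)),
      forTo .w (n0 .n) [
        setR2 .y (n0 .kk) (n0 .w) (r2 .y (n0 .c) (n0 .w)),
        setN2 .L (n0 .kk) (n0 .w) (n2 .L (n0 .c) (n0 .w))],
      inc .kk]],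
  setN0 .k (n0 .kk)]

theorem wp_reduceInit {s : Mem} (hn : s.nat .n 0 0 = n) (hk : s.nat .k 0 0 = k)
    (hlam : ∀ c < k, 0 ≤ s.real .lam c 0) :
    wp O (block reduceInit) (fun s' m => Tab n k 0 (origTab n (s.real .y)) (s.real .lam)
      (s'.real .lam) (s'.real .tab) (s'.nat .bas) (s'.nat .keep) ∧
      m ≤ k * (n * 60 + 100) + n * 60 + 100) s := by
  simp only [reduceInit, block]
  refine wp_seq (wp_mono (wp_forTo k (n * 60 + 70) (fun i s' => ∀ c < i, ∀ w ≤ n,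
    s'.real .tab w c = origTab n (s.real .y) w c) rfl ?_ ?_ ?_) ?_)
  · intro s' hF; simp [hF.nat .k rfl, hk]
  · simp
  · rintro i hi s1 hF1 hci hI
    have hn1 : s1.nat .n 0 0 = n := by rw [hF1.nat .n rfl, hn]
    have hy1 : s1.real .y = s.real .y := hF1.real .y rfl
    simp only [block, setN1, setR2]
    refine wp_seq (wp_mono (wp_forTo n 40 (fun p s' => (∀ c < i, ∀ w ≤ n,
      s'.real .tab w c = origTab n (s.real .y) w c) ∧
      ∀ w < p, s'.real .tab w i = s.real .y i w) rfl ?_ ?_ ?_) ?_)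
    · intro s' hF; simp [hF.nat .n rfl, hn1]
    · simpa using hI
    · rintro p hp s2 hF2 hwp ⟨h1, h2⟩
      have hc2 : s2.nat .c 0 0 = i := by rw [hF2.nat .c rfl, hci]
      have hy2 : s2.real .y = s.real .y := by rw [hF2.real .y rfl, hy1]
      simp only [block]
      refine wp_seq (wp_setR (wp_skip ?_))
      simp [hwp, hc2, hy2]
      refine ⟨?_, ?_⟩
      · intro c hc w hw
        rw [if_neg (by omega)]
        exact h1 c hc w hw
      · intro w hw
        split_ifs with e
        · rw [e]
        · exact h2 w (by omega)
    · rintro s2 m2 hF2 ⟨⟨h1, h2⟩, -, hm2⟩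
      have hc2 : s2.nat .c 0 0 = i := by rw [hF2.nat .c rfl, hci]
      have hn2 : s2.nat .n 0 0 = n := by rw [hF2.nat .n rfl, hn1]
      refine wp_seq (wp_setR (wp_seq (wp_setN (wp_skip ?_))))
      simp [hc2, hn2] at hm2 ⊢
      refine ⟨?_, by omega⟩
      intro c hc w hw
      by_cases e : c = i
      · subst e
        by_cases e' : w = n
        · simp [e', origTab]
        · simp [e', origTab, h2 w (by omega)]
      · simp only [e, and_false, if_false]
        exact h1 c (by omega) w hw
  rintro s1 m1 hF1 ⟨h1, -, hm1⟩
  have hn1 : s1.nat .n 0 0 = n := by rw [hF1.nat .n rfl, hn]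
  refine wp_seq (wp_mono (wp_forTo (n + 1) 20 (fun i s' => ∀ w < i, s'.nat .bas w 0 = 0)
    rfl ?_ ?_ ?_) ?_)
  · intro s' hF; simp [hF.nat .n rfl, hn1]
  · simp
  · rintro i hi s2 hF2 hwi hI
    simp only [block, setN1]
    refine wp_seq (wp_setN (wp_skip ?_))
    simp [hwi]
    intro w hw hne
    exact hI w (by omega)
  · rintro s2 m2 hF2 ⟨h2, -, hm2⟩
    refine wp_skip ⟨?_, ?_⟩
    · rw [hF2.real .lam rfl, hF1.real .lam rfl, hF2.real .tab rfl]
      have hb : ∀ w ≤ n, s2.nat .bas w 0 = 0 := fun w hw => h2 w (by omega)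
      refine ⟨?_, fun w hw => (hb w hw).le, ?_, ?_, fun c hc => by omega, fun c hc => by omega,
        hlam, fun _ _ => rfl⟩
      · intro a ha w hw
        rw [← ha w hw]
        refine sum_congr rfl fun c hc => ?_
        rw [h1 c (mem_range.1 hc) w hw]
      · intro w hw c hc; rw [hb w hw] at hc; omega
      · intro w hw c hc; rw [hb w hw] at hc; omega
    · simp at hm1 hm2 ⊢
      nlinarith

/-- The number of the columns that are kept is at most the number of rows. -/
theorem Tab.card_keep_le {orig lam0 lam tab : ℕ → ℕ → ℝ} {bas keep : ℕ → ℕ → ℕ}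
    (h : Tab n k k orig lam0 lam tab bas keep) :
    ((range k).filter (fun c => keep c 0 = 1)).card ≤ n + 1 := by
  have hex : ∀ c ∈ (range k).filter (fun c => keep c 0 = 1), ∃ w, w ≤ n ∧ bas w 0 = c + 1 := by
    intro c hc
    rw [mem_filter, mem_range] at hc
    exact h.keep_bas c hc.1 hc.2
  choose! ρ hρ using hex
  have := card_le_card_of_injOn (t := range (n + 1)) ρ
    (fun c hc => by simpa using Nat.lt_succ_iff.2 (hρ c hc).1) (fun c hc c' hc' e => by
      have h1 := (hρ c hc).2
      have h2 := (hρ c' hc').2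
      rw [e] at h1
      omega)
  simpa using this

/-- Every column that is dropped has coefficient 0, being either not kept or kept with λ = 0, so
neither the sum of the coefficients nor x changes. -/
theorem wp_compress {s : Mem} (hn : s.nat .n 0 0 = n) (hk : s.nat .k 0 0 = k)
    (hext : ∀ c < k, IsExt O n (s.nat .L c) (s.real .y c))
    (hlam : ∀ c < k, 0 ≤ s.real .lam c 0)
    (hkeep : ∀ c < k, s.nat .keep c 0 ≠ 1 → s.real .lam c 0 = 0) :
    wp O (block compress) (fun s' m =>
      s'.nat .k 0 0 ≤ ((range k).filter (fun c => s.nat .keep c 0 = 1)).card ∧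
      (∀ i < s'.nat .k 0 0, IsExt O n (s'.nat .L i) (s'.real .y i)) ∧
      (∀ i < s'.nat .k 0 0, 0 ≤ s'.real .lam i 0) ∧
      (∑ i ∈ range (s'.nat .k 0 0), s'.real .lam i 0 = ∑ c ∈ range k, s.real .lam c 0) ∧
      (∀ v < n, ∑ i ∈ range (s'.nat .k 0 0), s'.real .lam i 0 * s'.real .y i v =
        ∑ c ∈ range k, s.real .lam c 0 * s.real .y c v) ∧
      m ≤ k * (n * 100 + 200) + 100) s := by
  simp only [compress, block, setN0, ifThen, setR1]
  refine wp_seq (wp_setN (wp_seq ?_))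
  -- The renumbering is done in place. Because `kk` never exceeds c, the rows from c on are still
  -- the original ones when they are read.
  refine wp_mono (wp_forTo k (n * 100 + 150) (fun c s' =>
      s'.nat .kk 0 0 ≤ c ∧
      s'.nat .kk 0 0 ≤ ((range c).filter (fun c => s.nat .keep c 0 = 1)).card ∧
      (∀ i < s'.nat .kk 0 0, IsExt O n (s'.nat .L i) (s'.real .y i)) ∧
      (∀ i < s'.nat .kk 0 0, 0 ≤ s'.real .lam i 0) ∧
      (∑ i ∈ range (s'.nat .kk 0 0), s'.real .lam i 0 = ∑ c ∈ range c, s.real .lam c 0) ∧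
      (∀ v < n, ∑ i ∈ range (s'.nat .kk 0 0), s'.real .lam i 0 * s'.real .y i v =
        ∑ c ∈ range c, s.real .lam c 0 * s.real .y c v) ∧
      (∀ i, c ≤ i → s'.real .lam i 0 = s.real .lam i 0 ∧ s'.real .y i = s.real .y i ∧
        s'.nat .L i = s.nat .L i)) rfl ?_ ?_ ?_) ?_
  · intro s' hF; simp [hF.nat .k rfl, hk]
  · simp
  · rintro c hc s1 hF1 hcc ⟨h1, h2, h3, h4, h5, h6, h7⟩
    have hp1 : s1.nat .keep = s.nat .keep := by simp [hF1.nat .keep rfl]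
    have hn1 : s1.nat .n 0 0 = n := by simp [hF1.nat .n rfl, hn]
    obtain ⟨h7l, h7y, h7L⟩ := h7 c le_rfl
    generalize hq : s1.nat .kk 0 0 = q at *
    refine wp_seq (wp_ite ?_ ?_)
    · intro ht
      simp [hcc, hp1, h7l] at ht
      refine wp_seq (wp_setR (wp_seq ?_))
      simp only [NExp.eval, RExp.eval, n0, r1, hcc, hq, h7l]
      refine wp_mono (wp_forTo n 80 (fun p s' =>
        (∀ i, i ≠ q → s'.real .y i = s1.real .y i ∧ s'.nat .L i = s1.nat .L i) ∧
        (∀ w < p, s'.real .y q w = s.real .y c w ∧ s'.nat .L q w = s.nat .L c w) ∧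
        (∀ w, p ≤ w → s'.real .y q w = s1.real .y q w ∧ s'.nat .L q w = s1.nat .L q w))
        rfl ?_ ?_ ?_) ?_
      · intro s' hF; simp [hF.nat .n rfl, hn1]
      · simp
      · rintro p hp s2 hF2 hwp ⟨h8, h9, h10⟩
        have hc2 : s2.nat .c 0 0 = c := by simp [hF2.nat .c rfl, hcc]
        have hq2 : s2.nat .kk 0 0 = q := by simp [hF2.nat .kk rfl, hq]
        -- If c equals the target index, the row is copied onto itself; the entries from p on are
        -- unchanged, which is enough.
        have hyc : s2.real .y c p = s.real .y c p := by
          by_cases e : c = q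
          · rw [e, (h10 p le_rfl).1, ← e, h7y]
          · rw [(h8 c e).1, h7y]
        have hLc : s2.nat .L c p = s.nat .L c p := by
          by_cases e : c = q
          · rw [e, (h10 p le_rfl).2, ← e, h7L]
          · rw [(h8 c e).2, h7L]
        simp only [block, setR2, setN2]
        refine wp_seq (wp_setR (wp_seq (wp_setN (wp_skip ?_))))
        simp [hc2, hq2, hwp, hyc, hLc]
        refine ⟨?_, ?_, ?_⟩
        · intro i hi
          constructor
          · rw [← (h8 i hi).1]; funext w; simp [hi]
          · rw [← (h8 i hi).2]; funext w; simp [hi]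
        · intro w hw
          by_cases e : w = p
          · simp [e]
          · simpa [e] using h9 w (by omega)
        · intro w hw
          rw [if_neg (by omega), if_neg (by omega)]
          exact h10 w (by omega)
      · rintro s2 m2 hF2 ⟨⟨h8, h9, -⟩, -, hm2⟩
        have hq2 : s2.nat .kk 0 0 = q := by simp [hF2.nat .kk rfl, hq]
        have hl2 : s2.real .lam = upd (s1.real .lam) q 0 (s.real .lam c 0) := by
          simp [hF2.real .lam rfl]
        simp only [inc, setN0]
        refine wp_seq (wp_setN (wp_skip (wp_skip ?_)))
        simp only [NExp.eval, n0, hq2, ne_eq, reduceCtorEq, not_false_eq_true, Mem.nat_setN_of_ne,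
          Mem.nat_setN_self, upd_apply, and_self, if_true, Mem.real_setN, hl2]
        -- Applied to g = 1 for the sum of the coefficients and to the evaluation at v for the
        -- coordinates of x.
        have hkey : ∀ g : (ℕ → ℝ) → ℝ, g (s2.real .y q) = g (s.real .y c) →
            ∑ i ∈ range (q + 1), (if i = q ∧ True then s.real .lam c 0 else
              s1.real .lam i 0) * g (s2.real .y i) =
            ∑ i ∈ range q, s1.real .lam i 0 * g (s1.real .y i) +
              s.real .lam c 0 * g (s.real .y c) := by
          intro g hg
          rw [sum_range_succ, hg]
          congr 1
          · refine sum_congr rfl fun i hi => ?_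
            have hi := mem_range.1 hi
            rw [if_neg (by omega), (h8 i (by omega)).1]
          · simp
        refine ⟨⟨by omega, ?_, ?_, ?_, ?_, ?_, ?_⟩, ?_⟩
        · rw [range_add_one, filter_insert, if_pos ht.1, card_insert_of_notMem (by simp)]
          omega
        · intro i hi
          rcases Nat.lt_succ_iff_lt_or_eq.1 hi with h | rfl
          · rw [(h8 i (by omega)).1, (h8 i (by omega)).2]
            exact h3 i h
          · exact (hext c hc).congr (fun w hw => (h9 w hw).2) (fun w hw => (h9 w hw).1)
        · intro i hi
          by_cases e : i = q
          · simpa [e] using ht.2.le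
          · simpa [e] using h4 i (by omega)
        · have := hkey (fun _ => 1) rfl
          simp only [mul_one] at this
          rw [this, h5, sum_range_succ]
        · intro v hv
          rw [hkey (fun z => z v) (h9 v hv).1, h6 v hv, sum_range_succ]
        · intro i hi
          have hne : i ≠ q := by omega
          obtain ⟨e1, e2, e3⟩ := h7 i (by omega)
          exact ⟨by simp [hne, e1], by rw [(h8 i hne).1, e2], by rw [(h8 i hne).2, e3]⟩
        · simp at hm2 ⊢; omega
    · intro ht
      have hl0 : s.real .lam c 0 = 0 := by
        by_cases e : s.nat .keep c 0 = 1
        · have : ¬ 0 < s.real .lam c 0 := fun h => ht (by simp [hcc, hp1, h7l, e, h])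
          exact le_antisymm (not_lt.1 this) (hlam c hc)
        · exact hkeep c hc e
      refine wp_skip (wp_skip ?_)
      simp only [ne_eq, reduceCtorEq, not_false_eq_true, Mem.nat_setN_of_ne, Mem.real_setN, hq]
      refine ⟨⟨by omega, ?_, h3, h4, ?_, ?_, fun i hi => h7 i (by omega)⟩, ?_⟩
      · refine h2.trans (card_le_card (filter_subset_filter _ (range_mono (by omega))))
      · rw [h5, sum_range_succ, hl0, add_zero]
      · intro v hv
        rw [h6 v hv, sum_range_succ, hl0, zero_mul, add_zero]
      · simp
  · rintro s1 m1 hF1 ⟨⟨h1, h2, h3, h4, h5, h6, -⟩, -, hm1⟩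
    refine wp_seq (wp_setN (wp_skip ?_))
    simp at hm1 ⊢
    refine ⟨h2, h3, h4, h5, h6, ?_⟩
    nlinarith

/-- There are O(n) columns, each pivot costs O(n²), and the kept columns inject into the n + 1 rows.
Row n of the preserved sums gives ∑ λ_i = 1, the other rows give x. For the running time only the
bound n + 1 on the number of orderings is needed. -/
theorem wp_reduce {s : Mem} (hn : s.nat .n 0 0 = n) (hn1 : 1 ≤ n)
    (hk : s.nat .k 0 0 ≤ 2 * n + 1)
    (hB : Base O n (s.nat .k 0 0) (s.nat .L) (s.real .y) (s.real .lam) (s.real .x)) :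
    wp O reduce (fun s' m => s'.nat .k 0 0 ≤ n + 1 ∧
      Base O n (s'.nat .k 0 0) (s'.nat .L) (s'.real .y) (s'.real .lam) (s'.real .x) ∧
      m ≤ 10000 * (n * (n * n))) s := by
  generalize hkk : s.nat .k 0 0 = k at *
  have hred : reduce = block (reduceInit ++ (forTo .j (n0 .k) reduceStep :: compress)) := rfl
  rw [hred]
  refine wp_block_append (wp_mono (wp_reduceInit hn hkk hB.nonneg) ?_)
  rintro s1 m1 hF1 ⟨hT1, hm1⟩
  have hn1' : s1.nat .n 0 0 = n := by rw [hF1.nat .n rfl, hn]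
  have hk1 : s1.nat .k 0 0 = k := by rw [hF1.nat .k rfl, hkk]
  refine wp_seq (wp_mono (wp_forTo k (k * 60 + (n + 1) * (k * 60 + 100) + n * 380 + 1200)
    (fun j s' => Tab n k j (origTab n (s.real .y)) (s.real .lam)
      (s'.real .lam) (s'.real .tab) (s'.nat .bas) (s'.nat .keep)) rfl ?_ ?_ ?_) ?_)
  · intro s' hF; simp [hF.nat .k rfl, hk1]
  · simpa using hT1
  · rintro j hj s2 hF2 hjj hI
    refine wp_mono (wp_reduceStep (n := n) (k := k) ?_ ?_ hjj hj ?_ hI) ?_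
    · rw [hF2.nat .n rfl, hn1']
    · rw [hF2.nat .k rfl, hk1]
    · intro c; simp [origTab]
    · rintro s3 m3 hF3 ⟨h, hm⟩
      exact ⟨by simpa using h, hm⟩
  rintro s2 m2 hF2 ⟨hT2, -, hm2⟩
  have hL2 : s2.nat .L = s.nat .L := by rw [hF2.nat .L rfl, hF1.nat .L rfl]
  have hy2 : s2.real .y = s.real .y := by rw [hF2.real .y rfl, hF1.real .y rfl]
  refine wp_mono (wp_compress (n := n) (k := k) ?_ ?_ ?_ hT2.nonneg hT2.keep_zero) ?_
  · rw [hF2.nat .n rfl, hn1']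
  · rw [hF2.nat .k rfl, hk1]
  · rw [hL2, hy2]; exact hB.ext
  rintro s3 m3 hF3 ⟨h1, h2, h3, h4, h5, hm3⟩
  have hx3 : s3.real .x = s.real .x := by
    rw [hF3.real .x rfl, hF2.real .x rfl, hF1.real .x rfl]
  refine ⟨h1.trans hT2.card_keep_le, ⟨h2, h3, ?_, ?_⟩, ?_⟩
  · rw [h4, ← hB.sum_one]
    have := hT2.sum n le_rfl
    simpa [origTab] using this
  · intro v hv
    rw [h5 v hv, hx3, hB.x_eq v hv, hy2]
    have := hT2.sum v hv.le
    simpa [origTab, hv.ne] using this.symm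
  · have hk3 : k ≤ 3 * n := by omega
    have hnn : n ≤ n * n := Nat.le_mul_of_pos_left n hn1
    have hnn2 : n * n ≤ n * (n * n) := Nat.le_mul_of_pos_left _ hn1
    have hkn : k * n ≤ 3 * (n * n) := (Nat.mul_le_mul_right n hk3).trans (by ring_nf; omega)
    have hkk2 : k * k ≤ 9 * (n * n) := (Nat.mul_le_mul hk3 hk3).trans (by ring_nf; omega)
    have hkkn : k * k * n ≤ 9 * (n * (n * n)) :=
      (Nat.mul_le_mul_right n hkk2).trans (by ring_nf; omega)
    simp at hm2
    ring_nf at hm1 hm2 hm3 hkn hkk2 hkkn hnn hnn2 ⊢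
    omega

end

end SFM

namespace SFM

open Finset

/-! ## The initial extreme base and the start of a phase -/

variable {O : Set ℕ → ℝ} {n : ℕ} {M : ℝ}

/-- The state of the greedy algorithm after `v` vertices. -/
structure Greedy (O : Set ℕ → ℝ) (n v : ℕ) (s : Mem) : Prop where
  L : ∀ q < v, s.nat .L 0 q = q
  y : ∀ q < v, s.real .y 0 q = O (Set.Iio (q + 1)) - O (Set.Iio q)
  x : ∀ q < v, s.real .x q 0 = s.real .y 0 q
  phi : ∀ q < v, ∀ w < n, s.real .phi q w = 0
  g : s.real .g 0 0 = O (Set.Iio v)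
  qry : ∀ w < n, s.nat .qry w 0 ≠ 0 ↔ w < v

theorem wp_clearPhi {s : Mem} (hn : s.nat .n 0 0 = n) :
    wp O (forTo .w (n0 .n) [setR2 .phi (n0 .v) (n0 .w) (.lit 0)]) (fun s' m =>
      (∀ w < n, s'.real .phi (s.nat .v 0 0) w = 0) ∧
      (∀ q, q ≠ s.nat .v 0 0 → s'.real .phi q = s.real .phi q) ∧ m ≤ n * 50 + 20) s := by
  refine wp_mono (wp_forTo n 20 (fun i s' => (∀ w < i, s'.real .phi (s.nat .v 0 0) w = 0) ∧
    ∀ q, q ≠ s.nat .v 0 0 → s'.real .phi q = s.real .phi q) rfl ?_ ?_ ?_) ?_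
  · intro s' hF; simp [hF.nat .n rfl, hn]
  · simp
  · rintro w hw s1 hF hww ⟨h1, h2⟩
    simp only [block, setR2]
    refine wp_seq (wp_setR (wp_skip ?_))
    simp only [n0, NExp.eval, RExp.eval, hF.nat .v rfl, hww, Mem.real_setN, Mem.real_setR_self]
    refine ⟨⟨?_, ?_⟩, by simp⟩
    · intro w' hw'
      rcases Nat.lt_succ_iff_lt_or_eq.1 hw' with h | rfl
      · simp [h.ne, h1 w' h]
      · simp
    · intro q hq
      funext w'
      simp [hq, h2 q hq]
  · rintro s1 m1 hF ⟨⟨h1, h2⟩, -, hm⟩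
    refine ⟨h1, h2, ?_⟩
    simp at hm; omega

theorem wp_greedyStep (hO : IsOracle O n M) {s : Mem} {v : ℕ} (hn : s.nat .n 0 0 = n)
    (hv : s.nat .v 0 0 = v) (h : Greedy O n v s) :
    wp O (block [
      setN2 .L (.lit 0) (n0 .v) (n0 .v),
      setN1 .qry (n0 .v) (.lit 1),
      query0 .h,
      setR2 .y (.lit 0) (n0 .v) (.sub (r0 .h) (r0 .g)),
      setR1 .x (n0 .v) (r2 .y (.lit 0) (n0 .v)),
      setR0 .g (r0 .h),
      forTo .w (n0 .n) [setR2 .phi (n0 .v) (n0 .w) (.lit 0)]])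
      (fun s' m => Greedy O n (v + 1) s' ∧ m ≤ n * 50 + 200) s := by
  simp only [block, setN2, setN1, query0, setR2, setR1, setR0]
  refine wp_seq (wp_setN (wp_seq (wp_setN (wp_seq (wp_query (wp_seq (wp_setR
    (wp_seq (wp_setR (wp_seq (wp_setR (wp_seq ?_))))))))))))
  have hquery : O (((s.setN .L 0 v v).setN .qry v 0 1).querySet) = O (Set.Iio (v + 1)) := by
    refine hO.congr fun m hm => ?_
    simp only [Mem.querySet, Set.mem_ofPred_eq, Mem.nat_setN_self, upd_apply, and_true,
      Set.mem_Iio]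
    by_cases e : m = v
    · simp [e]
    · simp only [e, if_false, ne_eq, reduceCtorEq, not_false_eq_true, Mem.nat_setN_of_ne]
      rw [← ne_eq, h.qry m hm]
      omega
  simp only [NExp.eval, RExp.eval, n0, r0, r2, hv, Mem.nat_setR, Mem.real_setN, ne_eq,
    reduceCtorEq, not_false_eq_true, Mem.nat_setN_of_ne, Mem.real_setR_self,
    Mem.real_setR_of_ne, upd_apply, and_self, if_true, hquery, h.g]
  refine wp_mono (wp_clearPhi (n := n) (by simp [hn])) ?_
  rintro s1 m1 hF ⟨h1, h2, hm1⟩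
  simp only [ne_eq, reduceCtorEq, not_false_eq_true, Mem.nat_setR, Mem.nat_setN_of_ne, hv,
    Mem.real_setR_of_ne, Mem.real_setN] at h1 h2
  refine wp_skip ⟨⟨?_, ?_, ?_, ?_, ?_, ?_⟩, ?_⟩
  · intro q hq
    rw [hF.nat .L rfl]
    by_cases e : q = v
    · simp [e]
    · simp [e, h.L q (by omega)]
  · intro q hq
    rw [hF.real .y rfl]
    by_cases e : q = v
    · simp [e]
    · simp [e, h.y q (by omega)]
  · intro q hq
    rw [hF.real .y rfl, hF.real .x rfl]
    by_cases e : q = v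
    · simp [e]
    · simp [e, h.x q (by omega)]
  · intro q hq w hw
    by_cases e : q = v
    · rw [e]; exact h1 w hw
    · rw [h2 q e]; exact h.phi q (by omega) w hw
  · rw [hF.real .g rfl]
    simp
  · intro w hw
    rw [hF.nat .qry rfl]
    by_cases e : w = v
    · simp [e]
    · simp [e]
      rw [← ne_eq, h.qry w hw]
      omega
  · simp; omega

theorem wp_setUp (hO : IsOracle O n M) {s : Mem} (hn : s.nat .n 0 0 = n) :
    wp O setUp (fun s' m =>
      Base O n 1 (s'.nat .L) (s'.real .y) (s'.real .lam) (s'.real .x) ∧ s'.nat .k 0 0 = 1 ∧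
      s'.real .delta 0 0 = s.real .M 0 0 ∧ (∀ v < n, ∀ w < n, s'.real .phi v w = 0) ∧
      (∀ v < n, |s'.real .x v 0| ≤ 2 * M) ∧ m ≤ 50 * (n * n) + 400 * n + 200) s := by
  simp only [setUp, block]
  refine wp_seq (wp_mono (wp_forTo n 20 (fun i s' => ∀ w < i, s'.nat .qry w 0 = 0) rfl ?_ ?_ ?_) ?_)
  · intro s' hF; simp [hF.nat .n rfl, hn]
  · simp
  · rintro w hw s1 hF hww h1
    simp only [block, setN1]
    refine wp_seq (wp_setN (wp_skip ⟨?_, by simp⟩))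
    intro w' hw'
    rcases Nat.lt_succ_iff_lt_or_eq.1 hw' with h | rfl
    · simp [hww, h.ne, h1 w' h]
    · simp [hww]
  rintro s1 m1 hF1 ⟨hq1, -, hm1⟩
  simp only [setR0]
  refine wp_seq (wp_setR (wp_seq (wp_mono (wp_forTo n (n * 50 + 200)
    (fun v s' => Greedy O n v s') rfl ?_ ?_ ?_) ?_)))
  · intro s' hF; simp [hF.nat .n rfl, hF1.nat .n rfl, hn]
  · refine ⟨by simp, by simp, by simp, by simp, ?_, ?_⟩
    · simp [hO.empty]
    · intro w hw; simp [hq1 w hw]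
  · rintro v hv s2 hF2 hvv h2
    refine wp_mono (wp_greedyStep hO ?_ hvv h2) ?_
    · simp [hF2.nat .n rfl, hF1.nat .n rfl, hn]
    · rintro s3 m3 hF3 ⟨h3, hm3⟩
      refine ⟨⟨by simpa using h3.L, by simpa using h3.y, by simpa using h3.x,
        by simpa using h3.phi, by simpa using h3.g, by simpa using h3.qry⟩, hm3⟩
  · rintro s2 m2 hF2 ⟨h2, -, hm2⟩
    simp only [setR1, setN0]
    refine wp_seq (wp_setR (wp_seq (wp_setN (wp_seq (wp_setR (wp_skip ?_))))))
    have hpre : ∀ p ≤ n, pre (s2.nat .L 0) p = Set.Iio p := by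
      intro p hp
      ext m
      constructor
      · rintro ⟨q, hq, rfl⟩
        rw [h2.L q (by omega)]; exact hq
      · intro hm
        exact ⟨m, hm, h2.L m (lt_of_lt_of_le hm hp)⟩
    refine ⟨⟨?_, ?_, ?_, ?_⟩, ?_, ?_, ?_, ?_, ?_⟩
    · intro i hi
      obtain rfl : i = 0 := by omega
      simp only [ne_eq, reduceCtorEq, not_false_eq_true, Mem.nat_setR, Mem.nat_setN_of_ne,
        Mem.real_setR_of_ne, Mem.real_setN]
      refine ⟨⟨?_, ?_⟩, ?_⟩
      · intro p hp; rwa [h2.L p hp]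
      · intro p hp q hq e; rwa [h2.L p hp, h2.L q hq] at e
      · intro p hp
        rw [hpre _ hp, hpre _ hp.le, h2.L p hp, h2.y p hp]
    · intro i hi
      obtain rfl : i = 0 := by omega
      simp
    · simp
    · intro v hv; simp [h2.x v hv]
    · simp
    · simp [hF2.real .M rfl, hF1.real .M rfl]
    · intro v hv w hw; simpa using h2.phi v hv w hw
    · intro v hv
      simp only [ne_eq, reduceCtorEq, not_false_eq_true, Mem.real_setR_of_ne, Mem.real_setN]
      rw [h2.x v hv, h2.y v hv]
      refine (abs_sub _ _).trans ?_
      linarith [hO.bound (Set.Iio (v + 1)), hO.bound (Set.Iio v)]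
    · simp at hm1 hm2 ⊢
      nlinarith

/-- The flow value nearest to `a` in `[-δ, δ]`. -/
noncomputable def clamp (δ a : ℝ) : ℝ := max (-δ) (min δ a)

theorem clamp_eq {δ : ℝ} (hδ : 0 ≤ δ) (a : ℝ) :
    clamp δ a = if δ < a then δ else if a < -δ then -δ else a := by
  unfold clamp
  split_ifs with h1 h2
  · rw [min_eq_left h1.le, max_eq_right (by linarith)]
  · rw [min_eq_right (by linarith), max_eq_left h2.le]
  · rw [min_eq_right (by linarith), max_eq_right (by linarith)]

theorem clamp_neg (δ a : ℝ) (hδ : 0 ≤ δ) : clamp δ (-a) = - clamp δ a := by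
  rw [clamp_eq hδ, clamp_eq hδ]
  split_ifs <;> linarith

theorem abs_clamp_sub_le {δ a : ℝ} (hδ : 0 ≤ δ) (h : |a| ≤ 2 * δ) : |clamp δ a - a| ≤ δ := by
  have := abs_le.1 h
  rw [clamp_eq hδ, abs_le]
  split_ifs <;> constructor <;> linarith

theorem wp_clip {s : Mem} {δ : ℝ} (hδ : 0 ≤ δ) (hn : s.nat .n 0 0 = n)
    (hd : s.real .delta 0 0 = δ) :
    wp O clip (fun s' m => (∀ v < n, ∀ w < n, s'.real .phi v w = clamp δ (s.real .phi v w)) ∧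
      m ≤ 120 * (n * n) + 60 * n + 20) s := by
  refine wp_mono (wp_forTo n (n * 120 + 20) (fun i s' =>
    (∀ v < i, ∀ w < n, s'.real .phi v w = clamp δ (s.real .phi v w)) ∧
    ∀ v, i ≤ v → s'.real .phi v = s.real .phi v) rfl ?_ ?_ ?_) ?_
  · intro s' hF; simp [hF.nat .n rfl, hn]
  · simp
  · rintro v hv s1 hF1 hvv ⟨h1, h2⟩
    simp only [block]
    refine wp_seq (wp_mono (wp_forTo n 100 (fun i s' =>
      (∀ w < i, s'.real .phi v w = clamp δ (s.real .phi v w)) ∧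
      (∀ w, i ≤ w → s'.real .phi v w = s.real .phi v w) ∧
      ∀ q, q ≠ v → s'.real .phi q = s1.real .phi q) rfl ?_ ?_ ?_) ?_)
    · intro s' hF; simp [hF.nat .n rfl, hF1.nat .n rfl, hn]
    · simp [h2 v le_rfl]
    · rintro w hw s2 hF2 hww ⟨h3, h4, h5⟩
      have hv2 : s2.nat .v 0 0 = v := by simp [hF2.nat .v rfl, hvv]
      have hd2 : s2.real .delta 0 0 = δ := by simp [hF2.real .delta rfl, hF1.real .delta rfl, hd]
      have h4w := h4 w le_rfl
      have hc := clamp_eq hδ (s.real .phi v w)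
      have main : ∀ s3 : Mem, s3.real .phi v w = clamp δ (s.real .phi v w) →
          (∀ q r, ¬(q = v ∧ r = w) → s3.real .phi q r = s2.real .phi q r) →
          (∀ w' < w + 1, s3.real .phi v w' = clamp δ (s.real .phi v w')) ∧
          (∀ w', w + 1 ≤ w' → s3.real .phi v w' = s.real .phi v w') ∧
          ∀ q, q ≠ v → s3.real .phi q = s1.real .phi q := by
        intro s3 e1 e2
        refine ⟨?_, ?_, ?_⟩
        · intro w' hw'
          rcases Nat.lt_succ_iff_lt_or_eq.1 hw' with h | rfl
          · rw [e2 _ _ (by omega), h3 w' h]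
          · exact e1
        · intro w' hw'
          rw [e2 _ _ (by omega), h4 w' (by omega)]
        · intro q hq
          funext r
          rw [e2 _ _ (by tauto), h5 q hq]
      simp only [block, ifThen, setR2]
      repeat' with_reducible
        first | apply wp_seq | apply wp_setR | apply wp_ite | apply wp_skip | intro
      all_goals
        simp only [BExp.holds, NExp.eval, RExp.eval, n0, r0, r2, hv2, hww, hd2, h4w,
          Mem.nat_setR, Mem.real_setR_self, upd_apply, and_self, if_true, Nat.cast_zero,
          zero_sub, ne_eq, reduceCtorEq, not_false_eq_true, Mem.real_setR_of_ne] at *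
        refine ⟨main _ ?_ ?_, by simp⟩
      · rename_i h h'; linarith
      · intro q r hqr; simp [hqr]
      · rename_i h h'; simp [hc, h]
      · intro q r hqr; simp [hqr]
      · rename_i h h'; simp [hc, h, h']
      · intro q r hqr; simp [hqr]
      · rename_i h h'; simp [hc, h, h', h4 w le_rfl]
      · intro q r hqr; simp
    · rintro s2 m2 hF2 ⟨⟨h3, h4, h5⟩, -, hm2⟩
      refine wp_skip ⟨⟨?_, ?_⟩, ?_⟩
      · intro q hq w hw
        rcases Nat.lt_succ_iff_lt_or_eq.1 hq with h | rfl
        · simp [h5 q h.ne, h1 q h w hw]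
        · simp [h3 w hw]
      · intro q hq
        simp [h5 q (by omega), h2 q (by omega)]
      · simp at hm2 ⊢; omega
  · rintro s1 m1 hF1 ⟨⟨h1, -⟩, -, hm⟩
    refine ⟨h1, ?_⟩
    simp at hm
    nlinarith

theorem IsFlow.clamp {δ : ℝ} (hδ : 0 ≤ δ) {phi phi' : ℕ → ℕ → ℝ}
    (h : ∀ u < n, ∀ v < n, phi u v = - phi v u)
    (h' : ∀ u < n, ∀ v < n, phi' u v = SFM.clamp δ (phi u v)) : IsFlow n δ phi' where
  skew u hu v hv := by
    rw [h' u hu v hv, h' v hv u hu, h u hu v hv, clamp_neg _ _ hδ]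
  le u hu v hv := by
    rw [h' u hu v hv]
    exact max_le (by linarith) (min_le_left _ _)

/-- Values in [−2δ, 2δ] move by at most δ when they are clipped to [−δ, δ], so each boundary, a sum
of n of them, moves by at most nδ. -/
theorem negSum_clamp {δ : ℝ} (hδ : 0 ≤ δ) {x phi phi' : ℕ → ℕ → ℝ} (h : IsFlow n (2 * δ) phi)
    (h' : ∀ u < n, ∀ v < n, phi' u v = SFM.clamp δ (phi u v)) :
    negSum n (zeta n x phi) - n * (n * δ) ≤ negSum n (zeta n x phi') := by
  rw [sub_le_iff_le_add]
  refine negSum_le_add (by positivity) fun v hv => ?_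
  have : ∑ w ∈ range n, (phi' w v - phi w v) ≤ ∑ w ∈ range n, δ := by
    refine sum_le_sum fun w hw => ?_
    have hw := mem_range.1 hw
    rw [h' w hw v hv]
    exact (abs_le.1 (abs_clamp_sub_le hδ
      (abs_le.2 ⟨h.neg_le hw hv, h.le w hw v hv⟩))).2
  rw [sum_sub_distrib] at this
  simp only [sum_const, card_range, nsmul_eq_mul] at this
  simp only [zeta]
  linarith

end SFM

namespace SFM

open Finset

/-! ## Traces -/

/-- A contiguous piece that avoids the separator cannot straddle it; this reduces bounds between
labels to bounds on the two sides. -/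
theorem infix_append_cons {α : Type*} {w A R : List α} {m : α} (h : w <:+: A ++ m :: R)
    (hm : m ∉ w) : w <:+: A ∨ w <:+: R := by
  obtain ⟨p, q, h⟩ := h
  rcases List.append_eq_append_iff.1 h with ⟨as, e, -⟩ | ⟨cs, e, e'⟩
  · exact Or.inl ⟨p, as, e.symm⟩
  · rcases cs with - | ⟨c, cs⟩
    · exact Or.inl ⟨p, [], by simpa using e⟩
    · obtain ⟨rfl, rfl⟩ := List.cons_eq_cons.1 e'
      rcases List.append_eq_append_iff.1 e with ⟨as, -, e2⟩ | ⟨ds, -, e2⟩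
      · exact (hm (by simp [e2])).elim
      · rcases ds with - | ⟨d, ds⟩
        · exact (hm (by rw [List.nil_append] at e2; simp [← e2])).elim
        · obtain ⟨rfl, rfl⟩ := List.cons_eq_cons.1 e2
          exact Or.inr ⟨ds, q, rfl⟩

/-- Between consecutive labels there are at most `B` steps. -/
def Gap (B : ℕ) (tr : List Event) : Prop :=
  ∀ w : List Event, w <:+: tr → Event.mark .phase ∉ w → Event.mark .augmentation ∉ w → w.length ≤ B

/-- Between consecutive starts of phases there are at most `A` augmentations. -/
def AugBound (A : ℕ) (tr : List Event) : Prop :=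
  ∀ w : List Event, w <:+: tr → Event.mark .phase ∉ w → w.count (Event.mark .augmentation) ≤ A

theorem gap_steps {B m : ℕ} (h : m ≤ B) : Gap B (steps m) := fun w hw _ _ => by
  have := hw.length_le
  simp only [steps, List.length_replicate] at this
  omega

theorem Gap.append {B : ℕ} {X Y : List Event} (hX : Gap B X) (hY : Gap B Y) (l : Label) :
    Gap B (X ++ Event.mark l :: Y) := fun w hw h1 h2 => by
  have : Event.mark l ∉ w := by cases l <;> assumption
  exact (infix_append_cons hw this).elim (hX w · h1 h2) (hY w · h1 h2)

theorem augBound_of_count {A : ℕ} {X : List Event} (h : X.count (.mark .augmentation) ≤ A) :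
    AugBound A X := fun _ hw _ => (hw.sublist.count_le _).trans h

theorem AugBound.append {A : ℕ} {X Y : List Event} (hX : AugBound A X) (hY : AugBound A Y) :
    AugBound A (X ++ Event.mark .phase :: Y) := fun w hw h =>
  (infix_append_cons hw h).elim (hX w · h) (hY w · h)

@[simp] theorem count_mark_steps (l : Label) (m : ℕ) : (steps m).count (.mark l) = 0 := by
  simp [steps, List.count_replicate]

@[simp] theorem count_step_steps (m : ℕ) : (steps m).count .step = m := by
  simp [steps]

theorem steps_add_append (a b : ℕ) (R : List Event) :
    steps a ++ (steps b ++ R) = steps (a + b) ++ R := by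
  rw [← List.append_assoc, steps_add]

theorem Exec.cast {O : Set ℕ → ℝ} {P : Cmd} {s s' : Mem} {tr tr' : List Event}
    (h : Exec O P s s' tr) (e : tr = tr') : Exec O P s s' tr' := e ▸ h

/-! ## Phases -/

variable {O : Set ℕ → ℝ} {n : ℕ} {M δ : ℝ}

/-- The set that is returned. -/
def outSet (n : ℕ) (s : Mem) : Set ℕ :=
  {v | s.nat .nS 0 0 ≠ 0 ∧ v < n ∧ (s.nat .nT 0 0 ≠ 0 → s.nat .inW v 0 ≠ 0)}

/-- The state between two turns of the loop of a phase. -/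
structure Turn (O : Set ℕ → ℝ) (n : ℕ) (δ : ℝ) (s : Mem) : Prop where
  core : Core O n δ (zeta n (s.real .x) (s.real .phi)) s
  k_le : s.nat .k 0 0 ≤ n + 1

/-- The bound at the end of a phase. -/
def PhaseEnd (O : Set ℕ → ℝ) (n : ℕ) (δ : ℝ) (s : Mem) : Prop :=
  O (outSet n s) - n * δ ≤ negSum n (zeta n (s.real .x) (s.real .phi))

theorem Core.congr {ζ : ℕ → ℝ} {s s' : Mem} (h : Core O n δ ζ s) (hn : s'.nat .n = s.nat .n)
    (hd : s'.real .delta = s.real .delta) (hk : s'.nat .k = s.nat .k) (hL : s'.nat .L = s.nat .L)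
    (hy : s'.real .y = s.real .y) (hl : s'.real .lam = s.real .lam)
    (hx : s'.real .x = s.real .x) (hp : s'.real .phi = s.real .phi) : Core O n δ ζ s' where
  n_eq := by rw [hn, h.n_eq]
  delta_eq := by rw [hd, h.delta_eq]
  base := by rw [hk, hL, hy, hl, hx]; exact h.base
  flow := by rw [hp]; exact h.flow
  zeta_eq := by rw [hx, hp]; exact h.zeta_eq

theorem Core.turn {ζ : ℕ → ℝ} {s : Mem} (h : Core O n δ ζ s) (hk : s.nat .k 0 0 ≤ n + 1) :
    Turn O n δ s :=
  ⟨⟨h.n_eq, h.delta_eq, h.base, h.flow, fun _ _ => rfl⟩, hk⟩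

/-- The body of the loop of a phase. -/
def turnBody : List Cmd := [
  computeSTW,
  ifElse (.or (.neq (n0 .nS) (.lit 0)) (.neq (n0 .nT) (.lit 0)))
    [setN0 .go (.lit 0)]
    [search,
     ifElse (.neq (n0 .hit) (.lit 1))
       [augment]
       [setN0 .go (.lit 0)],
     reduce]]

theorem phaseEnd_of_noS (hO : IsOracle O n M) (hδ : 0 ≤ δ) {s : Mem} (h : Turn O n δ s)
    (h0 : s.nat .nS 0 0 = 0) (hS : ∀ v < n, v ∉ setS n δ (s.real .x) (s.real .phi)) :
    PhaseEnd O n δ s := by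
  have e : outSet n s = ∅ := by ext v; simp [outSet, h0]
  unfold PhaseEnd
  rw [e]
  refine h.core.base.le_negSum hO h.core.flow ∅ (by simp) (by simp) ?_ (by simp) hδ
  intro v hv _
  have := hS v hv
  simp only [setS, Set.mem_ofPred_eq, not_le] at this
  exact this.le

theorem phaseEnd_of_noT (hO : IsOracle O n M) (hδ : 0 ≤ δ) {s : Mem} (h : Turn O n δ s)
    (hS : s.nat .nS 0 0 ≠ 0)
    (h0 : s.nat .nT 0 0 = 0) (hT : ∀ v < n, v ∉ setT n δ (s.real .x) (s.real .phi)) :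
    PhaseEnd O n δ s := by
  have e : outSet n s = Set.Iio n := by ext v; simp [outSet, h0, hS]
  unfold PhaseEnd
  rw [e]
  refine h.core.base.le_negSum hO h.core.flow _ ?_ ?_ ?_ ?_ hδ
  · intro i hi a b hab hb _
    exact (h.core.base.ext i hi).lt a (hab.trans hb)
  · intro u _ v hv _ hv'; exact absurd hv hv'
  · intro v hv hv'; exact absurd hv hv'
  · intro v hv _
    have := hT v hv
    simp only [setT, Set.mem_ofPred_eq, not_le] at this
    exact this.le

/-- Here X = W: absence of active pairs makes W an initial segment of every ordering, closedness
means that no residual arc leaves it, and S ⊆ W, W ∩ T = ∅ give the two bounds on ζ. -/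
theorem phaseEnd_of_closed (hO : IsOracle O n M) (hδ : 0 ≤ δ) {s : Mem} {ζ : ℕ → ℝ}
    {S T : Set ℕ} (h : Core O n δ ζ s) (hQ : QI n S T s)
    (hC : Closed n (s.real .phi) (s.nat .inW) (s.nat .que) (s.nat .qt 0 0))
    (hhit : s.nat .hit 0 0 = 0) (hW : ∀ j < s.nat .k 0 0, WFirst n (s.nat .inW) (s.nat .L j) 0)
    (hnS : s.nat .nS 0 0 ≠ 0) (hnT : s.nat .nT 0 0 ≠ 0)
    (hS : ∀ v < n, v ∉ S → -δ ≤ ζ v) (hT : ∀ v < n, v ∉ T → ζ v ≤ δ) : PhaseEnd O n δ s := by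
  have e : ∀ v, v ∈ outSet n s ↔ v < n ∧ s.nat .inW v 0 = 1 := by
    intro v
    simp only [outSet, hnS, hnT, ne_eq, not_false_eq_true, true_and, forall_const,
      Set.mem_ofPred_eq]
    refine and_congr_right fun hv => ?_
    have := hQ.inW_le v hv
    omega
  refine h.base.le_negSum hO h.flow _ ?_ ?_ ?_ ?_ hδ
  · intro i hi a b hab hb hbX
    rw [e] at hbX ⊢
    exact ⟨(h.base.ext i hi).lt a (hab.trans hb), hW i hi a b (Nat.zero_le _) hab hb hbX.2⟩
  · intro u hu v hv huX hvX
    rw [e] at huX hvX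
    by_contra hle
    obtain ⟨m, hm, rfl⟩ := hQ.que_of u hu huX.2
    refine hvX ⟨hv, hC m hm v hv ?_ (not_lt.1 hle)⟩
    rintro rfl
    exact hvX huX
  · intro v hv hvX
    rw [h.zeta_eq v hv]
    exact hS v hv fun hvS => hvX ((e v).2 ⟨hv, hQ.S_sub v hv hvS⟩)
  · intro v hv hvX
    rw [h.zeta_eq v hv]
    exact hT v hv (hQ.hit0 hhit v hv ((e v).1 hvX).2)

/-- A turn either ends the phase or contains exactly one augmentation. The search does not change ζ,
so S and T computed at the start of the turn are still correct at the augmentation. Since `wp`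
covers only label-free programs, the derivation is assembled by hand. -/
theorem exec_turn (hO : IsOracle O n M) (hδ : 0 < δ) (hn : 1 ≤ n) {s : Mem} (h : Turn O n δ s)
    (hgo : s.nat .go 0 0 = 1) :
    (∃ s' m, Exec O (block turnBody) s s' (steps m) ∧ m ≤ 30000 * (n * (n * n)) ∧
      s'.nat .go 0 0 = 0 ∧ Turn O n δ s' ∧ PhaseEnd O n δ s') ∨
    ∃ s' m m', Exec O (block turnBody) s s' (steps m ++ Event.mark .augmentation :: steps m') ∧
      m + m' ≤ 30000 * (n * (n * n)) ∧ s'.nat .go 0 0 = 1 ∧ Turn O n δ s' ∧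
      negSum n (zeta n (s.real .x) (s.real .phi)) + δ ≤
        negSum n (zeta n (s'.real .x) (s'.real .phi)) := by
  obtain ⟨s1, m1, e1, hQ1, hC1, hq1, hS1, hT1, hm1⟩ :=
    wp_computeSTW (O := O) h.core.n_eq h.core.delta_eq hδ
  have hF1 := e1.frame
  have hx1 := hF1.real .x rfl
  have hp1 := hF1.real .phi rfl
  have hco1 : Core O n δ (zeta n (s.real .x) (s.real .phi)) s1 :=
    h.core.congr (hF1.nat .n rfl) (hF1.real .delta rfl) (hF1.nat .k rfl) (hF1.nat .L rfl)
      (hF1.real .y rfl) (hF1.real .lam rfl) hx1 hp1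
  have hk1 : s1.nat .k 0 0 ≤ n + 1 := by rw [hF1.nat .k rfl]; exact h.k_le
  have hgo1 : s1.nat .go 0 0 = 1 := by rw [hF1.nat .go rfl]; exact hgo
  have hSx : ∀ v < n, v ∉ setS n δ (s.real .x) (s.real .phi) →
      -δ ≤ zeta n (s.real .x) (s.real .phi) v := fun v _ hv => (not_le.1 hv).le
  have hTx : ∀ v < n, v ∉ setT n δ (s.real .x) (s.real .phi) →
      zeta n (s.real .x) (s.real .phi) v ≤ δ := fun v _ hv => (not_le.1 hv).le
  have htest : (BExp.or (.neq (n0 .nS) (.lit 0)) (.neq (n0 .nT) (.lit 0))).holds s1 ↔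
      s1.nat .nS 0 0 = 0 ∨ s1.nat .nT 0 0 = 0 := by simp
  by_cases ht : s1.nat .nS 0 0 = 0 ∨ s1.nat .nT 0 0 = 0
  · left
    have hturn : Turn O n δ (s1.setN .go 0 0 0) := by
      refine (hco1.congr ?_ ?_ ?_ ?_ ?_ ?_ ?_ ?_).turn ?_ <;> simp [hk1]
    refine ⟨s1.setN .go 0 0 0, m1 + 15, ((e1.seq _ _ _ _ _ _ _ (.seq _ _ _ _ _ _ _
      (.ite_true _ _ _ _ _ _ (htest.2 ht) (.seq _ _ _ _ _ _ _ (.setN _ _ _ _ _) (.skip _)))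
        (.skip _)))).cast ?_, ?_, ?_, hturn, ?_⟩
    · simp [steps_add]
    · nlinarith
    · simp
    · by_cases h0 : s1.nat .nS 0 0 = 0
      · refine phaseEnd_of_noS hO hδ.le hturn (by simpa using h0) ?_
        simpa [hx1, hp1] using hS1 h0
      · refine phaseEnd_of_noT hO hδ.le hturn (by simpa using h0)
          (by simpa using ht.resolve_left h0) ?_
        simpa [hx1, hp1] using hT1 (ht.resolve_left h0)
  · obtain ⟨s2, m2, e2, hco2, hQ2, hC2, hk2, hhit, hm2⟩ :=
      wp_search hO hδ.le hn hco1 hQ1 hC1 hq1 hk1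
    have hF2 := e2.frame
    have hgo2 : s2.nat .go 0 0 = 1 := by rw [hF2.nat .go rfl]; exact hgo1
    have hnS2 := hF2.nat .nS rfl
    have hnT2 := hF2.nat .nT rfl
    rcases hhit with hhit | ⟨hhit, hW⟩
    · right
      obtain ⟨s3, m3, e3, hfl3, ⟨a, haS, han, b, hbT, hz3⟩, hm3⟩ :=
        wp_augmentPath (O := O) hδ.le hco2 hQ2 hhit
      have hF3 := e3.frame
      obtain ⟨s4, m4, e4, hk4, hb4, hm4⟩ := wp_reduce (O := O) (s := s3) (n := n)
        (by rw [hF3.nat .n rfl, hco2.n_eq]) hn (by rw [hF3.nat .k rfl]; exact hk2)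
        (by rw [hF3.nat .k rfl, hF3.nat .L rfl, hF3.real .y rfl, hF3.real .lam rfl,
              hF3.real .x rfl]; exact hco2.base)
      have hF4 := e4.frame
      refine ⟨s4, m1 + 11 + m2 + 5, m3 + m4, ?_, by nlinarith, ?_, ⟨⟨?_, ?_, hb4, ?_, ?_⟩, hk4⟩, ?_⟩
      · refine (e1.seq _ _ _ _ _ _ _ (.seq _ _ _ _ _ _ _
          (.ite_false _ _ _ _ _ _ (mt htest.1 ht) (.seq _ _ _ _ _ _ _ e2 (.seq _ _ _ _ _ _ _
            (.ite_true _ _ _ _ _ _ (by simpa using hhit) (.seq _ _ _ _ _ _ _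
              (.seq _ _ _ _ _ _ _ (.mark _ _) e3) (.skip _)))
            (.seq _ _ _ _ _ _ _ e4 (.skip _))))) (.skip _))).cast ?_
        simp [steps_add, steps_add_append, add_assoc]
      · rw [hF4.nat .go rfl, hF3.nat .go rfl, hgo2]
      · rw [hF4.nat .n rfl, hF3.nat .n rfl, hco2.n_eq]
      · rw [hF4.real .delta rfl, hF3.real .delta rfl, hco2.delta_eq]
      · rw [hF4.real .phi rfl]; exact hfl3
      · exact fun _ _ => rfl
      · rw [hF4.real .x rfl, hF3.real .x rfl, hF4.real .phi rfl]
        exact negSum_augment han hδ haS hbT hz3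
    · left
      obtain ⟨s4, m4, e4, hk4, hb4, hm4⟩ := wp_reduce (O := O) (s := s2.setN .go 0 0 0) (n := n)
        (by simpa using hco2.n_eq) hn (by simpa using hk2) (by simpa using hco2.base)
      have hF4 := e4.frame
      have hP2 : PhaseEnd O n δ s2 := phaseEnd_of_closed hO hδ.le hco2 hQ2 hC2 hhit hW
        (by rw [hnS2]; tauto) (by rw [hnT2]; tauto) hSx hTx
      refine ⟨s4, m1 + 11 + m2 + 5 + 4 + m4, ?_, by nlinarith, ?_, ⟨⟨?_, ?_, hb4, ?_, ?_⟩, hk4⟩, ?_⟩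
      · refine (e1.seq _ _ _ _ _ _ _ (.seq _ _ _ _ _ _ _
          (.ite_false _ _ _ _ _ _ (mt htest.1 ht) (.seq _ _ _ _ _ _ _ e2 (.seq _ _ _ _ _ _ _
            (.ite_false _ _ _ _ _ _ (by simp [hhit]) (.seq _ _ _ _ _ _ _ (.setN _ _ _ _ _)
              (.skip _)))
            (.seq _ _ _ _ _ _ _ e4 (.skip _))))) (.skip _))).cast ?_
        simp [steps_add, add_assoc]
      · rw [hF4.nat .go rfl]; simp
      · rw [hF4.nat .n rfl]; simpa using hco2.n_eq
      · rw [hF4.real .delta rfl]; simpa using hco2.delta_eq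
      · rw [hF4.real .phi rfl]; simpa using hco2.flow
      · exact fun _ _ => rfl
      · simp only [PhaseEnd, outSet] at hP2 ⊢
        rw [hF4.real .x rfl, hF4.real .phi rfl, hF4.nat .nS rfl, hF4.nat .nT rfl,
          hF4.nat .inW rfl]
        simpa using hP2

end SFM

/-! ### The loop of a phase and the loop over the phases -/

namespace SFM

open Finset

variable {O : Set ℕ → ℝ} {n : ℕ} {M δ : ℝ}

/-- The properties of the trace `tr` of the loop of a phase with at most `N` augmentations whose
turns take at most `B` steps. -/
structure LoopTrace (B N : ℕ) (tr : List Event) : Prop where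
  phase : tr.count (.mark .phase) = 0
  aug : tr.count (.mark .augmentation) ≤ N
  step : tr.count .step ≤ (N + 1) * B
  gap : ∀ R c, c ≤ B → (∀ c ≤ 3 * B, Gap (6 * B) (steps c ++ R)) →
    Gap (6 * B) (steps c ++ (tr ++ R))

/-- The field `gap` carries a prefix of steps and a continuation R because the steps at both ends of
the loop merge with those of the neighbouring code. A label splits the run, and what follows the
label is again a prefix of at most B steps. -/
theorem LoopTrace.turn {B N m m' : ℕ} {tr : List Event} (h : LoopTrace B N tr) (hm : m + m' ≤ B) :
    LoopTrace B (N + 1) (steps m ++ Event.mark .augmentation :: (steps m' ++ tr)) where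
  phase := by simp [h.phase]
  aug := by have := h.aug; simp; omega
  step := by have := h.step; simp; nlinarith
  gap R c hc hR := by
    have := Gap.append (B := 6 * B) (gap_steps (m := c + m) (by omega))
      (h.gap R m' (by omega) hR) .augmentation
    simpa [steps_add_append] using this

/-- The loop of a phase. -/
def turnLoop : Cmd := whileDo (.neq (n0 .go) (.lit 1)) turnBody

/-- Induction on the number N of augmentations for which there is room below the upper bound f(X) +
n²δ of ζ⁻(V). The bound 30310n³ contains a whole turn together with the tests of the loop. -/
theorem exec_turnLoop (hO : IsOracle O n M) (hδ : 0 < δ) (hn : 1 ≤ n) (X : Set ℕ) (N : ℕ) :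
    ∀ s : Mem, Turn O n δ s → s.nat .go 0 0 = 1 →
      O X + n * (n * δ) ≤ negSum n (zeta n (s.real .x) (s.real .phi)) + N * δ →
      ∃ s' tr, Exec O turnLoop s s' tr ∧ LoopTrace (30310 * (n * (n * n))) N tr ∧
        Turn O n δ s' ∧ PhaseEnd O n δ s' := by
  have hn3 : 1 ≤ n * (n * n) := Nat.mul_pos hn (Nat.mul_pos hn hn)
  have htest : ∀ s : Mem, (BExp.neq (n0 .go) (.lit 1)).holds s ↔ s.nat .go 0 0 = 1 := by simp
  induction N with
  | zero =>
    intro s h hgo hN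
    rcases exec_turn hO hδ hn h hgo with ⟨s', m, e, hm, hgo', h', hE⟩ |
      ⟨s', m, m', e, hm, hgo', h', hE⟩
    · refine ⟨s', steps (5 + m + 5), ((Exec.while_true _ _ _ _ _ _ _ ((htest s).2 hgo) e
        (.while_false _ _ _ (by rw [htest]; omega)))).cast ?_, ⟨?_, ?_, ?_, ?_⟩, h', hE⟩
      · simp [steps_add]
      · simp
      · simp
      · simp; omega
      · intro R c hc hR
        rw [steps_add_append]
        exact hR _ (by omega)
    -- No room is left: one more augmentation would lift ζ⁻(V) above its upper bound.
    · have := h'.core.base.negSum_le hO h'.core.flow hδ.le X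
      push_cast at hN
      linarith
  | succ N ih =>
    intro s h hgo hN
    rcases exec_turn hO hδ hn h hgo with ⟨s', m, e, hm, hgo', h', hE⟩ |
      ⟨s', m, m', e, hm, hgo', h', hE⟩
    · refine ⟨s', steps (5 + m + 5), ((Exec.while_true _ _ _ _ _ _ _ ((htest s).2 hgo) e
        (.while_false _ _ _ (by rw [htest]; omega)))).cast ?_, ⟨?_, ?_, ?_, ?_⟩, h', hE⟩
      · simp [steps_add]
      · simp
      · simp
      · simp; nlinarith
      · intro R c hc hR
        rw [steps_add_append]
        exact hR _ (by omega)
    · obtain ⟨s2, tr, e2, htr, h2, hE2⟩ := ih s' h' hgo' (by push_cast at hN; linarith)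
      refine ⟨s2, _, ((Exec.while_true _ _ _ _ _ _ _ ((htest s).2 hgo) e e2)).cast ?_,
        htr.turn (m := 5 + m) (m' := m') (by omega), h2, hE2⟩
      simp [steps_add_append]

/-- The state between two phases. -/
structure Ready (O : Set ℕ → ℝ) (n : ℕ) (δ : ℝ) (s : Mem) : Prop where
  turn : Turn O n δ s
  lower : ∃ X, O X - 4 * (n * δ) ≤ negSum n (zeta n (s.real .x) (s.real .phi))

/-- In terms of the new value δ' = δ/2, the distance from ζ⁻(V) to its upper bound is at most 8nδ'
from the previous state, n²δ' from clipping and n²δ' from the upper bound itself, at most 10n²δ' in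
all. -/
theorem exec_scalingPhase (hO : IsOracle O n M) (hδ : 0 < δ) (hn : 1 ≤ n) {s : Mem}
    (h : Ready O n δ s) :
    ∃ s' m tr, Exec O scalingPhase s s' (Event.mark .phase :: (steps m ++ tr)) ∧
      m ≤ 300 * (n * (n * n)) ∧ LoopTrace (30310 * (n * (n * n))) (10 * (n * n)) tr ∧
      Ready O n (δ / 2) s' ∧ PhaseEnd O n (δ / 2) s' := by
  have hnn : n ≤ n * n := Nat.le_mul_of_pos_left n hn
  have hnn2 : n * n ≤ n * (n * n) := Nat.le_mul_of_pos_left _ hn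
  have hn1 : (1 : ℝ) ≤ n := by exact_mod_cast hn
  obtain ⟨X, hX⟩ := h.lower
  have hδ2 : 0 < δ / 2 := by linarith
  have hs := h.turn.core
  obtain ⟨s1, m1, e1, hc1, hm1⟩ := wp_clip (O := O) (s := s.setR .delta 0 0 (δ / 2)) hδ2.le
    (by simpa using hs.n_eq) (by simp)
  have hF1 := e1.frame
  have hx1 : s1.real .x = s.real .x := by simp [hF1.real .x rfl]
  simp only [ne_eq, reduceCtorEq, not_false_eq_true, Mem.real_setR_of_ne] at hc1
  have hfl1 : IsFlow n (δ / 2) (s1.real .phi) := IsFlow.clamp hδ2.le hs.flow.skew hc1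
  have hz1 := negSum_clamp hδ2.le (x := s.real .x)
    (show IsFlow n (2 * (δ / 2)) (s.real .phi) by
      rw [mul_div_cancel₀ δ two_ne_zero]; exact hs.flow) hc1
  have hcore : Core O n (δ / 2) (zeta n (s.real .x) (s1.real .phi)) (s1.setN .go 0 0 1) := by
    refine ⟨?_, ?_, ?_, by simpa using hfl1, ?_⟩
    · simpa [hF1.nat .n rfl] using hs.n_eq
    · simp [hF1.real .delta rfl]
    · simpa [hF1.nat .k rfl, hF1.nat .L rfl, hF1.real .y rfl, hF1.real .lam rfl, hx1]
        using hs.base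
    · intro v _; simp [hx1]
  obtain ⟨s2, tr, e2, htr, h2, hE2⟩ := exec_turnLoop hO hδ2 hn X (10 * (n * n))
    (s1.setN .go 0 0 1) (hcore.turn (by simpa [hF1.nat .k rfl] using h.turn.k_le)) (by simp)
    (by
      simp only [Mem.real_setN, hx1]
      push_cast
      have : (n : ℝ) * δ ≤ n * n * δ := by
        have := mul_le_mul_of_nonneg_right hn1 (by positivity : (0 : ℝ) ≤ n * δ)
        linarith
      linarith)
  have e1' : Exec O clip (s.setR .delta 0 0 (RExp.eval s (.div (r0 .delta) (.lit 2)))) s1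
      (steps m1) := by
    simpa [hs.delta_eq] using e1
  refine ⟨s2, 8 + m1 + 4, tr, ?_, by omega, htr, ⟨h2, outSet n s2, ?_⟩, hE2⟩
  · refine (Exec.seq _ _ _ _ _ _ _ (.mark _ _) (.seq _ _ _ _ _ _ _ (.setR _ _ _ _ _)
      (.seq _ _ _ _ _ _ _ e1' (.seq _ _ _ _ _ _ _ (.setN _ _ _ _ _)
        (.seq _ _ _ _ _ _ _ e2 (.skip _)))))).cast ?_
    simp [steps_add_append, add_assoc]
  -- The end of a phase gives the constant 1 where `Ready` asks only for 4; the slack accommodates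
  -- the initial state.
  · have : 0 ≤ n * (δ / 2) := by positivity
    have hE3 := hE2
    unfold PhaseEnd at hE3
    linarith

/-- The properties of the trace `tr` of at most `p` phases. -/
structure PhasesTrace (B A p : ℕ) (tr : List Event) : Prop where
  phase : tr.count (.mark .phase) ≤ p
  step : tr.count .step ≤ p * ((A + 2) * B) + B
  aug : ∀ X : List Event, X.count (.mark .augmentation) ≤ A → ∀ c, AugBound A (X ++ (tr ++ steps c))
  gap : ∀ c ≤ 3 * B, ∀ c' ≤ B, Gap (6 * B) (steps c ++ (tr ++ steps c'))

theorem PhasesTrace.steps {B A p m : ℕ} (hm : m ≤ B) : PhasesTrace B A p (steps m) where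
  phase := by simp
  step := by simp; omega
  aug X hX c := augBound_of_count (by simpa using hX)
  gap c hc c' hc' := by
    rw [steps_add, steps_add]
    exact gap_steps (by omega)

/-- One phase costs at most B steps outside its loop and (A + 1)B inside. A label-free run is at
most 3B + B before a phase label and at most 3B + B + B at the end of the run, hence the common
bound 6B. -/
theorem PhasesTrace.phases {B A p t m : ℕ} {tr tr' : List Event} (h : PhasesTrace B A p tr')
    (ht : t + m ≤ B) (htr : LoopTrace B A tr) :
    PhasesTrace B A (p + 1)
      (SFM.steps t ++ Event.mark .phase :: (SFM.steps m ++ (tr ++ tr'))) where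
  phase := by
    have := h.phase
    simp [htr.phase]
    omega
  step := by
    have := h.step
    have := htr.step
    simp
    nlinarith
  aug X hX c := by
    have := AugBound.append (A := A) (X := X ++ SFM.steps t) (augBound_of_count (by simpa using hX))
      (h.aug (SFM.steps m ++ tr) (by simpa using htr.aug) c)
    simpa using this
  gap c hc c' hc' := by
    have := Gap.append (B := 6 * B) (gap_steps (m := c + t) (by omega))
      (htr.gap (tr' ++ SFM.steps c') m (by omega) fun d hd => h.gap d hd c' hc') .phase
    simpa [steps_add_append] using this

/-- The loop of the algorithm. -/
def phases : Cmd :=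
  whileDo (.rle (.div (.lit 1) (.mul (.ofNat (n0 .n)) (.ofNat (n0 .n)))) (r0 .delta)) [scalingPhase]

/-- Halving δ lowers the exponent p by one. The disjunction in the hypotheses rules out that the
loop is left before any phase has established `PhaseEnd`, on which the correctness of the output
rests. -/
theorem exec_phases (hO : IsOracle O n M) (hn : 1 ≤ n) (p : ℕ) :
    ∀ (δ : ℝ) (s : Mem), 0 < δ → Ready O n δ s → δ * (n * n) < 2 ^ p →
      (PhaseEnd O n δ s ∨ 1 ≤ δ * (n * n)) →
      ∃ s' tr, Exec O phases s s' tr ∧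
        PhasesTrace (30310 * (n * (n * n))) (10 * (n * n)) p tr ∧ s'.nat .n 0 0 = n ∧
        ∀ Y, O (outSet n s') ≤ O Y := by
  have hn3 : 1 ≤ n * (n * n) := Nat.mul_pos hn (Nat.mul_pos hn hn)
  have htest : ∀ (δ : ℝ) (s : Mem), Ready O n δ s →
      ((BExp.rle (.div (.lit 1) (.mul (.ofNat (n0 .n)) (.ofNat (n0 .n)))) (r0 .delta)).holds s ↔
        1 ≤ δ * (n * n)) := by
    intro δ s h
    simp only [BExp.holds, RExp.eval, NExp.eval, n0, r0, h.turn.core.n_eq, h.turn.core.delta_eq]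
    rw [div_le_iff₀ (by positivity)]
    simp
  have hend : ∀ (p : ℕ) (δ : ℝ) (s : Mem), 0 < δ → Ready O n δ s → ¬ 1 ≤ δ * (n * n) →
      (PhaseEnd O n δ s ∨ 1 ≤ δ * (n * n)) →
      ∃ s' tr, Exec O phases s s' tr ∧
        PhasesTrace (30310 * (n * (n * n))) (10 * (n * n)) p tr ∧ s'.nat .n 0 0 = n ∧
        ∀ Y, O (outSet n s') ≤ O Y := by
    intro p δ s hδ h h1 hE
    have hc := h.turn.core
    exact ⟨s, steps 15, (Exec.while_false _ _ _ (mt (htest δ s h).1 h1)).cast (by simp),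
      PhasesTrace.steps (by omega), hc.n_eq, fun Y => hc.base.minimizer hO hc.flow hδ.le
        (not_le.1 h1) hn (hE.resolve_right h1) Y⟩
  induction p with
  | zero =>
    intro δ s hδ h hp hE
    exact hend 0 δ s hδ h (by simpa using hp) hE
  | succ p ih =>
    intro δ s hδ h hp hE
    by_cases h1 : 1 ≤ δ * (n * n)
    · obtain ⟨s1, m, tr, e1, hm, htr, h1', hE1⟩ := exec_scalingPhase hO hδ hn h
      obtain ⟨s2, tr2, e2, htr2, hn2, hY⟩ := ih (δ / 2) s1 (by linarith) h1'
        (by rw [pow_succ] at hp; linarith) (Or.inl hE1)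
      refine ⟨s2, _, (Exec.while_true _ _ _ _ _ _ _ ((htest δ s h).2 h1)
        (.seq _ _ _ _ _ _ _ e1 (.skip _)) e2).cast ?_,
        htr2.phases (t := 15) (m := m) (by omega) htr, hn2, hY⟩
      simp
    · exact hend _ δ s hδ h h1 hE

end SFM

namespace SFM

open Finset

variable {O : Set ℕ → ℝ} {n : ℕ} {M : ℝ}

/-! ## The algorithm -/

/-- The commands of `algorithm` after the last phase. -/
def writeOut : Cmd :=
  forTo .v (n0 .n) [
    ifElse (.neq (n0 .nS) (.lit 0))
      [setN1 .out (n0 .v) (.lit 0)]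
      [ifElse (.neq (n0 .nT) (.lit 0))
        [setN1 .out (n0 .v) (.lit 1)]
        [setN1 .out (n0 .v) (n1 .inW (n0 .v))]]]

theorem wp_writeOut {s : Mem} (hn : s.nat .n 0 0 = n) :
    wp O writeOut (fun s' m =>
      (∀ v < n, s'.nat .out v 0 ≠ 0 ↔ v ∈ outSet n s) ∧ m ≤ 60 * n + 20) s := by
  refine wp_mono (wp_forTo n 40 (fun i s' =>
    ∀ v < i, s'.nat .out v 0 ≠ 0 ↔ v ∈ outSet n s) rfl ?_ ?_ ?_) ?_
  · intro s' hF; simp [hF.nat .n rfl, hn]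
  · simp
  · rintro v hv s1 hF hvv h
    have e1 := hF.nat .nS rfl
    have e2 := hF.nat .nT rfl
    have e3 := hF.nat .inW rfl
    have main : ∀ a, (a ≠ 0 ↔ v ∈ outSet n s) → ∀ w < v + 1,
        ((s1.setN .out v 0 a).setN .v 0 0 (v + 1)).nat .out w 0 ≠ 0 ↔ w ∈ outSet n s := by
      intro a ha w hw
      rcases Nat.lt_succ_iff_lt_or_eq.1 hw with hw' | rfl
      · simpa [hw'.ne] using h w hw'
      · simpa using ha
    simp only [block, ifElse, setN1]
    repeat' with_reducible
      first | apply wp_seq | apply wp_setN | apply wp_ite | apply wp_skip | intro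
    all_goals
      simp only [BExp.holds, NExp.eval, n0, n1, hvv, e1, e2, e3] at *
      refine ⟨main _ ?_, by simp⟩
      simp only [outSet, Set.mem_ofPred_eq]
      tauto
  · rintro s1 m1 hF ⟨h, -, hm⟩
    refine ⟨h, ?_⟩
    simp at hm; omega

theorem exec_algorithm (hO : IsOracle O n M) (hn : 1 ≤ n) (hM : 1 ≤ M) {p : ℕ}
    (hp : M * (n * n) < 2 ^ p) {s : Mem} (hsn : s.nat .n 0 0 = n) (hsM : s.real .M 0 0 = M) :
    ∃ s' tr m m', Exec O algorithm s s' (steps m ++ (tr ++ steps m')) ∧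
      PhasesTrace (30310 * (n * (n * n))) (10 * (n * n)) p tr ∧
      m ≤ 30310 * (n * (n * n)) ∧ m' ≤ 30310 * (n * (n * n)) ∧
      ∀ Y, O {v | s'.nat .out v 0 ≠ 0} ≤ O Y := by
  have hnn : n ≤ n * n := Nat.le_mul_of_pos_left n hn
  have hnn2 : n * n ≤ n * (n * n) := Nat.le_mul_of_pos_left _ hn
  have hn1 : (1 : ℝ) ≤ n := by exact_mod_cast hn
  obtain ⟨s1, m1, e1, hb1, hk1, hd1, hphi1, hx1, hm1⟩ := wp_setUp hO hsn
  have hF1 := e1.frame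
  have hready : Ready O n M s1 := by
    refine ⟨⟨⟨?_, by rw [hd1, hsM], by rw [hk1]; exact hb1, ⟨?_, ?_⟩, fun _ _ => rfl⟩, ?_⟩, ∅, ?_⟩
    · rw [hF1.nat .n rfl, hsn]
    · intro u hu v hv; rw [hphi1 u hu v hv, hphi1 v hv u hu, neg_zero]
    · intro u hu v hv; rw [hphi1 u hu v hv]; linarith
    · rw [hk1]; omega
    -- Initially φ = 0, and each coordinate of x is a difference of two values of f, so ζ⁻(V) ≥
    -- −2nM, while f(∅) = 0.
    · have := negSum_le_add (n := n) (z := fun _ => 0) (z' := zeta n (s1.real .x) (s1.real .phi))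
        (d := 2 * M) (by linarith) (by
          intro v hv
          have h0 : ∑ w ∈ range n, s1.real .phi w v = 0 :=
            sum_eq_zero fun w hw => hphi1 w (mem_range.1 hw) v hv
          rw [zeta, h0]
          linarith [(abs_le.1 (hx1 v hv)).1])
      rw [hO.empty]
      simp only [negSum, min_self, sum_const_zero] at this ⊢
      nlinarith
  have hstart : 1 ≤ M * (n * n) := by nlinarith [mul_le_mul hn1 hn1 zero_le_one (by linarith)]
  obtain ⟨s2, tr, e2, htr, hn2, hmin⟩ :=
    exec_phases hO hn p M s1 (by linarith) hready hp (Or.inr hstart)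
  obtain ⟨s3, m3, e3, hout, hm3⟩ := wp_writeOut (O := O) hn2
  refine ⟨s3, tr, m1, m3, (Exec.seq _ _ _ _ _ _ _ e1 (.seq _ _ _ _ _ _ _ e2
    (.seq _ _ _ _ _ _ _ e3 (.skip _)))).cast (by simp), htr, by omega, by omega, fun Y => ?_⟩
  rw [hO.congr (X := {v | s3.nat .out v 0 ≠ 0}) (Y := outSet n s2) hout]
  exact hmin Y

/-! ### From the set function on `V` to an oracle on numbers -/

section

variable {V : Type*} [Fintype V] [DecidableEq V]

theorem isOracle_oracle (e : Fin (Fintype.card V) ≃ V) {f : Finset V → ℤ} (hf : IsSubmodular f)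
    (h0 : f ∅ = 0) (hM : ∀ X : Finset V, |(f X : ℝ)| ≤ M) :
    IsOracle (oracle e f) (Fintype.card V) M where
  submod X Y := by
    have := hf (vertices e X) (vertices e Y)
    have e1 : vertices e (X ∪ Y) = vertices e X ∪ vertices e Y := by ext; simp [vertices]
    have e2 : vertices e (X ∩ Y) = vertices e X ∩ vertices e Y := by ext; simp [vertices]
    simp only [oracle, e1, e2]
    exact_mod_cast this
  empty := by
    have e1 : vertices e ∅ = ∅ := by ext; simp [vertices]
    simp [oracle, e1, h0]
  bound X := hM _
  inter X := by
    have e1 : vertices e (X ∩ Set.Iio (Fintype.card V)) = vertices e X := by ext; simp [vertices]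
    simp [oracle, e1]
  int X := ⟨_, rfl⟩

end

/-- The number of phases is logarithmic. -/
theorem exists_lt_two_pow {n : ℕ} {M : ℝ} (hn : 1 ≤ n) (hM : 1 ≤ M) (hnM : 2 ≤ n * M) :
    ∃ p : ℕ, 1 ≤ p ∧ M * (n * n) < 2 ^ p ∧ (p : ℝ) ≤ 6 * Real.log (n * M) := by
  have hlog2 := Real.log_two_gt_d9
  have hL : Real.log 2 ≤ Real.log (n * M) := Real.log_le_log two_pos hnM
  -- This uses M ≥ 1 and turns the number of halvings, log₂(Mn²), into at most 2 log₂(nM).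
  have hle : M * (n * n) ≤ (n * M) ^ 2 := by
    have : n * n * M ≤ n * n * M * M := le_mul_of_one_le_right (by positivity) hM
    nlinarith
  set r := 2 * Real.log (n * M) / Real.log 2 with hr
  have hr0 : 0 ≤ r := div_nonneg (by linarith) (by linarith)
  refine ⟨⌊r⌋₊ + 1, by omega, ?_, ?_⟩
  · refine hle.trans_lt ?_
    have h1 : r < (⌊r⌋₊ + 1 : ℕ) := by exact_mod_cast Nat.lt_floor_add_one r
    rw [← Real.log_lt_log_iff (by positivity) (by positivity), Real.log_pow, Real.log_pow]
    rw [hr, div_lt_iff₀ (by linarith)] at h1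
    exact_mod_cast h1
  · have h1 : (⌊r⌋₊ : ℝ) ≤ r := Nat.floor_le hr0
    -- Here 2 / log 2 ≤ 3; the final + 1 is absorbed by another 3 log(nM), since nM ≥ 2 and 3 log 2
    -- ≥ 1.
    have h2 : r ≤ 3 * Real.log (n * M) := by
      rw [hr, div_le_iff₀ (by linarith)]
      nlinarith
    push_cast
    linarith

end SFM

/-! ### The main theorem; the arbitrary numbering `e` accounts for the arbitrary initial ordering -/

theorem mainTheorem2 :
    ∃ C : ℝ, 0 < C ∧
      ∀ (V : Type*) [Fintype V] [DecidableEq V] [Nonempty V]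
        (e : Fin (Fintype.card V) ≃ V) (f : Finset V → ℤ) (M : ℝ),
        IsSubmodular f → f ∅ = 0 → (∀ X : Finset V, |(f X : ℝ)| ≤ M) →
        1 ≤ M → 2 ≤ (Fintype.card V : ℝ) * M →
        ∃ (s : SFM.Mem) (tr : List SFM.Event),
          SFM.Exec (SFM.oracle e f) SFM.algorithm (SFM.input (Fintype.card V) M) s tr ∧
          (∀ Y : Finset V, f (SFM.output e s) ≤ f Y) ∧
          (tr.count SFM.Event.step : ℝ) ≤
            C * (Fintype.card V : ℝ) ^ 5 * Real.log (Fintype.card V * M) ∧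
          (tr.count (SFM.Event.mark .phase) : ℝ) ≤ C * Real.log (Fintype.card V * M) ∧
          (∀ w : List SFM.Event, w <:+: tr → SFM.Event.mark .phase ∉ w →
            (w.count (SFM.Event.mark .augmentation) : ℝ) ≤ C * (Fintype.card V : ℝ) ^ 2) ∧
          (∀ w : List SFM.Event, w <:+: tr → SFM.Event.mark .phase ∉ w →
            SFM.Event.mark .augmentation ∉ w →
            (w.length : ℝ) ≤ C * (Fintype.card V : ℝ) ^ 3) := by
  -- The largest requirement is the total step count: 15 · 30310 = 454650 times n⁵ per unit of p,
  -- with p ≤ 6 log(nM).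
  refine ⟨10 ^ 7, by norm_num, ?_⟩
  intro V _ _ _ e f M hf h0 hfM hM hnM
  have hO := SFM.isOracle_oracle e hf h0 hfM
  have hvert : ∀ Y : Finset V, ∃ Q : Set ℕ, SFM.vertices e Q = Y := by
    refine fun Y => ⟨{m | ∃ v ∈ Y, (e.symm v : ℕ) = m}, ?_⟩
    ext v
    simp [SFM.vertices, Fin.val_inj]
  set n := Fintype.card V
  have hn : 1 ≤ n := Fintype.card_pos
  obtain ⟨p, hp1, hp2, hp3⟩ := SFM.exists_lt_two_pow hn hM hnM
  obtain ⟨s, tr, m, m', he, htr, hm, hm', hmin⟩ :=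
    SFM.exec_algorithm hO hn hM hp2 (s := SFM.input n M) (by simp [SFM.input]) (by simp [SFM.input])
  refine ⟨s, _, he, ?_, ?_, ?_, ?_, ?_⟩
  · intro Y
    obtain ⟨Q, hQ⟩ := hvert Y
    have := hmin Q
    simp only [SFM.oracle, hQ] at this
    exact_mod_cast this
  · set B := 30310 * (n * (n * n)) with hB
    have hstep : (SFM.steps m ++ (tr ++ SFM.steps m')).count .step ≤
        p * ((10 * (n * n) + 2) * B) + 3 * B := by
      have := htr.step
      simp
      omega
    -- Because p ≥ 1 and n ≥ 1, the terms 2pB and 3B together fit into 5pn²B.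
    have hle : p * ((10 * (n * n) + 2) * B) + 3 * B ≤ p * (15 * (n * n * B)) := by
      have h1 : B ≤ n * n * B := Nat.le_mul_of_pos_left _ (by positivity)
      have h3 := Nat.mul_le_mul_left p h1
      nlinarith
    have h4 : ((SFM.steps m ++ (tr ++ SFM.steps m')).count .step : ℝ) ≤
        p * (454650 * n ^ 5) := by
      refine (Nat.cast_le.2 (hstep.trans hle)).trans (le_of_eq ?_)
      rw [hB]
      push_cast
      ring
    have h5 := mul_le_mul_of_nonneg_right hp3 (by positivity : (0 : ℝ) ≤ 454650 * n ^ 5)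
    linarith
  · have : ((tr.count (SFM.Event.mark .phase) : ℕ) : ℝ) ≤ p := by exact_mod_cast htr.phase
    simp
    linarith
  · intro w hw h
    have := htr.aug (SFM.steps m) (by simp) m' w hw h
    have : (w.count (SFM.Event.mark .augmentation) : ℝ) ≤ 10 * (n * n) := by exact_mod_cast this
    nlinarith
  · intro w hw h h'
    have := htr.gap m (by omega) m' hm' w hw h h'
    have : (w.length : ℝ) ≤ 6 * (30310 * (n * (n * n))) := by exact_mod_cast this
    have h3 : (0 : ℝ) ≤ n ^ 3 := by positivity
    nlinarith
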